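/- **Setting.** Let $p$ be a prime, $k$ a perfect field of characteristic $p$, $K_0=\operatorname{Frac}W(k)$ with Frobenius $\sigma$, $K$ a totally ramified finite extension of $K_0$, and $F$ a finite extension of $\mathbb{Q}_p$ of degree $d$. A *filtered isocrystal over $K$ with coefficients in $F$* is $(\mathcal N,\iota)=(N,\varphi,\mathrm{Fil}^\bullet N_K,\iota)$, where $N$ is a finite-dimensional $K_0$-vector space, $\varphi\colon N\to N$ is bijective and $\sigma$-linear, $\mathrm{Fil}^\bullet$ is a decreasing, exhaustive and separated $\mathbb Z$-filtration of $N_K=N\otimes_{K_0}K$ by $K$-subspaces, and $\iota$ is a $\mathbb{Q}_p$-algebra map from $F$ to the endomorphisms of $(N,\varphi,\mathrm{Fil}^\bullet N_K)$. Subobjects are given by the $\varphi$-stable subspaces $N'\subseteq N$ (that is, $\varphi(N')=N'$), also $\iota$-stable when coefficients are considered, with the induced filtration; quotients carry the quotient filtration. Put $\operatorname{ht}=\dim_{K_0}N$, $t_N(\mathcal N)=v_p(\det\varphi)$ and $t_H(\mathcal N)=\sum_i i\dim_K \mathrm{gr}^i N_K$. The object is *weakly admissible* if $t_H(\mathcal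 N')\le t_N(\mathcal N')$ for all subobjects $\mathcal N'$ of $\mathcal N$ (neglecting $\iota$), with equality for $\mathcal N'=\mathcal N$. **Polygons.** A decreasing $n$-tuple $(a_1,\dots,a_n)$ of rational numbers is identified with the concave polygon on $[0,n]$ that starts at $(0,0)$ and has slope $a_i$ on $[i-1,i]$; break points are interior points where the slope changes. Write $\operatorname{ht}=dn$. * $\mathrm{Newt}(\mathcal N,\iota)$ has slopes $-\lambda$ with multiplicity $\dim_{K_0}N_\lambda/d$, where $N=\bigoplus_\lambda N_\lambda$ is the slope decomposition of $(N,\varphi)$. Here $(N_\lambda,\varphi)$ is isotypical of slope $\lambda$: there are integers $r$ and $s>0$ with $\lambda=r/s$ and a $W(k)$-lattice $M\subseteq N_\lambda$ with $\varphi^sM=p^rM$. * $\mathrm{Hdg}(\mathcal N,\iota)=\frac1d\sum_\tau f_\tau$, where $\tau$ runs over the $\mathbb{Q}_p$-embeddings of $F$ into an algebraic closure $\overline K$ of $K$, $N_\tau\subseteq N\otimes_{K_0}\overline K$ is the subspace on which $F$ acts through $\tau$, and $f_\tau$ is the decreasing tuple in which $-i$ occurs $\dim_{\overline K}\mathrm{gr}^iN_\tau$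 times, for the filtration of $N_\tau$ induced by $\mathrm{Fil}^\bullet$. * For $(\mathcal N,\iota)$ weakly admissible, let $0=\mathcal N_0'\subsetneq\dots\subsetneq\mathcal N_m'=\mathcal N$ be the Harder–Narasimhan filtration of $\mathcal N$ by weakly admissible subobjects for the slope $\mu=-t_N/\operatorname{ht}$: the successive quotients are semi-stable, of strictly decreasing slopes. (A nonzero weakly admissible object is semi-stable if none of its nonzero weakly admissible subobjects has larger slope.) Then $\mathrm{HN}(\mathcal N,\iota)$ has slopes $\mu(\mathcal N_i'/\mathcal N_{i-1}')$ with multiplicity $\operatorname{ht}(\mathcal N_i'/\mathcal N_{i-1}')/d$. The subobject corresponding to a break point $z$ of this polygon is the step $\mathcal N_i'$ with $(\operatorname{ht}(\mathcal N_i')/d,\,-t_N(\mathcal N_i')/d)=z$. **Proposition 3.7.** Let $(\mathcal N,\iota)$ be a weakly admissible filtered isocrystal over $K$ with coefficients in $F$ which is Hodge–Newton reducible at $z=(x,y)$, i.e. $z$ is a break point of $\mathrm{Newt}(\mathcal N,\iota)$ that also lies on $\mathrm{Hdg}(\mathcal N,\iota)$. Then: 1. $z$ is a break point of $\mathrm{HN}(\mathcal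 N,\iota)$, and there is exactly one corresponding subobject $\mathcal N_1$ in the Harder–Narasimhan filtration. 2. $\mathcal N_1$ is $\iota$-stable; writing $(\mathcal N_1,\iota_1)$ for it with the restricted $F$-action and $(\mathcal N_2,\iota_2)$ for the quotient of $(\mathcal N,\iota)$ by it, both $(\mathcal N_1,\iota_1)$ and $(\mathcal N_2,\iota_2)$ are weakly admissible. 3. $\mathrm{Newt}(\mathcal N_1,\iota_1)$ and $\mathrm{Hdg}(\mathcal N_1,\iota_1)$ are the restrictions of $\mathrm{Newt}(\mathcal N,\iota)$ and $\mathrm{Hdg}(\mathcal N,\iota)$ to $[0,x]$. 4. $\mathrm{Newt}(\mathcal N_2,\iota_2)$ and $\mathrm{Hdg}(\mathcal N_2,\iota_2)$ are the rest of $\mathrm{Newt}(\mathcal N,\iota)$ and $\mathrm{Hdg}(\mathcal N,\iota)$ after $z$, i.e. on $[0,n-x]$ they are the functions $t\mapsto \mathrm{Newt}(\mathcal N,\iota)(t+x)-y$ and $t\mapsto \mathrm{Hdg}(\mathcal N,\iota)(t+x)-y$. -/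

import Mathlib

open scoped TensorProduct

noncomputable section

namespace HodgeNewton

/-! ### Polygons -/

/-- The polygon `[0, n] → ℝ` attached to an `n`-tuple of slopes: it starts at `(0, 0)` and proceeds
with slope `a_i` on the `i`-th unit interval. (Outside `[0, n]` it is extended by constants; only
the values on `[0, n]` are ever used.) -/
def polygon (a : List ℚ) (t : ℝ) : ℝ :=
  ∑ i : Fin a.length, ((a.get i : ℚ) : ℝ) * max 0 (min 1 (t - (i : ℕ)))

/-- `z` is a break point of the polygon of `a`: an interior point of the polygon around whose
abscissa the polygon is not affine linear. -/
def IsBreakPoint (a : List ℚ) (z : ℝ × ℝ) : Prop :=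
  0 < z.1 ∧ z.1 < a.length ∧ polygon a z.1 = z.2 ∧
    ¬ ∃ c m : ℝ, ∀ᶠ t in nhds z.1, polygon a t = c + m * t

/-- `z` lies on (the graph over `[0, n]` of) the polygon of `a`. -/
def LiesOn (a : List ℚ) (z : ℝ × ℝ) : Prop :=
  0 ≤ z.1 ∧ z.1 ≤ a.length ∧ polygon a z.1 = z.2

/-- The polygon of `b` is the restriction of the polygon of `a` to `[0, x]`. -/
def IsRestriction (b a : List ℚ) (x : ℝ) : Prop :=
  (b.length : ℝ) = x ∧ ∀ t ∈ Set.Icc 0 x, polygon b t = polygon a t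

/-- The polygon of `b` is the rest of the polygon of `a` after the point `z`, that is
`t ↦ a(t + x) - y` on `[0, n - x]`, where `z = (x, y)`. -/
def IsRest (b a : List ℚ) (z : ℝ × ℝ) : Prop :=
  (b.length : ℝ) = a.length - z.1 ∧
    ∀ t ∈ Set.Icc 0 ((a.length : ℝ) - z.1), polygon b t = polygon a (t + z.1) - z.2

/-! ### Filtered vector spaces -/

/-- A decreasing, exhaustive and separated `ℤ`-filtration of a vector space. -/
structure VecFiltration (L V : Type*) [Field L] [AddCommGroup V] [Module L V] where
  Fil : ℤ → Submodule L V
  antitone : Antitone Fil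
  exhaustive : ∃ i, Fil i = ⊤
  separated : ∃ j, Fil j = ⊥

namespace VecFiltration

section

variable {L V W : Type*} [Field L] [AddCommGroup V] [Module L V] [AddCommGroup W] [Module L W]

/-- The filtration induced on a subspace, given as the source of an injective linear map. -/
def comap (𝓕 : VecFiltration L V) (f : W →ₗ[L] V) (hf : Function.Injective f) :
    VecFiltration L W where
  Fil i := (𝓕.Fil i).comap f
  antitone _ _ h := Submodule.comap_mono (𝓕.antitone h)
  exhaustive := by
    obtain ⟨i, hi⟩ := 𝓕.exhaustive
    exact ⟨i, by rw [hi, Submodule.comap_top]⟩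
  separated := by
    obtain ⟨j, hj⟩ := 𝓕.separated
    exact ⟨j, by rw [hj, Submodule.comap_bot, LinearMap.ker_eq_bot.mpr hf]⟩

/-- The filtration induced on a quotient, given as the target of a surjective linear map. -/
def map (𝓕 : VecFiltration L V) (f : V →ₗ[L] W) (hf : Function.Surjective f) :
    VecFiltration L W where
  Fil i := (𝓕.Fil i).map f
  antitone _ _ h := Submodule.map_mono (𝓕.antitone h)
  exhaustive := by
    obtain ⟨i, hi⟩ := 𝓕.exhaustive
    exact ⟨i, by rw [hi, Submodule.map_top, LinearMap.range_eq_top.mpr hf]⟩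
  separated := by
    obtain ⟨j, hj⟩ := 𝓕.separated
    exact ⟨j, by rw [hj, Submodule.map_bot]⟩

/-- The filtration induced on `L' ⊗ V` for a field extension `L'` of `L`. -/
def baseChange (𝓕 : VecFiltration L V) (L' : Type*) [Field L'] [Algebra L L'] :
    VecFiltration L' (L' ⊗[L] V) where
  Fil i := (𝓕.Fil i).baseChange L'
  antitone _ _ h := Submodule.baseChange_mono L' (𝓕.antitone h)
  exhaustive := by
    obtain ⟨i, hi⟩ := 𝓕.exhaustive
    exact ⟨i, by rw [hi, Submodule.baseChange_top]⟩
  separated := by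
    obtain ⟨j, hj⟩ := 𝓕.separated
    exact ⟨j, by rw [hj, Submodule.baseChange_bot]⟩

/-- The dimension of the graded piece `gr^i = Fil^i / Fil^{i+1}`. -/
def grDim (𝓕 : VecFiltration L V) (i : ℤ) : ℕ :=
  Module.finrank L (𝓕.Fil i ⧸ (𝓕.Fil (i + 1)).submoduleOf (𝓕.Fil i))

/-- The degree `∑ i · dim gr^i` of a filtration. -/
def degree (𝓕 : VecFiltration L V) : ℤ := ∑ᶠ i : ℤ, i * (𝓕.grDim i : ℤ)

/-- The type of a filtration: the numbers `-i`, each with multiplicity `dim gr^i`, in decreasing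
order. -/
def type (𝓕 : VecFiltration L V) : List ℚ :=
  (∑ᶠ i : ℤ, Multiset.replicate (𝓕.grDim i) (-(i : ℚ))).sort (· ≥ ·)

end

end VecFiltration

/-! ### The field `K₀` -/

section Witt

variable (p : ℕ) [Fact p.Prime] (k : Type*) [Field k] [CharP k p]

/-- The fraction field `K₀` of the ring of Witt vectors `W(k)`. -/
abbrev K₀ := FractionRing (WittVector p k)

/-- The embedding `ℤ_p = W(𝔽_p) → W(k) → K₀`. -/
def padicIntToK₀ : ℤ_[p] →+* K₀ p k :=
  ((algebraMap (WittVector p k) (K₀ p k)).comp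
    (WittVector.map (ZMod.castHom (dvd_refl p) k))).comp
      ((WittVector.equiv p).symm : ℤ_[p] →+* WittVector p (ZMod p))

theorem padicIntToK₀_injective : Function.Injective (padicIntToK₀ p k) := by
  intro x y h
  apply (WittVector.equiv p).symm.injective
  apply WittVector.map_injective (ZMod.castHom (dvd_refl p) k)
    (RingHom.injective (ZMod.castHom (dvd_refl p) k))
  exact IsFractionRing.injective (WittVector p k) (K₀ p k) h

/-- The canonical embedding `ℚ_p → K₀`. -/
def padicToK₀ : ℚ_[p] →+* K₀ p k := IsFractionRing.lift (padicIntToK₀_injective p k)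

variable [PerfectRing k p]

/-- The `p`-adic valuation of `K₀`, normalised by `v_p(p) = 1` (and with `v_p(0) = 0` by
convention). -/
def vp (x : K₀ p k) : ℤ :=
  -WithZero.log ((IsDiscreteValuationRing.maximalIdeal (WittVector p k)).valuation (K₀ p k) x)

/-- `K` is a totally ramified finite extension of `K₀`: the extension of the maximal ideal of
`W(k)` to the integral closure of `W(k)` in `K` is the `[K : K₀]`-th power of a maximal ideal. -/
def IsTotallyRamified (K : Type*) [Field K] [Algebra (K₀ p k) K] : Prop :=
  letI : Algebra (WittVector p k) K :=
    ((algebraMap (K₀ p k) K).comp (algebraMap (WittVector p k) (K₀ p k))).toAlgebra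
  FiniteDimensional (K₀ p k) K ∧
    ∃ P : Ideal (integralClosure (WittVector p k) K), P.IsMaximal ∧
      (IsLocalRing.maximalIdeal (WittVector p k)).map
        (algebraMap (WittVector p k) (integralClosure (WittVector p k) K)) =
          P ^ Module.finrank (K₀ p k) K

end Witt

/-! ### Filtered isocrystals -/

section Filtered

variable (p : ℕ) [Fact p.Prime] (k : Type*) [Field k] [CharP k p] [PerfectRing k p]

/-- A structure of filtered isocrystal over `K` on a `K₀`-vector space `N`: a bijective Frobenius
semilinear endomorphism `φ` of `N` and a filtration of `N_K = K ⊗ N`. -/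
structure FilteredIsocrystal (K : Type*) [Field K] [Algebra (K₀ p k) K]
    (N : Type*) [AddCommGroup N] [Module (K₀ p k) N] where
  φ : N →ₛₗ[WittVector.FractionRing.frobeniusRingHom p k] N
  bijective : Function.Bijective φ
  fil : VecFiltration K (K ⊗[K₀ p k] N)

namespace FilteredIsocrystal

variable {p k} {K : Type*} [Field K] [Algebra (K₀ p k) K]
  {N : Type*} [AddCommGroup N] [Module (K₀ p k) N]

/-- `A ⊆ N` underlies a sub-isocrystal, i.e. `φ` restricts to a bijection of `A`. Together with the induced filtration, these are exactly
the subobjects of a filtered isocrystal. -/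
def IsStable (X : FilteredIsocrystal p k K N) (A : Submodule (K₀ p k) N) : Prop :=
  ∀ v, X.φ v ∈ A ↔ v ∈ A

theorem baseChange_subtype_injective (K : Type*) [Field K] [Algebra (K₀ p k) K]
    (A : Submodule (K₀ p k) N) : Function.Injective (A.subtype.baseChange K) :=
  Module.Flat.lTensor_preserves_injective_linearMap A.subtype A.injective_subtype

theorem baseChange_mkQ_surjective (K : Type*) [Field K] [Algebra (K₀ p k) K]
    (A : Submodule (K₀ p k) N) : Function.Surjective (A.mkQ.baseChange K) :=
  LinearMap.lTensor_surjective K A.mkQ_surjective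

/-- The subobject of a filtered isocrystal with underlying space `A`. -/
def sub (X : FilteredIsocrystal p k K N) (A : Submodule (K₀ p k) N) (hA : X.IsStable A) :
    FilteredIsocrystal p k K A where
  φ := (X.φ.domRestrict A).codRestrict A fun v => (hA v).2 v.2
  bijective := by
    constructor
    · intro v w h
      exact Subtype.ext (X.bijective.1 (congrArg Subtype.val h))
    · intro w
      obtain ⟨v, hv⟩ := X.bijective.2 (w : N)
      exact ⟨⟨v, (hA v).1 (hv ▸ w.2)⟩, Subtype.ext hv⟩
  fil := X.fil.comap (A.subtype.baseChange K) (baseChange_subtype_injective K A)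

/-- The quotient of a filtered isocrystal by its subobject with underlying space `A`. -/
def quot (X : FilteredIsocrystal p k K N) (A : Submodule (K₀ p k) N) (hA : X.IsStable A) :
    FilteredIsocrystal p k K (N ⧸ A) where
  φ := A.mapQ A X.φ fun v hv => (hA v).2 hv
  bijective := by
    constructor
    · rw [injective_iff_map_eq_zero]
      intro v
      induction v using Submodule.Quotient.induction_on with
      | _ v =>
        intro h
        rw [Submodule.mapQ_apply, Submodule.Quotient.mk_eq_zero] at h
        rw [Submodule.Quotient.mk_eq_zero]
        exact (hA v).1 h
    · intro w
      induction w using Submodule.Quotient.induction_on with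
      | _ w =>
        obtain ⟨v, rfl⟩ := X.bijective.2 w
        exact ⟨Submodule.Quotient.mk v, Submodule.mapQ_apply _ _ _ _⟩
  fil := X.fil.map (A.mkQ.baseChange K) (baseChange_mkQ_surjective K A)

theorem isStable_submoduleOf (X : FilteredIsocrystal p k K N) {A B : Submodule (K₀ p k) N}
    (hA : X.IsStable A) (hB : X.IsStable B) : (X.sub B hB).IsStable (A.submoduleOf B) :=
  fun v => hA (v : N)

/-- The subquotient `B / A`, for stable subspaces `A ⊆ B`. -/
def subquot (X : FilteredIsocrystal p k K N) (A B : Submodule (K₀ p k) N)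
    (hA : X.IsStable A) (hB : X.IsStable B) :
    FilteredIsocrystal p k K (B ⧸ A.submoduleOf B) :=
  (X.sub B hB).quot (A.submoduleOf B) (X.isStable_submoduleOf hA hB)

/-- The sub-isocrystal with underlying space `A` is isotypical of slope `l = r / s`: there is a
`W(k)`-lattice `M` in `A` with `φ^s M = p^r M`. -/
def IsIsotypical (X : FilteredIsocrystal p k K N) (A : Submodule (K₀ p k) N) (l : ℚ) : Prop :=
  letI : Module (WittVector p k) N :=
    Module.compHom N (algebraMap (WittVector p k) (K₀ p k))
  X.IsStable A ∧ ∃ r s : ℤ, 0 < s ∧ l = (r : ℚ) / (s : ℚ) ∧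
    ∃ M : Submodule (WittVector p k) N, M.FG ∧
      Submodule.span (K₀ p k) (M : Set N) = A ∧
      (X.φ)^[s.toNat] '' (M : Set N) = (fun v => ((p : K₀ p k) ^ r) • v) '' (M : Set N)

/-- A slope decomposition `N = ⨁ N_λ`: `slope 0 < slope 1 < ⋯` are the slopes which appear
nontrivially and `comp i` is the isotypical component of slope `slope i`. -/
structure SlopeDecomposition (X : FilteredIsocrystal p k K N) where
  m : ℕ
  slope : Fin m → ℚ
  strictMono : StrictMono slope
  comp : Fin m → Submodule (K₀ p k) N
  ne_bot : ∀ i, comp i ≠ ⊥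
  isotypical : ∀ i, X.IsIsotypical (comp i) (slope i)
  isInternal : DirectSum.IsInternal comp

section FiniteDim

variable [FiniteDimensional (K₀ p k) N]

/-- The Newton number `t_N = v_p(det φ)`, computed from the matrix of `φ` in a basis. -/
def tN (X : FilteredIsocrystal p k K N) : ℤ :=
  vp p k (Matrix.of fun i j : Fin (Module.finrank (K₀ p k) N) =>
    (Module.finBasis (K₀ p k) N).repr (X.φ (Module.finBasis (K₀ p k) N j)) i).det

/-- The Hodge number `t_H = deg(Fil)`. -/
def tH (X : FilteredIsocrystal p k K N) : ℤ := X.fil.degree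

/-- The slope `μ = -t_N / ht`. -/
def mu (X : FilteredIsocrystal p k K N) : ℚ :=
  -(X.tN : ℚ) / (Module.finrank (K₀ p k) N : ℚ)

/-- Weak admissibility: `t_H ≤ t_N` for all subobjects, with equality for the whole object. -/
def IsWeaklyAdmissible (X : FilteredIsocrystal p k K N) : Prop :=
  (∀ (A : Submodule (K₀ p k) N) (hA : X.IsStable A), (X.sub A hA).tH ≤ (X.sub A hA).tN) ∧
    X.tH = X.tN

/-- Semi-stability of a nonzero weakly admissible filtered isocrystal, tested on its nonzero weakly
admissible subobjects. -/
def IsSemistable (X : FilteredIsocrystal p k K N) : Prop :=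
  Nontrivial N ∧ X.IsWeaklyAdmissible ∧
    ∀ (A : Submodule (K₀ p k) N) (hA : X.IsStable A), A ≠ ⊥ →
      (X.sub A hA).IsWeaklyAdmissible → (X.sub A hA).mu ≤ X.mu

/-- A Harder-Narasimhan filtration `0 = C 0 ⊊ C 1 ⊊ ⋯ ⊊ C m = N` by weakly admissible subobjects,
with semi-stable successive quotients of strictly decreasing slopes. -/
structure HNFiltration (X : FilteredIsocrystal p k K N) where
  m : ℕ
  C : Fin (m + 1) → Submodule (K₀ p k) N
  bot : C 0 = ⊥
  top : C (Fin.last m) = ⊤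
  strictMono : StrictMono C
  stable : ∀ i, X.IsStable (C i)
  weaklyAdmissible : ∀ i, (X.sub (C i) (stable i)).IsWeaklyAdmissible
  semistable : ∀ i : Fin m,
    (X.subquot (C i.castSucc) (C i.succ) (stable _) (stable _)).IsSemistable
  slope_strictAnti : StrictAnti fun i : Fin m =>
    (X.subquot (C i.castSucc) (C i.succ) (stable _) (stable _)).mu

end FiniteDim

end FilteredIsocrystal

/-! ### Coefficients -/

/-- A structure of filtered isocrystal over `K` with coefficients in `F` on `N`: a filtered
isocrystal with a `ℚ_p`-algebra map `ι` from `F` to its endomorphism ring. -/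
structure FilteredIsocrystalWithCoeff (K : Type*) [Field K] [Algebra (K₀ p k) K]
    (F : Type*) [Field F] [Algebra ℚ_[p] F]
    (N : Type*) [AddCommGroup N] [Module (K₀ p k) N]
    extends FilteredIsocrystal p k K N where
  ι : F →+* Module.End (K₀ p k) N
  ι_padic : ∀ (a : ℚ_[p]) (v : N), ι (algebraMap ℚ_[p] F a) v = padicToK₀ p k a • v
  ι_φ : ∀ (a : F) (v : N), ι a (φ v) = φ (ι a v)
  ι_fil : ∀ (a : F) (i : ℤ), ∀ v ∈ fil.Fil i, (ι a).baseChange K v ∈ fil.Fil i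

namespace FilteredIsocrystalWithCoeff

variable {p k} {K : Type*} [Field K] [Algebra (K₀ p k) K]
  {F : Type*} [Field F] [Algebra ℚ_[p] F]
  {N : Type*} [AddCommGroup N] [Module (K₀ p k) N]

/-- `A ⊆ N` is stable under `φ` and under the action of `F`. -/
structure IsStable (X : FilteredIsocrystalWithCoeff p k K F N) (A : Submodule (K₀ p k) N) :
    Prop where
  stable : X.toFilteredIsocrystal.IsStable A
  ι_stable : ∀ (a : F), ∀ v ∈ A, X.ι a v ∈ A

/-- The subobject with underlying space `A`. -/
def sub (X : FilteredIsocrystalWithCoeff p k K F N) (A : Submodule (K₀ p k) N)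
    (hA : X.IsStable A) : FilteredIsocrystalWithCoeff p k K F A where
  toFilteredIsocrystal := X.toFilteredIsocrystal.sub A hA.stable
  ι :=
    { toFun := fun a => (X.ι a).restrict (hA.ι_stable a)
      map_one' := by ext v; simp
      map_mul' := fun a b => by ext v; simp
      map_zero' := by ext v; simp
      map_add' := fun a b => by ext v; simp }
  ι_padic a v := Subtype.ext (X.ι_padic a v)
  ι_φ a v := Subtype.ext (X.ι_φ a v)
  ι_fil a i v hv := by
    have h := X.ι_fil a i _ hv
    change A.subtype.baseChange K (((X.ι a).restrict (hA.ι_stable a)).baseChange K v) ∈ X.fil.Fil i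
    rw [← LinearMap.comp_apply, ← LinearMap.baseChange_comp] at h ⊢
    exact h

/-- The quotient by the subobject with underlying space `A`. -/
def quot (X : FilteredIsocrystalWithCoeff p k K F N) (A : Submodule (K₀ p k) N)
    (hA : X.IsStable A) : FilteredIsocrystalWithCoeff p k K F (N ⧸ A) where
  toFilteredIsocrystal := X.toFilteredIsocrystal.quot A hA.stable
  ι :=
    { toFun := fun a => A.mapQ A (X.ι a) (hA.ι_stable a)
      map_one' := by ext v; simp
      map_mul' := fun a b => by ext v; simp
      map_zero' := by ext v; simp
      map_add' := fun a b => by ext v; simp }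
  ι_padic a v := by
    induction v using Submodule.Quotient.induction_on with
    | _ v => exact congrArg (Submodule.Quotient.mk (p := A)) (X.ι_padic a v)
  ι_φ a v := by
    induction v using Submodule.Quotient.induction_on with
    | _ v => exact congrArg (Submodule.Quotient.mk (p := A)) (X.ι_φ a v)
  ι_fil a i v hv := by
    obtain ⟨w, hw, rfl⟩ := hv
    refine ⟨_, X.ι_fil a i w hw, ?_⟩
    change A.mkQ.baseChange K ((X.ι a).baseChange K w) =
      (A.mapQ A (X.ι a) (hA.ι_stable a)).baseChange K (A.mkQ.baseChange K w)
    rw [← LinearMap.comp_apply, ← LinearMap.comp_apply, ← LinearMap.baseChange_comp,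
      ← LinearMap.baseChange_comp]
    rfl

/-- The underlying filtered isocrystal is weakly admissible. -/
def IsWeaklyAdmissible [FiniteDimensional (K₀ p k) N]
    (X : FilteredIsocrystalWithCoeff p k K F N) : Prop :=
  X.toFilteredIsocrystal.IsWeaklyAdmissible

open Classical in
/-- The Newton polygon: the negatives of the slopes `λ` of the slope decomposition of `(N, φ)`,
each with multiplicity `dim N_λ / d`, where `d = [F : ℚ_p]`. The slope decomposition exists (and is
unique) because `k` is perfect. -/
def newton (X : FilteredIsocrystalWithCoeff p k K F N) : List ℚ :=
  if h : Nonempty X.toFilteredIsocrystal.SlopeDecomposition then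
    (List.ofFn fun i : Fin h.some.m => List.replicate
      (Module.finrank (K₀ p k) (h.some.comp i) / Module.finrank ℚ_[p] F)
      (-(h.some.slope i))).flatten
  else []

variable (p k K F) in
/-- The embeddings of `F` over `ℚ_p` into the algebraic closure of `K`. -/
def Embedding : Type _ :=
  {τ : F →+* AlgebraicClosure K // ∀ a : ℚ_[p], τ (algebraMap ℚ_[p] F a) =
    algebraMap K (AlgebraicClosure K) (algebraMap (K₀ p k) K (padicToK₀ p k a))}

/-- For `K'` the algebraic closure of `K`, the subspace `N_τ` of `N_{K'} = K' ⊗ N_K` on which `F`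
acts through the embedding `τ`. -/
def eigenspace (X : FilteredIsocrystalWithCoeff p k K F N) (τ : Embedding p k K F) :
    Submodule (AlgebraicClosure K) (AlgebraicClosure K ⊗[K] (K ⊗[K₀ p k] N)) :=
  ⨅ a : F, LinearMap.ker
    (((X.ι a).baseChange K).baseChange (AlgebraicClosure K) - τ.1 a • LinearMap.id)

/-- The filtration of `N_τ` induced by the one of `N_{K'}`. -/
def eigenFil (X : FilteredIsocrystalWithCoeff p k K F N) (τ : Embedding p k K F) :
    VecFiltration (AlgebraicClosure K) (X.eigenspace τ) :=
  (X.fil.baseChange (AlgebraicClosure K)).comap (X.eigenspace τ).subtype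
    (X.eigenspace τ).injective_subtype

/-- The Hodge polygon `(1/d) ∑_τ f_τ`, of length `n = ht / d`, where `f_τ` is the type
of `N_τ` with its filtration and `d = [F : ℚ_p]`. -/
def hodge (X : FilteredIsocrystalWithCoeff p k K F N) : List ℚ :=
  List.ofFn fun i : Fin (Module.finrank (K₀ p k) N / Module.finrank ℚ_[p] F) =>
    (1 / (Module.finrank ℚ_[p] F : ℚ)) *
      ∑ᶠ τ : Embedding p k K F, (X.eigenFil τ).type.getD (i : ℕ) 0

/-- A (weakly admissible) object is Hodge-Newton reducible at `z` if `z` is a break point of the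
Newton polygon which also lies on the Hodge polygon. -/
def IsHodgeNewtonReducibleAt (X : FilteredIsocrystalWithCoeff p k K F N) (z : ℝ × ℝ) : Prop :=
  IsBreakPoint X.newton z ∧ LiesOn X.hodge z

variable [FiniteDimensional (K₀ p k) N]

open Classical in
/-- The Harder-Narasimhan polygon: the slopes of the successive quotients of the Harder-Narasimhan
filtration, each with multiplicity the height of the quotient divided by `d = [F : ℚ_p]`. -/
def hn (X : FilteredIsocrystalWithCoeff p k K F N) : List ℚ :=
  if h : Nonempty X.toFilteredIsocrystal.HNFiltration then
    (List.ofFn fun i : Fin h.some.m => List.replicate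
      (Module.finrank (K₀ p k)
        (h.some.C i.succ ⧸ (h.some.C i.castSucc).submoduleOf (h.some.C i.succ)) /
          Module.finrank ℚ_[p] F)
      (X.toFilteredIsocrystal.subquot (h.some.C i.castSucc) (h.some.C i.succ)
        (h.some.stable _) (h.some.stable _)).mu).flatten
  else []

/-- `A` underlies the subobject corresponding to the point `z` of the Harder-Narasimhan polygon:
it is a step of the Harder-Narasimhan filtration and `(ht A / d, -t_N(A) / d) = z`, where
`d = [F : ℚ_p]`. -/
def IsHNSubobjectAt (X : FilteredIsocrystalWithCoeff p k K F N) (z : ℝ × ℝ)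
    (A : Submodule (K₀ p k) N) : Prop :=
  ∃ (H : X.toFilteredIsocrystal.HNFiltration) (i : Fin (H.m + 1)), H.C i = A ∧
    (Module.finrank (K₀ p k) (H.C i) : ℝ) / (Module.finrank ℚ_[p] F : ℝ) = z.1 ∧
    -((X.toFilteredIsocrystal.sub (H.C i) (H.stable i)).tN : ℝ) /
      (Module.finrank ℚ_[p] F : ℝ) = z.2

end FilteredIsocrystalWithCoeff

end Filtered

end HodgeNewton

end

/-!
For a rational number `c` put `deg c B = c * ht B - t_N(B)` for stable subspaces `B` of `N`. Since
`ht` and `t_N` are additive on `B ↦ (B ⊔ B', B ⊓ B')`, so is `deg c`, and a subspace that maximises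
`deg c` for two different values of `c` is determined by its height and Newton number
(`eq_of_deg_le`). The proof exhibits one subspace `A` as such a maximiser in two ways.

*Newton polygon.* A break point `z` of the Newton polygon separates the slopes of `(N, φ)` into
those below and those above some `c`; let `A` be the sum of the isotypical components of the small
slopes (`SlopeDecomposition.part`). A lattice `M` with `φ^s M ⊆ p^r M`, or with `p^r M ⊆ φ^s M`,
bounds the Newton number of its span, as is seen from the determinant of `φ^s` on a basis of `M`
(`SlopesGE.le_tN`, `SlopesLE.tN_le`). Hence `A` maximises `deg c` among all stable subspaces, for
all `c` in an interval with more than one point (`SlopeDecomposition.deg_le_part`). It is stable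
under `F` and splits the Newton polygon at `z` (`exists_newton_eq_append`).

*Hodge polygon.* All the spaces `N_τ` have the same dimension: the characteristic polynomial of
`ι(a)` is invariant under the Frobenius, so it has coefficients in `ℚ_p`, and the conjugates of a
primitive element of `F` are roots of the same multiplicity (`finrank_eigenspace_mul`). The
filtrations of the `N_τ` are exact in `N` (`finrank_eigenFil_eq`), so that `-t_H(A) / d` is at most
the value of the Hodge polygon at `ht A / d` (`neg_tH_sub_le`). If `z` lies on the Hodge polygon,
then together with `t_H(A) ≤ t_N(A)` all these inequalities are equalities. So `A` and `N / A` are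
weakly admissible, and for every `τ` the filtration of `A_τ` carries the first slopes of the one of
`N_τ`; thus the Hodge polygon splits at `z` as well (`hodge_eq_append_of_liesOn`).

*Harder-Narasimhan polygon.* Among the weakly admissible subobjects, `deg c` is maximised by the
step of the Harder-Narasimhan filtration at which the slopes pass `-c` (`HNFiltration.deg_le`). For
`c` inside the interval above, uniqueness shows that this step is `A` (`exists_hn_step`). Every step
is a common maximiser of two degree functions, so it is stable under `F`
(`isStable_hn_step`). Hence all heights are divisible by `d`, and the polygon breaks at each proper
step (`isBreakPoint_hn`). A Harder-Narasimhan filtration exists since the slope decomposition bounds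
the Newton numbers of stable subspaces from below (`nonempty_hnFiltration`).
-/

noncomputable section

namespace HodgeNewton

/-! ### Polygons of lists of slopes -/

theorem polygon_nil (t : ℝ) : polygon [] t = 0 := by simp [polygon]

theorem polygon_cons (s : ℚ) (l : List ℚ) (t : ℝ) :
    polygon (s :: l) t = s * max 0 (min 1 t) + polygon l (t - 1) := by
  unfold polygon
  refine (Fin.sum_univ_succ (n := l.length) _).trans ?_
  simp [sub_sub, add_comm]

theorem polygon_of_nonpos (l : List ℚ) {t : ℝ} (ht : t ≤ 0) : polygon l t = 0 := by
  unfold polygon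
  refine Finset.sum_eq_zero fun i _ => ?_
  have : (0 : ℝ) ≤ (i : ℕ) := Nat.cast_nonneg _
  rw [max_eq_left ((min_le_right _ _).trans (by linarith)), mul_zero]

theorem polygon_of_length_le (l : List ℚ) {t : ℝ} (ht : (l.length : ℝ) ≤ t) :
    polygon l t = (l.sum : ℚ) := by
  induction l generalizing t with
  | nil => simp [polygon_nil]
  | cons s l ih =>
    rw [List.length_cons, Nat.cast_succ] at ht
    have h0 : (0 : ℝ) ≤ l.length := Nat.cast_nonneg _
    rw [polygon_cons, ih (by linarith), min_eq_left (by linarith), max_eq_right zero_le_one]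
    simp

theorem polygon_append (l l' : List ℚ) (t : ℝ) :
    polygon (l ++ l') t = polygon l t + polygon l' (t - l.length) := by
  induction l generalizing t with
  | nil => simp [polygon_nil]
  | cons s l ih =>
    rw [List.cons_append, polygon_cons, polygon_cons, ih, List.length_cons, Nat.cast_succ]
    ring_nf

theorem isRestriction_append (l l' : List ℚ) {x : ℝ} (hx : (l.length : ℝ) = x) :
    IsRestriction l (l ++ l') x := by
  refine ⟨hx, fun t ht => ?_⟩
  rw [polygon_append, polygon_of_nonpos l' (by linarith [ht.2]), add_zero]

theorem isRest_append (l l' : List ℚ) {z : ℝ × ℝ} (hx : (l.length : ℝ) = z.1)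
    (hy : ((l.sum : ℚ) : ℝ) = z.2) : IsRest l' (l ++ l') z := by
  refine ⟨by rw [List.length_append, ← hx]; push_cast; ring, fun t ht => ?_⟩
  rw [polygon_append, polygon_of_length_le l (by linarith [ht.1]), hx, hy]
  ring_nf

theorem polygon_natCast_eq_sum_take (l : List ℚ) {q : ℕ} (hq : q ≤ l.length) :
    polygon l q = ((l.take q).sum : ℚ) := by
  conv_lhs => rw [← List.take_append_drop q l]
  rw [polygon_append, polygon_of_length_le _ (by simp), polygon_of_nonpos _ (by simp [hq]),
    add_zero]

/-- Near a point strictly inside a unit interval the polygon is affine linear. -/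
theorem polygon_eventually_linear_of_mem_Ioo (l : List ℚ) {q : ℕ} {x : ℝ}
    (h : x ∈ Set.Ioo (q : ℝ) (q + 1)) :
    ∃ c m : ℝ, ∀ᶠ t in nhds x, polygon l t = c + m * t := by
  induction l generalizing q x with
  | nil => exact ⟨0, 0, by simp [polygon_nil]⟩
  | cons s l ih =>
    rcases q with _ | q
    · refine ⟨0, s, ?_⟩
      filter_upwards [isOpen_Ioo.mem_nhds h] with t ht
      simp only [Nat.cast_zero, zero_add, Set.mem_Ioo] at ht
      rw [polygon_cons, polygon_of_nonpos _ (by linarith), min_eq_right ht.2.le,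
        max_eq_right ht.1.le]
      ring
    · obtain ⟨c, m, hcm⟩ := ih (q := q) (x := x - 1)
        ⟨by have := h.1; push_cast at this; linarith, by have := h.2; push_cast at this; linarith⟩
      have hc : Filter.Tendsto (fun t : ℝ => t - 1) (nhds x) (nhds (x - 1)) :=
        (continuous_id.sub continuous_const).tendsto x
      refine ⟨s + c - m, m, ?_⟩
      filter_upwards [isOpen_Ioo.mem_nhds h, hc.eventually hcm] with t ht ht'
      have h1 : (1 : ℝ) ≤ t := by
        have := ht.1; push_cast at this; linarith [(Nat.cast_nonneg q : (0 : ℝ) ≤ q)]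
      rw [polygon_cons, ht', min_eq_left h1, max_eq_right zero_le_one]
      ring

/-- The polygon of a list in two pieces, near the point where the pieces meet. -/
theorem polygon_append_cons_near (l l' : List ℚ) (a b : ℚ) {t : ℝ}
    (ht : t ∈ Set.Ioo (l.length : ℝ) (l.length + 2)) :
    polygon (l ++ a :: b :: l') t =
      (l.sum : ℚ) + a * min 1 (t - l.length) + b * max 0 (t - l.length - 1) := by
  rw [polygon_append, polygon_of_length_le l ht.1.le, polygon_cons, polygon_cons,
    polygon_of_nonpos l' (by linarith [ht.2]), min_eq_right (by linarith [ht.2] :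
      t - l.length - 1 ≤ 1), max_eq_right (le_min zero_le_one (by linarith [ht.1]))]
  ring

/-- A polygon breaks wherever two adjacent slopes differ. -/
theorem isBreakPoint_of_append {l l' : List ℚ} {a b : ℚ} (hab : a ≠ b) :
    IsBreakPoint (l ++ a :: b :: l') ((l.length + 1 : ℕ), ((l.sum + a : ℚ) : ℝ)) := by
  refine ⟨by simp; positivity, ?_, ?_, ?_⟩
  · simp only [List.length_append, List.length_cons]
    exact_mod_cast by omega
  · rw [polygon_append_cons_near _ _ _ _ ⟨by simp, by push_cast; linarith⟩]
    simp
  · rintro ⟨c, m, h⟩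
    apply hab
    simp only [Nat.cast_succ] at h
    have hm : Set.Ioo (l.length : ℝ) (l.length + 2) ∈ nhds ((l.length : ℝ) + 1) :=
      isOpen_Ioo.mem_nhds ⟨by linarith, by linarith⟩
    obtain ⟨ε, hε, hb⟩ := Metric.eventually_nhds_iff.mp (h.and hm)
    have key : ∀ u : ℝ, |u| < ε → ((l.sum : ℚ) + a * min 1 (1 + u) + b * max 0 u : ℝ) =
        c + m * (l.length + 1 + u) := by
      intro u hu
      obtain ⟨h1, h2⟩ := @hb (l.length + 1 + u) (by rw [Real.dist_eq]; ring_nf; exact hu)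
      rw [polygon_append_cons_near _ _ _ _ h2] at h1
      convert h1 using 4 <;> ring_nf
    have h0 := key 0 (by simpa using hε)
    have h1 := key (ε / 2) (by rw [abs_of_pos (by linarith)]; linarith)
    have h2 := key (-(ε / 2)) (by rw [abs_neg, abs_of_pos (by linarith)]; linarith)
    rw [min_eq_left (by linarith), max_eq_right (by linarith)] at h1
    rw [min_eq_right (by linarith), max_eq_left (by linarith)] at h2
    simp only [add_zero, min_self, mul_one, max_self, mul_zero] at h0
    have : ((a : ℝ) - b) * (ε / 2) = 0 := by linarith
    rcases mul_eq_zero.mp this with h | h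
    · exact_mod_cast sub_eq_zero.mp h
    · linarith

/-- A break point has integral abscissa, and the slopes on its two sides differ. -/
theorem IsBreakPoint.exists_append {l : List ℚ} {z : ℝ × ℝ} (h : IsBreakPoint l z) :
    ∃ (l₁ l₂ : List ℚ) (a b : ℚ), l = l₁ ++ a :: b :: l₂ ∧ a ≠ b ∧
      (((l₁ ++ [a]).length : ℕ) : ℝ) = z.1 ∧ (((l₁ ++ [a]).sum : ℚ) : ℝ) = z.2 := by
  obtain ⟨h0, h1, h2, h3⟩ := h
  obtain ⟨q, hq⟩ : ∃ q : ℕ, z.1 = q := by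
    by_contra! hne
    refine h3 (polygon_eventually_linear_of_mem_Ioo l (q := ⌊z.1⌋₊) ⟨?_, Nat.lt_floor_add_one _⟩)
    exact lt_of_le_of_ne (Nat.floor_le h0.le) (hne _).symm
  rw [hq] at h0 h1 h3
  obtain ⟨q, rfl⟩ : ∃ q', q = q' + 1 := Nat.exists_eq_succ_of_ne_zero (by
    rintro rfl; simp at h0)
  have hql : q + 1 < l.length := by exact_mod_cast h1
  have hsplit : l = l.take q ++ l[q] :: l[q + 1] :: l.drop (q + 2) := by
    conv_lhs => rw [← List.take_append_drop q l, List.drop_eq_getElem_cons (by omega),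
      List.drop_eq_getElem_cons hql]
  have hlen : (l.take q).length = q := by simp; omega
  have hne : l[q] ≠ l[q + 1] := by
    intro he
    refine h3 ⟨((l.take q).sum : ℚ) - l[q] * q, l[q], ?_⟩
    have hm : Set.Ioo (q : ℝ) (q + 2) ∈ nhds (((q + 1 : ℕ) : ℝ)) :=
      isOpen_Ioo.mem_nhds ⟨by push_cast; linarith, by push_cast; linarith⟩
    filter_upwards [hm] with t ht
    rw [(congrArg (polygon · t) hsplit).trans
      (polygon_append_cons_near _ _ _ _ (by rwa [hlen])), hlen, ← he]
    rcases le_total 1 (t - q) with h | h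
    · rw [min_eq_left h, max_eq_right (by linarith)]; ring
    · rw [min_eq_right h, max_eq_left (by linarith)]; ring
  refine ⟨l.take q, l.drop (q + 2), l[q], l[q + 1], hsplit, hne, ?_, ?_⟩
  · rw [List.length_append, hlen, hq]; simp
  · rw [hq, polygon_natCast_eq_sum_take l hql.le] at h2
    rw [← h2, List.take_succ_eq_append_getElem (by omega)]

/-! ### Decreasing lists of slopes -/

theorem sortedGE_append_of_lt {l l' : List ℚ} (hl : l.SortedGE) (hl' : l'.SortedGE)
    (h : ∀ a ∈ l, ∀ b ∈ l', b < a) : (l ++ l').SortedGE := by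
  rw [List.sortedGE_iff_pairwise] at *
  exact List.pairwise_append.mpr ⟨hl, hl', fun a ha b hb => (h a ha b hb).le⟩

theorem isBreakPoint_append_of_lt {l l' : List ℚ} (hl : l ≠ []) (hl' : l' ≠ [])
    (h : ∀ a ∈ l, ∀ b ∈ l', b < a) :
    IsBreakPoint (l ++ l') ((l.length : ℕ), ((l.sum : ℚ) : ℝ)) := by
  obtain ⟨b, l', rfl⟩ := List.exists_cons_of_ne_nil hl'
  obtain ⟨l, a, rfl⟩ : ∃ l₀ a, l = l₀ ++ [a] :=
    ⟨_, _, (List.dropLast_append_getLast hl).symm⟩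
  have := isBreakPoint_of_append (l := l) (l' := l') (h a (by simp) b (by simp)).ne'
  simpa using this

/-- A decreasing list is the concatenation of its parts above and below a gap. -/
theorem eq_append_of_coe_eq_add {l l₁ l₂ : List ℚ} (hl : l.SortedGE) (hl₁ : l₁.SortedGE)
    (hl₂ : l₂.SortedGE) (h : ∀ a ∈ l₁, ∀ b ∈ l₂, b < a)
    (hM : (l : Multiset ℚ) = (l₁ : Multiset ℚ) + (l₂ : Multiset ℚ)) : l = l₁ ++ l₂ :=
  List.Perm.eq_of_sortedGE hl (sortedGE_append_of_lt hl₁ hl₂ h)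
    (Multiset.coe_eq_coe.mp (by rw [hM, Multiset.coe_add]))

/-- A break point of a decreasing list of slopes is determined by a threshold `t`: it is the end
point of the part consisting of the slopes `≥ t`. -/
theorem IsBreakPoint.exists_threshold {l : List ℚ} (hl : l.SortedGE) {z : ℝ × ℝ}
    (h : IsBreakPoint l z) :
    ∃ t : ℚ, ((((l : Multiset ℚ).filter (t ≤ ·)).card : ℕ) : ℝ) = z.1 ∧
      ((((l : Multiset ℚ).filter (t ≤ ·)).sum : ℚ) : ℝ) = z.2 ∧
      (∃ a ∈ l, t ≤ a) ∧ ∃ a ∈ l, a < t := by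
  obtain ⟨l₁, l₂, a, b, rfl, hab, hx, hy⟩ := h.exists_append
  have hs := List.pairwise_append.mp (List.sortedGE_iff_pairwise.mp hl)
  have hab' : b < a := lt_of_le_of_ne
    ((List.pairwise_cons.mp hs.2.1).1 b (by simp)) hab.symm
  have h2 : (a :: b :: l₂).filter (a ≤ ·) = [a] := by
    rw [List.filter_cons_of_pos (by simp), List.filter_eq_nil_iff.mpr]
    intro c hc
    have : c ≤ b := by
      rcases List.mem_cons.mp hc with rfl | hc
      · exact le_rfl
      · exact (List.pairwise_cons.mp (List.pairwise_cons.mp hs.2.1).2).1 c hc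
    simpa using this.trans_lt hab'
  have h1 : l₁.filter (a ≤ ·) = l₁ :=
    List.filter_eq_self.mpr fun c hc => by simpa using hs.2.2 c hc a (by simp)
  have hf : (((l₁ ++ a :: b :: l₂ : List ℚ) : Multiset ℚ).filter (a ≤ ·)) =
      ((l₁ ++ [a] : List ℚ) : Multiset ℚ) := by
    rw [Multiset.filter_coe, List.filter_append, h1, h2]
  refine ⟨a, ?_, ?_, ⟨a, by simp, le_rfl⟩, b, by simp, hab'⟩
  · rw [hf, Multiset.coe_card, hx]
  · rw [hf, Multiset.sum_coe, hy]

theorem coe_flatten_ofFn {m : ℕ} (f : Fin m → List ℚ) :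
    ((List.ofFn f).flatten : Multiset ℚ) = ∑ i, (f i : Multiset ℚ) := by
  induction m with
  | zero => simp
  | succ m ih =>
    rw [List.ofFn_succ, List.flatten_cons, ← Multiset.coe_add, ih, Fin.sum_univ_succ]

theorem sortedGE_flatten_replicate {m : ℕ} (n : Fin m → ℕ) {s : Fin m → ℚ} (hs : Antitone s) :
    (List.ofFn fun i => List.replicate (n i) (s i)).flatten.SortedGE := by
  rw [List.sortedGE_iff_pairwise, List.pairwise_flatten]
  refine ⟨?_, ?_⟩
  · intro l hl
    obtain ⟨i, rfl⟩ := List.mem_ofFn.mp hl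
    exact List.pairwise_replicate.mpr (Or.inr le_rfl)
  · rw [List.pairwise_ofFn]
    intro i j hij a ha b hb
    rw [List.eq_of_mem_replicate ha, List.eq_of_mem_replicate hb]
    exact hs hij.le

theorem sortedGE_sort (s : Multiset ℚ) : (s.sort (· ≥ ·)).SortedGE :=
  List.sortedGE_iff_pairwise.mpr (Multiset.pairwise_sort s (· ≥ ·))

theorem sort_add_eq_append {s u : Multiset ℚ} {l : List ℚ}
    (h : (s + u).sort (· ≥ ·) = s.sort (· ≥ ·) ++ l) : l = u.sort (· ≥ ·) := by
  refine List.Perm.eq_of_sortedGE ?_ (sortedGE_sort u) (Multiset.coe_eq_coe.mp ?_)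
  · have := sortedGE_sort (s + u)
    rw [h, List.sortedGE_iff_pairwise] at this
    exact List.sortedGE_iff_pairwise.mpr (List.pairwise_append.mp this).2.1
  · have := congrArg (fun l : List ℚ => (l : Multiset ℚ)) h
    simp only [Multiset.sort_eq, ← Multiset.coe_add] at this
    rw [Multiset.sort_eq]
    exact (add_left_cancel this).symm

/-- The `i`-th largest element of a submultiset is at most the `i`-th largest element. -/
theorem sort_getElem_le (s u : Multiset ℚ) {i : ℕ} (hi : i < (s.sort (· ≥ ·)).length)
    (hi' : i < ((s + u).sort (· ≥ ·)).length) :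
    (s.sort (· ≥ ·))[i] ≤ ((s + u).sort (· ≥ ·))[i] := by
  have hsub : List.Sublist (s.sort (· ≥ ·)) ((s + u).sort (· ≥ ·)) := by
    refine List.sublist_of_subperm_of_sortedGE ?_ (sortedGE_sort _) (sortedGE_sort _)
    rw [← Multiset.coe_le, Multiset.sort_eq, Multiset.sort_eq]
    exact Multiset.le_add_right s u
  obtain ⟨f, hf⟩ := List.sublist_iff_exists_fin_orderEmbedding_get_eq.mp hsub
  have h1 : i ≤ (f ⟨i, hi⟩ : ℕ) := by
    have key : ∀ j (hj : j < (s.sort (· ≥ ·)).length), j ≤ (f ⟨j, hj⟩ : ℕ) := by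
      intro j
      induction j with
      | zero => intro _; exact Nat.zero_le _
      | succ j ih =>
        intro hj
        have h2 := ih (by omega)
        have h3 : f ⟨j, by omega⟩ < f ⟨j + 1, hj⟩ := f.strictMono (by simp [Fin.lt_def])
        have h4 : (f ⟨j, by omega⟩ : ℕ) < (f ⟨j + 1, hj⟩ : ℕ) := h3
        omega
    exact key i hi
  have h2 := hf ⟨i, hi⟩
  rw [List.get_eq_getElem] at h2
  rw [h2]
  exact (sortedGE_sort (s + u)).antitone_get (a := ⟨i, hi'⟩) (b := f ⟨i, hi⟩) h1

/-- The sum of `m` entries of a multiset is at most the sum of its `m` largest entries. -/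
theorem sum_sort_le_sum_take (s u : Multiset ℚ) :
    s.sum ≤ (((s + u).sort (· ≥ ·)).take s.card).sum := by
  have hlen : (((s + u).sort (· ≥ ·)).take s.card).length = (s.sort (· ≥ ·)).length := by
    simp
  conv_lhs => rw [← Multiset.sort_eq s (· ≥ ·), Multiset.sum_coe]
  refine List.Forall₂.sum_le_sum (List.forall₂_iff_get.mpr ⟨hlen.symm, fun i hi hi' => ?_⟩)
  rw [List.get_eq_getElem, List.get_eq_getElem, List.getElem_take]
  exact sort_getElem_le s u hi _

/-- If the sum of a submultiset is as large as its cardinality allows, then it consists of the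
largest elements. -/
theorem sort_eq_append_of_sum_eq (s u : Multiset ℚ)
    (h : (((s + u).sort (· ≥ ·)).take s.card).sum ≤ s.sum) :
    (s + u).sort (· ≥ ·) = s.sort (· ≥ ·) ++ u.sort (· ≥ ·) := by
  have hlen : (((s + u).sort (· ≥ ·)).take s.card).length = (s.sort (· ≥ ·)).length := by
    simp
  have htake : s.sort (· ≥ ·) = ((s + u).sort (· ≥ ·)).take s.card := by
    refine List.ext_getElem hlen.symm fun i hi hi' => ?_
    have key : ∀ (l l' : List ℚ) (hl : l.length = l'.length),
        (∀ i (hi : i < l.length) (hi' : i < l'.length), l[i] ≤ l'[i]) → l'.sum ≤ l.sum →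
        ∀ i (hi : i < l.length) (hi' : i < l'.length), l[i] = l'[i] := by
      intro l
      induction l with
      | nil => intro l' _ _ _ i hi; simp at hi
      | cons a l ih =>
        intro l' hl hle hsum
        rcases l' with _ | ⟨b, l'⟩
        · simp at hl
        have hl' : l.length = l'.length := by simpa using hl
        have h0 : a ≤ b := hle 0 (by simp) (by simp)
        have hle' : ∀ i (hi : i < l.length) (hi' : i < l'.length), l[i] ≤ l'[i] :=
          fun i hi hi' => hle (i + 1) (by simpa using hi) (by simpa using hi')
        have h1 : l.sum ≤ l'.sum :=
          List.Forall₂.sum_le_sum (List.forall₂_iff_get.mpr ⟨hl', fun i hi hi' => hle' i hi hi'⟩)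
        rw [List.sum_cons, List.sum_cons] at hsum
        intro i hi hi'
        rcases i with _ | i
        · change a = b
          exact le_antisymm h0 (by linarith)
        · exact ih l' hl' hle' (by linarith) i (by simpa using hi) (by simpa using hi')
    refine key _ _ hlen.symm (fun j hj hj' => ?_) ?_ i hi hi'
    · rw [List.getElem_take]
      exact sort_getElem_le s u hj _
    · rwa [← Multiset.sum_coe (s.sort _), Multiset.sort_eq]
  have := List.take_append_drop s.card ((s + u).sort (· ≥ ·))
  rw [← htake] at this
  rw [← this, sort_add_eq_append this.symm]

/-! ### Splitting polygons given by slopes with multiplicities -/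

theorem coe_flatten_replicate {m : ℕ} (n : Fin m → ℕ) (s : Fin m → ℚ) :
    ((List.ofFn fun i => List.replicate (n i) (s i)).flatten : Multiset ℚ) =
      ∑ i, Multiset.replicate (n i) (s i) := by
  rw [coe_flatten_ofFn]
  exact Finset.sum_congr rfl fun i _ => Multiset.coe_replicate _ _

theorem mem_sort_sum_replicate {ι : Type*} {J : Finset ι} {n : ι → ℕ} {s : ι → ℚ} {a : ℚ}
    (h : a ∈ (∑ i ∈ J, Multiset.replicate (n i) (s i)).sort (· ≥ ·)) : ∃ i ∈ J, a = s i := by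
  rw [Multiset.mem_sort, Multiset.mem_sum] at h
  obtain ⟨i, hi, h⟩ := h
  exact ⟨i, hi, Multiset.eq_of_mem_replicate h⟩

/-- If the slopes with index in `J` are larger than the others, then the sorted list of all slopes
is the concatenation of those with index in `J` and of the others. -/
theorem eq_sort_append_sort {ι : Type*} [Fintype ι] [DecidableEq ι] {n : ι → ℕ} {s : ι → ℚ}
    {J : Finset ι} (hJ : ∀ i ∈ J, ∀ i' ∉ J, s i' < s i) {l : List ℚ} (hl : l.SortedGE)
    (hls : (l : Multiset ℚ) = ∑ i, Multiset.replicate (n i) (s i)) :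
    l = (∑ i ∈ J, Multiset.replicate (n i) (s i)).sort (· ≥ ·) ++
      (∑ i ∈ Jᶜ, Multiset.replicate (n i) (s i)).sort (· ≥ ·) := by
  refine eq_append_of_coe_eq_add hl (sortedGE_sort _) (sortedGE_sort _) ?_ ?_
  · intro a ha b hb
    obtain ⟨i, hi, rfl⟩ := mem_sort_sum_replicate ha
    obtain ⟨i', hi', rfl⟩ := mem_sort_sum_replicate hb
    exact hJ i hi i' (Finset.mem_compl.mp hi')
  · rw [Multiset.sort_eq, Multiset.sort_eq, hls, Finset.sum_add_sum_compl]

theorem length_sort_sum_replicate {ι : Type*} (J : Finset ι) (n : ι → ℕ) (s : ι → ℚ) :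
    ((∑ i ∈ J, Multiset.replicate (n i) (s i)).sort (· ≥ ·)).length = ∑ i ∈ J, n i := by
  rw [Multiset.length_sort, Multiset.card_sum]
  exact Finset.sum_congr rfl fun i _ => Multiset.card_replicate _ _

theorem sum_sort_sum_replicate {ι : Type*} (J : Finset ι) (n : ι → ℕ) (s : ι → ℚ) :
    ((∑ i ∈ J, Multiset.replicate (n i) (s i)).sort (· ≥ ·)).sum = ∑ i ∈ J, n i * s i := by
  rw [← Multiset.sum_coe, Multiset.sort_eq]
  have := map_sum (Multiset.sumAddMonoidHom (M := ℚ)) (fun i => Multiset.replicate (n i) (s i)) J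
  simp only [Multiset.coe_sumAddMonoidHom, Multiset.sum_replicate, nsmul_eq_mul] at this
  exact this

theorem sum_filter_castSucc_lt {m : ℕ} (g : Fin (m + 1) → ℚ) (j : Fin (m + 1)) :
    ∑ i : Fin m with i.castSucc < j, (g i.succ - g i.castSucc) = g j - g 0 := by
  classical
  induction j using Fin.induction with
  | zero => simp
  | succ j ih =>
    have h : (Finset.univ.filter fun i : Fin m => i.castSucc < j.succ) =
        insert j (Finset.univ.filter fun i : Fin m => i.castSucc < j.castSucc) := by
      ext i
      simp only [Finset.mem_filter, Finset.mem_univ, true_and, Finset.mem_insert, Fin.lt_def,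
        Fin.ext_iff, Fin.val_castSucc, Fin.val_succ]
      omega
    rw [h, Finset.sum_insert (by simp), ih]
    ring

end HodgeNewton

namespace HodgeNewton

/-! ### Degrees and types of filtrations -/

namespace VecFiltration

open Module

variable {L V W U : Type*} [Field L] [AddCommGroup V] [Module L V] [AddCommGroup W] [Module L W]
  [AddCommGroup U] [Module L U]

theorem exists_bounds (𝓕 : VecFiltration L V) :
    ∃ (a : ℤ) (n : ℕ), 𝓕.Fil a = ⊤ ∧ 𝓕.Fil (a + n) = ⊥ := by
  obtain ⟨a, ha⟩ := 𝓕.exhaustive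
  obtain ⟨b, hb⟩ := 𝓕.separated
  refine ⟨a, (b - a).toNat, ha, ?_⟩
  rw [eq_bot_iff, ← hb]
  exact 𝓕.antitone (by have := Int.self_le_toNat (b - a); linarith)

section

variable [FiniteDimensional L V] [FiniteDimensional L W] [FiniteDimensional L U]

theorem grDim_eq (𝓕 : VecFiltration L V) (i : ℤ) :
    (𝓕.grDim i : ℤ) = finrank L (𝓕.Fil i) - finrank L (𝓕.Fil (i + 1)) := by
  have h := Submodule.finrank_quotient_add_finrank ((𝓕.Fil (i + 1)).submoduleOf (𝓕.Fil i))
  rw [(Submodule.submoduleOfEquivOfLe (𝓕.antitone (by omega : i ≤ i + 1))).finrank_eq] at h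
  rw [grDim]
  omega

theorem grDim_eq_zero_of_notMem {𝓕 : VecFiltration L V} {a : ℤ} {n : ℕ} (ha : 𝓕.Fil a = ⊤)
    (hb : 𝓕.Fil (a + n) = ⊥) {i : ℤ} (hi : i ∉ Finset.Ico a (a + n)) : 𝓕.grDim i = 0 := by
  have h := 𝓕.grDim_eq i
  rw [Finset.mem_Ico, not_and_or, not_le, not_lt] at hi
  rcases hi with hi | hi
  · have h1 : 𝓕.Fil i = ⊤ := eq_top_iff.mpr (ha ▸ 𝓕.antitone hi.le)
    have h2 : 𝓕.Fil (i + 1) = ⊤ := eq_top_iff.mpr (ha ▸ 𝓕.antitone (by omega))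
    rw [h1, h2, sub_self] at h
    exact_mod_cast h
  · have h1 : 𝓕.Fil i = ⊥ := eq_bot_iff.mpr (hb ▸ 𝓕.antitone hi)
    have h2 : 𝓕.Fil (i + 1) = ⊥ := eq_bot_iff.mpr (hb ▸ 𝓕.antitone (by omega))
    rw [h1, h2, sub_self] at h
    exact_mod_cast h

theorem grDim_support_finite (𝓕 : VecFiltration L V) : {i | 𝓕.grDim i ≠ 0}.Finite := by
  obtain ⟨a, n, ha, hb⟩ := 𝓕.exists_bounds
  refine (Finset.Ico a (a + n)).finite_toSet.subset fun i hi => ?_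
  by_contra h
  exact hi (grDim_eq_zero_of_notMem ha hb h)

theorem sum_Ico_int (f : ℤ → ℤ) (a : ℤ) (n : ℕ) :
    ∑ i ∈ Finset.Ico a (a + n), i * (f i - f (i + 1)) =
      a * f a - (a + n) * f (a + n) + ∑ j ∈ Finset.range n, f (a + j + 1) := by
  induction n with
  | zero => simp
  | succ n ih =>
    have : Finset.Ico a (a + (n + 1 : ℕ)) = insert (a + n) (Finset.Ico a (a + n)) := by
      ext i; simp only [Finset.mem_Ico, Finset.mem_insert]; push_cast; omega
    rw [this, Finset.sum_insert (by simp), ih, Finset.sum_range_succ]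
    push_cast
    ring_nf

theorem degree_eq {𝓕 : VecFiltration L V} {a : ℤ} {n : ℕ} (ha : 𝓕.Fil a = ⊤)
    (hb : 𝓕.Fil (a + n) = ⊥) :
    𝓕.degree = a * finrank L V +
      ∑ j ∈ Finset.range n, (finrank L (𝓕.Fil (a + j + 1)) : ℤ) := by
  have h := sum_Ico_int (fun i => (finrank L (𝓕.Fil i) : ℤ)) a n
  rw [ha, hb, finrank_top, finrank_bot, Nat.cast_zero, mul_zero, sub_zero] at h
  rw [← h, degree, finsum_eq_sum_of_support_subset (s := Finset.Ico a (a + n))]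
  · exact Finset.sum_congr rfl fun i _ => by rw [grDim_eq]
  · intro i hi
    by_contra h
    exact hi (by simp only [grDim_eq_zero_of_notMem ha hb h, Nat.cast_zero, mul_zero])

/-- The multiset underlying the type of a filtration. -/
def typeMultiset (𝓕 : VecFiltration L V) : Multiset ℚ :=
  ∑ᶠ i : ℤ, Multiset.replicate (𝓕.grDim i) (-(i : ℚ))

omit [FiniteDimensional L V] in
theorem type_eq_sort (𝓕 : VecFiltration L V) : 𝓕.type = 𝓕.typeMultiset.sort (· ≥ ·) := rfl

theorem typeMultiset_support_finite (𝓕 : VecFiltration L V) :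
    (Function.support fun i : ℤ => Multiset.replicate (𝓕.grDim i) (-(i : ℚ))).Finite :=
  𝓕.grDim_support_finite.subset fun i hi h => hi (by simp [h])

theorem degree_support_finite (𝓕 : VecFiltration L V) :
    (Function.support fun i : ℤ => i * (𝓕.grDim i : ℤ)).Finite :=
  𝓕.grDim_support_finite.subset fun i hi h => hi (by simp [h])

theorem sum_typeMultiset (𝓕 : VecFiltration L V) : 𝓕.typeMultiset.sum = -(𝓕.degree : ℚ) := by
  have h1 := (Multiset.sumAddMonoidHom : Multiset ℚ →+ ℚ).map_finsum 𝓕.typeMultiset_support_finite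
  have h2 := (Int.castAddHom ℚ).map_finsum 𝓕.degree_support_finite
  change 𝓕.typeMultiset.sum = _ at h1
  change (𝓕.degree : ℚ) = _ at h2
  rw [h1, h2, ← finsum_neg_distrib]
  refine finsum_congr fun i => ?_
  simp [mul_comm]

theorem card_typeMultiset (𝓕 : VecFiltration L V) : 𝓕.typeMultiset.card = finrank L V := by
  obtain ⟨a, n, ha, hb⟩ := 𝓕.exists_bounds
  have h1 := (Multiset.cardHom : Multiset ℚ →+ ℕ).map_finsum 𝓕.typeMultiset_support_finite
  change 𝓕.typeMultiset.card = _ at h1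
  rw [h1, finsum_eq_sum_of_support_subset (s := Finset.Ico a (a + n))]
  · have key : ∀ n : ℕ, ∑ i ∈ Finset.Ico a (a + n), (𝓕.grDim i : ℤ) =
        finrank L (𝓕.Fil a) - finrank L (𝓕.Fil (a + n)) := by
      intro n
      induction n with
      | zero => rw [Nat.cast_zero, add_zero]; simp
      | succ n ih =>
        have : Finset.Ico a (a + (n + 1 : ℕ)) = insert (a + n) (Finset.Ico a (a + n)) := by
          ext i; simp only [Finset.mem_Ico, Finset.mem_insert]; push_cast; omega
        rw [this, Finset.sum_insert (by simp), ih, grDim_eq, Nat.cast_succ, add_assoc]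
        ring
    have := key n
    rw [ha, hb, finrank_top, finrank_bot] at this
    simp only [Multiset.cardHom_apply, Multiset.card_replicate]
    rw [Nat.cast_zero, sub_zero] at this
    exact_mod_cast this
  · intro i hi
    by_contra h
    exact hi (by simp [grDim_eq_zero_of_notMem ha hb h])

theorem length_type (𝓕 : VecFiltration L V) : 𝓕.type.length = finrank L V := by
  rw [type_eq_sort, Multiset.length_sort, card_typeMultiset]

end

/-! #### Additivity -/

section Additive

variable [FiniteDimensional L V] [FiniteDimensional L W] [FiniteDimensional L U]

theorem grDim_add {𝓕 : VecFiltration L V} {𝓖 : VecFiltration L W} {𝓗 : VecFiltration L U}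
    (h : ∀ i, finrank L (𝓕.Fil i) = finrank L (𝓖.Fil i) + finrank L (𝓗.Fil i)) (i : ℤ) :
    𝓕.grDim i = 𝓖.grDim i + 𝓗.grDim i := by
  have h1 := 𝓕.grDim_eq i
  have h2 := 𝓖.grDim_eq i
  have h3 := 𝓗.grDim_eq i
  have h4 := h i
  have h5 := h (i + 1)
  omega

theorem degree_add {𝓕 : VecFiltration L V} {𝓖 : VecFiltration L W} {𝓗 : VecFiltration L U}
    (h : ∀ i, finrank L (𝓕.Fil i) = finrank L (𝓖.Fil i) + finrank L (𝓗.Fil i)) :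
    𝓕.degree = 𝓖.degree + 𝓗.degree := by
  unfold degree
  rw [← finsum_add_distrib 𝓖.degree_support_finite 𝓗.degree_support_finite]
  exact finsum_congr fun i => by rw [grDim_add h]; push_cast; ring

theorem typeMultiset_add {𝓕 : VecFiltration L V} {𝓖 : VecFiltration L W} {𝓗 : VecFiltration L U}
    (h : ∀ i, finrank L (𝓕.Fil i) = finrank L (𝓖.Fil i) + finrank L (𝓗.Fil i)) :
    𝓕.typeMultiset = 𝓖.typeMultiset + 𝓗.typeMultiset := by
  unfold typeMultiset
  rw [← finsum_add_distrib 𝓖.typeMultiset_support_finite 𝓗.typeMultiset_support_finite]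
  exact finsum_congr fun i => by rw [grDim_add h, Multiset.replicate_add]

omit [FiniteDimensional L V] [FiniteDimensional L W] in
theorem finrank_comap {f : W →ₗ[L] V} (hf : Function.Injective f) (R : Submodule L V) :
    finrank L (R.comap f) = finrank L (LinearMap.range f ⊓ R : Submodule L V) := by
  rw [(Submodule.equivMapOfInjective f hf (R.comap f)).finrank_eq, Submodule.map_comap_eq]

omit [FiniteDimensional L W] [FiniteDimensional L U] in
/-- In a short exact sequence, with the induced filtrations on the outer terms, the dimensions of
the steps add up. -/
theorem finrank_fil_of_exact {𝓕 : VecFiltration L V} {𝓖 : VecFiltration L W}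
    {𝓗 : VecFiltration L U} {f : W →ₗ[L] V} {g : V →ₗ[L] U} (hf : Function.Injective f)
    (hfg : LinearMap.range f = LinearMap.ker g)
    (hG : ∀ i, 𝓖.Fil i = (𝓕.Fil i).comap f) (hH : ∀ i, 𝓗.Fil i = (𝓕.Fil i).map g) (i : ℤ) :
    finrank L (𝓕.Fil i) = finrank L (𝓖.Fil i) + finrank L (𝓗.Fil i) := by
  have h := LinearMap.finrank_range_add_finrank_ker (g.domRestrict (𝓕.Fil i))
  rw [← h, add_comm, hH, hG, LinearMap.range_domRestrict]
  congr 1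
  rw [finrank_comap hf, hfg, LinearMap.domRestrict, LinearMap.ker_comp,
    finrank_comap (𝓕.Fil i).injective_subtype, Submodule.range_subtype, inf_comm]

theorem degree_eq_sum {ι L' : Type*} [Fintype ι] [Field L'] {M : ι → Type*}
    [∀ j, AddCommGroup (M j)] [∀ j, Module L' (M j)] [∀ j, FiniteDimensional L' (M j)]
    {𝓕 : VecFiltration L V} {𝓖 : ∀ j, VecFiltration L' (M j)}
    (h : ∀ i, finrank L (𝓕.Fil i) = ∑ j, finrank L' ((𝓖 j).Fil i)) :
    𝓕.degree = ∑ j, (𝓖 j).degree := by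
  unfold degree
  rw [← finsum_sum_comm _ _ fun j _ => (𝓖 j).degree_support_finite]
  refine finsum_congr fun i => ?_
  rw [← Finset.mul_sum]
  congr 1
  rw [grDim_eq, h, h]
  push_cast
  rw [← Finset.sum_sub_distrib]
  exact Finset.sum_congr rfl fun j _ => ((𝓖 j).grDim_eq i).symm

end Additive

/-! #### Degrees of subspaces -/

section Sub

variable [FiniteDimensional L V] [FiniteDimensional L W]

/-- The degree of the filtration induced on a subspace. -/
def degreeOn (𝓕 : VecFiltration L V) (R : Submodule L V) : ℤ :=
  (𝓕.comap R.subtype R.injective_subtype).degree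

omit [FiniteDimensional L V] in
theorem degree_comap_eq {𝓕 : VecFiltration L V} {f : W →ₗ[L] V} (hf : Function.Injective f)
    {a : ℤ} {n : ℕ} (ha : 𝓕.Fil a = ⊤) (hb : 𝓕.Fil (a + n) = ⊥) :
    (𝓕.comap f hf).degree = a * finrank L (LinearMap.range f) +
      ∑ j ∈ Finset.range n,
        (finrank L (LinearMap.range f ⊓ 𝓕.Fil (a + j + 1) : Submodule L V) : ℤ) := by
  rw [degree_eq (𝓕 := 𝓕.comap f hf) (a := a) (n := n)]
  · rw [(LinearEquiv.ofInjective f hf).finrank_eq]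
    congr 1
    exact Finset.sum_congr rfl fun j _ => by rw [← finrank_comap hf]; rfl
  · change (𝓕.Fil a).comap f = ⊤
    rw [ha, Submodule.comap_top]
  · change (𝓕.Fil _).comap f = ⊥
    rw [hb, Submodule.comap_bot, LinearMap.ker_eq_bot.mpr hf]

omit [FiniteDimensional L V] in
theorem degree_comap (𝓕 : VecFiltration L V) {f : W →ₗ[L] V} (hf : Function.Injective f) :
    (𝓕.comap f hf).degree = 𝓕.degreeOn (LinearMap.range f) := by
  obtain ⟨a, n, ha, hb⟩ := 𝓕.exists_bounds
  rw [degreeOn, degree_comap_eq hf ha hb, degree_comap_eq _ ha hb, Submodule.range_subtype]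

theorem degreeOn_eq {𝓕 : VecFiltration L V} (R : Submodule L V) {a : ℤ} {n : ℕ}
    (ha : 𝓕.Fil a = ⊤) (hb : 𝓕.Fil (a + n) = ⊥) :
    𝓕.degreeOn R = a * finrank L R + ∑ j ∈ Finset.range n,
      (finrank L (R ⊓ 𝓕.Fil (a + j + 1) : Submodule L V) : ℤ) := by
  rw [degreeOn, degree_comap_eq _ ha hb, Submodule.range_subtype]

/-- The degree of subspaces is supermodular, because the dimension of the intersection with a fixed
subspace is. -/
theorem degreeOn_add_le (𝓕 : VecFiltration L V) (R S : Submodule L V) :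
    𝓕.degreeOn R + 𝓕.degreeOn S ≤ 𝓕.degreeOn (R ⊓ S) + 𝓕.degreeOn (R ⊔ S) := by
  obtain ⟨a, n, ha, hb⟩ := 𝓕.exists_bounds
  simp only [degreeOn_eq _ ha hb]
  have h1 : (finrank L (R ⊔ S : Submodule L V) : ℤ) + finrank L (R ⊓ S : Submodule L V) =
      finrank L R + finrank L S := mod_cast Submodule.finrank_sup_add_finrank_inf_eq R S
  have h2 : ∀ T : Submodule L V, (finrank L (R ⊓ T : Submodule L V) : ℤ) +
      finrank L (S ⊓ T : Submodule L V) ≤ finrank L (R ⊓ S ⊓ T : Submodule L V) +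
      finrank L ((R ⊔ S) ⊓ T : Submodule L V) := by
    intro T
    have h3 := Submodule.finrank_sup_add_finrank_inf_eq (R ⊓ T) (S ⊓ T)
    rw [← inf_inf_distrib_right] at h3
    have h4 : finrank L (R ⊓ T ⊔ S ⊓ T : Submodule L V) ≤
        finrank L ((R ⊔ S) ⊓ T : Submodule L V) :=
      Submodule.finrank_mono (sup_le (inf_le_inf_right _ le_sup_left)
        (inf_le_inf_right _ le_sup_right))
    omega
  have h5 := Finset.sum_le_sum fun (j : ℕ) (_ : j ∈ Finset.range n) => h2 (𝓕.Fil (a + j + 1))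
  rw [Finset.sum_add_distrib, Finset.sum_add_distrib] at h5
  have h6 : a * (finrank L (R ⊔ S : Submodule L V) : ℤ) +
      a * finrank L (R ⊓ S : Submodule L V) = a * finrank L R + a * finrank L S := by
    rw [← mul_add, h1, mul_add]
  linarith

/-- An injective filtered endomorphism does not decrease the degree of a subspace. -/
theorem degreeOn_le_degreeOn_map {𝓕 : VecFiltration L V} (e : V →ₗ[L] V)
    (he : Function.Injective e) (h : ∀ i, ∀ v ∈ 𝓕.Fil i, e v ∈ 𝓕.Fil i) (R : Submodule L V) :
    𝓕.degreeOn R ≤ 𝓕.degreeOn (R.map e) := by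
  obtain ⟨a, n, ha, hb⟩ := 𝓕.exists_bounds
  simp only [degreeOn_eq _ ha hb]
  rw [(Submodule.equivMapOfInjective e he R).finrank_eq]
  gcongr with j
  rw [(Submodule.equivMapOfInjective e he _).finrank_eq, Submodule.map_inf e he]
  exact Submodule.finrank_mono (inf_le_inf_left _ (Submodule.map_le_iff_le_comap.mpr (h _)))

end Sub

end VecFiltration

end HodgeNewton

namespace HodgeNewton

/-! ### Submodules and base change of vector spaces -/

section BaseChange

open Module

theorem range_baseChange_eq_ker {L : Type*} [Field L] {A B C : Type*} [AddCommGroup A] [Module L A]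
    [AddCommGroup B] [Module L B] [AddCommGroup C] [Module L C] (L' : Type*) [Field L']
    [Algebra L L'] {f : A →ₗ[L] B} {g : B →ₗ[L] C} (hg : Function.Surjective g)
    (h : LinearMap.range f = LinearMap.ker g) :
    LinearMap.range (f.baseChange L') = LinearMap.ker (g.baseChange L') := by
  have := lTensor_exact L' (LinearMap.exact_iff.mpr h.symm) hg
  ext v
  exact (this v).symm

theorem finrank_baseChange_submodule {L : Type*} [Field L] {M : Type*} [AddCommGroup M]
    [Module L M] (L' : Type*) [Field L'] [Algebra L L'] (S : Submodule L M) :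
    finrank L' (S.baseChange L') = finrank L S := by
  have h : Function.Injective (S.subtype.baseChange L') :=
    Module.Flat.lTensor_preserves_injective_linearMap S.subtype S.injective_subtype
  rw [Submodule.baseChange, LinearMap.finrank_range_of_inj h, Module.finrank_baseChange]

theorem baseChange_sup {L : Type*} [Field L] {M : Type*} [AddCommGroup M]
    [Module L M] (L' : Type*) [Field L'] [Algebra L L'] (S T : Submodule L M) :
    (S ⊔ T).baseChange L' = S.baseChange L' ⊔ T.baseChange L' := by
  refine le_antisymm ?_ (sup_le (Submodule.baseChange_mono L' le_sup_left)
    (Submodule.baseChange_mono L' le_sup_right))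
  rw [Submodule.baseChange_eq_span, Submodule.span_le]
  rintro _ ⟨v, hv, rfl⟩
  obtain ⟨a, ha, b, hb, rfl⟩ := Submodule.mem_sup.mp hv
  rw [map_add]
  exact Submodule.add_mem_sup (Submodule.tmul_mem_baseChange_of_mem 1 ha)
    (Submodule.tmul_mem_baseChange_of_mem 1 hb)

/-- The inclusion from left to right is clear, and the dimensions agree by the compatibility with
sums. -/
theorem baseChange_inf {L : Type*} [Field L] {M : Type*} [AddCommGroup M]
    [Module L M] [FiniteDimensional L M] (L' : Type*) [Field L'] [Algebra L L']
    (S T : Submodule L M) :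
    (S ⊓ T).baseChange L' = S.baseChange L' ⊓ T.baseChange L' := by
  refine Submodule.eq_of_le_of_finrank_eq (le_inf (Submodule.baseChange_mono L' inf_le_left)
    (Submodule.baseChange_mono L' inf_le_right)) ?_
  have h1 := Submodule.finrank_sup_add_finrank_inf_eq S T
  have h2 := Submodule.finrank_sup_add_finrank_inf_eq (S.baseChange L') (T.baseChange L')
  rw [← baseChange_sup] at h2
  simp only [finrank_baseChange_submodule] at h2 ⊢
  omega

/-- In a commutative square `iD ∘ g = q ∘ iE` with `g` surjective, `iD` injective and `ker q` in the
image of `iE`, as for a subquotient, the two ways to induce a filtration step on `D` agree. -/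
theorem map_comap_eq_comap_map {L : Type*} [Field L] {E Q D M : Type*} [AddCommGroup E]
    [Module L E] [AddCommGroup Q] [Module L Q] [AddCommGroup D] [Module L D] [AddCommGroup M]
    [Module L M] {iE : E →ₗ[L] M} {q : M →ₗ[L] Q} {iD : D →ₗ[L] Q} {g : E →ₗ[L] D}
    (hD : Function.Injective iD) (hg : Function.Surjective g) (hsq : iD ∘ₗ g = q ∘ₗ iE)
    (hker : LinearMap.ker q ≤ LinearMap.range iE) (S : Submodule L M) :
    (S.map q).comap iD = (S.comap iE).map g := by
  have hsq' : ∀ e, iD (g e) = q (iE e) := fun e => LinearMap.congr_fun hsq e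
  ext d
  constructor
  · rintro ⟨w, hw, hwd⟩
    obtain ⟨e, rfl⟩ := hg d
    rw [hsq'] at hwd
    have h1 : w - iE e ∈ LinearMap.ker q := by rw [LinearMap.mem_ker, map_sub, hwd, sub_self]
    obtain ⟨e', he'⟩ := hker h1
    have h2 : iE (e + e') = w := by rw [map_add, he', add_sub_cancel]
    refine ⟨e + e', ?_, ?_⟩
    · change iE (e + e') ∈ S
      rwa [h2]
    · apply hD
      rw [hsq', hsq', h2, hwd]
  · rintro ⟨e, he, rfl⟩
    exact ⟨iE e, he, (hsq' e).symm⟩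

theorem baseChange_map_le {L : Type*} [Field L] {M V : Type*} [AddCommGroup M] [Module L M]
    [AddCommGroup V] [Module L V] (L' : Type*) [Field L'] [Algebra L L'] (f : M →ₗ[L] V)
    (S : Submodule L M) : (S.map f).baseChange L' ≤ (S.baseChange L').map (f.baseChange L') := by
  rw [Submodule.baseChange_eq_span, Submodule.span_le]
  rintro _ ⟨_, ⟨v, hv, rfl⟩, rfl⟩
  exact ⟨1 ⊗ₜ v, Submodule.tmul_mem_baseChange_of_mem 1 hv, by simp⟩

theorem map_baseChange_le {L : Type*} [Field L] {M V : Type*} [AddCommGroup M] [Module L M]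
    [AddCommGroup V] [Module L V] (L' : Type*) [Field L'] [Algebra L L'] (f : M →ₗ[L] V)
    (S : Submodule L M) : (S.baseChange L').map (f.baseChange L') ≤ (S.map f).baseChange L' := by
  rw [Submodule.baseChange_eq_span, Submodule.map_span_le]
  rintro _ ⟨v, hv, rfl⟩
  have := Submodule.tmul_mem_baseChange_of_mem (A := L') 1 (Submodule.mem_map_of_mem (f := f) hv)
  simpa using this

theorem baseChange_apply_comm {L : Type*} [Field L] {M V U W : Type*} [AddCommGroup M] [Module L M]
    [AddCommGroup V] [Module L V] [AddCommGroup U] [Module L U] [AddCommGroup W] [Module L W]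
    (L' : Type*) [Field L'] [Algebra L L'] {f : V →ₗ[L] W} {g : M →ₗ[L] V} {f' : U →ₗ[L] W}
    {g' : M →ₗ[L] U} (h : ∀ v, f (g v) = f' (g' v)) (v : L' ⊗[L] M) :
    f.baseChange L' (g.baseChange L' v) = f'.baseChange L' (g'.baseChange L' v) := by
  have h' : f ∘ₗ g = f' ∘ₗ g' := LinearMap.ext h
  rw [← LinearMap.comp_apply, ← LinearMap.comp_apply, ← LinearMap.baseChange_comp, h',
    LinearMap.baseChange_comp]

/-- The dimension of `T` is the sum of those of its image under `q` and of its intersection with the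
kernel of `q`. -/
theorem finrank_le_of_map_le {L : Type*} [Field L] {M V W : Type*} [AddCommGroup M] [Module L M]
    [AddCommGroup V] [Module L V] [AddCommGroup W] [Module L W] [FiniteDimensional L M]
    [FiniteDimensional L V] [FiniteDimensional L W] {f : M →ₗ[L] V} {q : V →ₗ[L] W}
    {S : Submodule L M} {T : Submodule L V} {R : Submodule L W} (hR : T.map q ≤ R)
    (hS : T ⊓ LinearMap.ker q ≤ S.map f) : finrank L T ≤ finrank L S + finrank L R := by
  have h1 := LinearMap.finrank_range_add_finrank_ker (q.domRestrict T)
  rw [LinearMap.range_domRestrict, LinearMap.domRestrict, LinearMap.ker_comp,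
    VecFiltration.finrank_comap T.injective_subtype, Submodule.range_subtype] at h1
  have h2 := Submodule.finrank_mono hR
  have h3 := Submodule.finrank_mono hS
  have h4 := Submodule.finrank_map_le f S
  omega

end BaseChange

end HodgeNewton

namespace HodgeNewton

/-! ### The valuation and the Frobenius of `K₀` -/

section Valuation

variable {p : ℕ} [Fact p.Prime] {k : Type*} [Field k] [CharP k p] [PerfectRing k p]

theorem vp_mul {x y : K₀ p k} (hx : x ≠ 0) (hy : y ≠ 0) :
    vp p k (x * y) = vp p k x + vp p k y := by
  rw [vp, map_mul, WithZero.log_mul (by simpa using hx) (by simpa using hy), neg_add]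
  rfl

theorem vp_one : vp p k 1 = 0 := by simp [vp]

theorem vp_pow {x : K₀ p k} (hx : x ≠ 0) (n : ℕ) : vp p k (x ^ n) = n * vp p k x := by
  induction n with
  | zero => simp [vp_one]
  | succ n ih => rw [pow_succ, vp_mul (pow_ne_zero n hx) hx, ih]; push_cast; ring

theorem vp_inv {x : K₀ p k} (hx : x ≠ 0) : vp p k x⁻¹ = -vp p k x := by
  have := vp_mul hx (inv_ne_zero hx)
  rw [mul_inv_cancel₀ hx, vp_one] at this
  linarith

theorem vp_zpow {x : K₀ p k} (hx : x ≠ 0) (n : ℤ) : vp p k (x ^ n) = n * vp p k x := by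
  rcases n with n | n
  · simpa using vp_pow hx n
  · rw [zpow_negSucc, vp_inv (pow_ne_zero _ hx), vp_pow hx, Int.negSucc_eq]
    push_cast; ring

theorem vp_algebraMap_nonneg (w : WittVector p k) :
    0 ≤ vp p k (algebraMap (WittVector p k) (K₀ p k) w) := by
  rcases eq_or_ne w 0 with rfl | hw
  · simp [vp]
  have h := (IsDiscreteValuationRing.maximalIdeal (WittVector p k)).valuation_le_one
    (K := K₀ p k) w
  rw [vp, Left.nonneg_neg_iff]
  have h0 : (IsDiscreteValuationRing.maximalIdeal (WittVector p k)).valuation (K₀ p k)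
    (algebraMap (WittVector p k) (K₀ p k) w) ≠ 0 := by simpa using hw
  simpa using (WithZero.log_le_log h0 one_ne_zero).mpr h

theorem vp_algebraMap_unit (w : (WittVector p k)ˣ) :
    vp p k (algebraMap (WittVector p k) (K₀ p k) w) = 0 := by
  have h1 := vp_algebraMap_nonneg (w : WittVector p k)
  have h2 := vp_algebraMap_nonneg ((w⁻¹ : (WittVector p k)ˣ) : WittVector p k)
  have h3 := vp_mul (p := p) (k := k)
    (x := algebraMap (WittVector p k) (K₀ p k) w)
    (y := algebraMap (WittVector p k) (K₀ p k) ((w⁻¹ : (WittVector p k)ˣ) : WittVector p k))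
    (by simp) (by simp)
  rw [← map_mul, Units.mul_inv, map_one, vp_one] at h3
  linarith

omit [PerfectRing k p] in
theorem natCast_p_ne_zero : (p : K₀ p k) ≠ 0 := by
  have h : (p : WittVector p k) ≠ 0 := (WittVector.irreducible p).ne_zero
  have := (map_ne_zero_iff (algebraMap (WittVector p k) (K₀ p k))
    (IsFractionRing.injective (WittVector p k) (K₀ p k))).mpr h
  rwa [map_natCast] at this

theorem vp_p : vp p k (p : K₀ p k) = 1 := by
  have h : (IsDiscreteValuationRing.maximalIdeal (WittVector p k)).valuation (K₀ p k) (p : K₀ p k) =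
      (IsDiscreteValuationRing.maximalIdeal (WittVector p k)).intValuation (p : WittVector p k) := by
    rw [← map_natCast (algebraMap (WittVector p k) (K₀ p k)) p]
    exact IsDedekindDomain.HeightOneSpectrum.valuation_of_algebraMap _ _
  have h2 := IsDedekindDomain.HeightOneSpectrum.intValuation_singleton
    (IsDiscreteValuationRing.maximalIdeal (WittVector p k))
    (WittVector.irreducible (p := p) (k := k)).ne_zero
    ((WittVector.irreducible (p := p) (k := k)).maximalIdeal_eq)
  rw [vp, h, h2]
  simp

theorem frobenius_algebraMap (w : WittVector p k) :
    WittVector.FractionRing.frobeniusRingHom p k (algebraMap _ (K₀ p k) w) =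
      algebraMap _ (K₀ p k) (WittVector.frobenius w) :=
  IsFractionRing.ringEquivOfRingEquiv_algebraMap _ _

theorem vp_frobenius (x : K₀ p k) :
    vp p k (WittVector.FractionRing.frobeniusRingHom p k x) = vp p k x := by
  have key : ∀ w : WittVector p k, w ≠ 0 →
      vp p k (WittVector.FractionRing.frobeniusRingHom p k (algebraMap _ (K₀ p k) w)) =
        vp p k (algebraMap _ (K₀ p k) w) := by
    intro w hw
    obtain ⟨m, u, rfl⟩ := WittVector.exists_eq_pow_p_mul' w hw
    have hp := natCast_p_ne_zero (p := p) (k := k)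
    have hu : ∀ u : (WittVector p k)ˣ, algebraMap (WittVector p k) (K₀ p k) u ≠ 0 := by simp
    have h1 : WittVector.frobenius (u : WittVector p k) =
      (Units.map (WittVector.frobenius (p := p) (R := k)).toMonoidHom u : (WittVector p k)ˣ) := rfl
    rw [frobenius_algebraMap, map_mul, map_mul, map_mul, map_pow, map_pow, map_pow, map_natCast,
      map_natCast, h1, vp_mul (pow_ne_zero _ hp) (hu _), vp_mul (pow_ne_zero _ hp) (hu _),
      vp_algebraMap_unit, vp_algebraMap_unit]
  obtain ⟨a, b, hb, rfl⟩ := IsFractionRing.div_surjective (A := WittVector p k) x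
  have hb0 := nonZeroDivisors.ne_zero hb
  rcases eq_or_ne a 0 with rfl | ha
  · simp
  have hA : algebraMap (WittVector p k) (K₀ p k) a ≠ 0 := by simpa using ha
  have hB : algebraMap (WittVector p k) (K₀ p k) b ≠ 0 := by simpa using hb0
  have hi := (WittVector.FractionRing.frobeniusRingHom p k).injective
  rw [map_div₀, div_eq_mul_inv, div_eq_mul_inv, vp_mul hA (inv_ne_zero hB), vp_inv hB,
    vp_mul ((map_ne_zero_iff _ hi).mpr hA) (inv_ne_zero ((map_ne_zero_iff _ hi).mpr hB)),
    vp_inv ((map_ne_zero_iff _ hi).mpr hB), key a ha, key b hb0]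

theorem vp_frobenius_iterate (x : K₀ p k) (s : ℕ) :
    vp p k ((WittVector.FractionRing.frobeniusRingHom p k)^[s] x) = vp p k x := by
  induction s with
  | zero => rfl
  | succ s ih => rw [Function.iterate_succ_apply', vp_frobenius, ih]

theorem frobenius_surjective :
    Function.Surjective (WittVector.FractionRing.frobeniusRingHom p k) :=
  (WittVector.FractionRing.frobenius p k).surjective

end Valuation

/-! ### Matrices of semilinear endomorphisms -/

section SemilinearMatrix

open Matrix Module

variable {L V : Type*} [Field L] [AddCommGroup V] [Module L V] {σ : L →+* L}
  {ι : Type*} [Fintype ι] [DecidableEq ι]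

/-- The matrix of a semilinear endomorphism. -/
def semilinearMatrix (b : Basis ι L V) (φ : V →ₛₗ[σ] V) : Matrix ι ι L :=
  Matrix.of fun i j => b.repr (φ (b j)) i

omit [DecidableEq ι] in
theorem repr_semilinear (b : Basis ι L V) (φ : V →ₛₗ[σ] V) (v : V) :
    ⇑(b.repr (φ v)) = semilinearMatrix b φ *ᵥ (fun i => σ (b.repr v i)) := by
  ext i
  conv_lhs => rw [← b.sum_repr v, map_sum, map_sum]
  simp [semilinearMatrix, mulVec, dotProduct, mul_comm, map_smulₛₗ]

omit [DecidableEq ι] in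
theorem semilinearMatrix_mul (b c : Basis ι L V) (φ : V →ₛₗ[σ] V) :
    c.toMatrix b * semilinearMatrix b φ = semilinearMatrix c φ * (c.toMatrix b).map σ := by
  ext i j
  have h1 := congrFun (repr_semilinear c φ (b j)) i
  have h2 := congrFun (b.toMatrix_mulVec_repr c (φ (b j))) i
  exact h2.trans h1

theorem semilinearMatrix_det_ne_zero (b : Basis ι L V) {φ : V →ₛₗ[σ] V}
    (hσ : Function.Surjective σ) (hφ : Function.Injective φ) :
    (semilinearMatrix b φ).det ≠ 0 := by
  intro h
  obtain ⟨x, hx, hx0⟩ := Matrix.exists_mulVec_eq_zero_iff.mpr h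
  choose y hy using fun i => hσ (x i)
  have h1 := repr_semilinear b φ (∑ i, y i • b i)
  simp only [b.repr_sum_self, hy] at h1
  rw [hx0] at h1
  have h2 : φ (∑ i, y i • b i) = 0 := by
    apply b.repr.injective
    rw [map_zero]
    exact DFunLike.coe_injective h1
  have h3 := hφ (h2.trans (map_zero φ).symm)
  apply hx
  ext i
  have h4 := b.repr_sum_self y
  rw [h3, map_zero] at h4
  rw [← hy, ← congrFun h4 i]
  simp

/-- The matrix of the `s`-th iterate of a semilinear endomorphism. -/
def semilinearMatrixIter (b : Basis ι L V) (φ : V →ₛₗ[σ] V) : ℕ → Matrix ι ι L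
  | 0 => 1
  | s + 1 => semilinearMatrix b φ * (semilinearMatrixIter b φ s).map σ

theorem repr_semilinear_iterate (b : Basis ι L V) (φ : V →ₛₗ[σ] V) (s : ℕ) (v : V) :
    ⇑(b.repr (φ^[s] v)) = semilinearMatrixIter b φ s *ᵥ (fun i => σ^[s] (b.repr v i)) := by
  induction s with
  | zero => simp [semilinearMatrixIter]
  | succ s ih =>
    rw [Function.iterate_succ_apply', repr_semilinear, ih, semilinearMatrixIter, ← mulVec_mulVec]
    congr 1
    ext i
    rw [RingHom.map_mulVec]
    congr 1
    ext j
    simp [Function.iterate_succ_apply']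

end SemilinearMatrix

/-! ### The Newton number -/

namespace FilteredIsocrystal

open Matrix Module

variable {p : ℕ} [Fact p.Prime] {k : Type*} [Field k] [CharP k p] [PerfectRing k p]
  {K : Type*} [Field K] [Algebra (K₀ p k) K]
  {N V U : Type*} [AddCommGroup N] [Module (K₀ p k) N] [AddCommGroup V] [Module (K₀ p k) V]
  [AddCommGroup U] [Module (K₀ p k) U]

theorem det_ne_zero (X : FilteredIsocrystal p k K N) {ι : Type*} [Fintype ι] [DecidableEq ι]
    (b : Basis ι (K₀ p k) N) : (semilinearMatrix b X.φ).det ≠ 0 :=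
  semilinearMatrix_det_ne_zero b frobenius_surjective X.bijective.1

theorem vp_det_eq (X : FilteredIsocrystal p k K N) {ι : Type*} [Fintype ι] [DecidableEq ι]
    (b c : Basis ι (K₀ p k) N) :
    vp p k (semilinearMatrix b X.φ).det = vp p k (semilinearMatrix c X.φ).det := by
  have h := congrArg Matrix.det (semilinearMatrix_mul b c X.φ)
  have h0 : (c.toMatrix b).det ≠ 0 := by
    intro h
    have := congrArg Matrix.det (c.toMatrix_mul_toMatrix_flip b)
    rw [det_mul, h, zero_mul, det_one] at this
    exact zero_ne_one this
  have h1 : ((c.toMatrix b).map (WittVector.FractionRing.frobeniusRingHom p k)).det =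
    WittVector.FractionRing.frobeniusRingHom p k (c.toMatrix b).det := (RingHom.map_det _ _).symm
  rw [det_mul, det_mul, h1] at h
  have h2 := congrArg (vp p k) h
  rw [vp_mul h0 (X.det_ne_zero b), vp_mul (X.det_ne_zero c)
    ((map_ne_zero_iff _ (RingHom.injective _)).mpr h0), vp_frobenius] at h2
  linarith

/-- The Newton number can be computed in any basis. -/
theorem tN_eq [FiniteDimensional (K₀ p k) N] (X : FilteredIsocrystal p k K N) {ι : Type*}
    [Fintype ι] [DecidableEq ι] (b : Basis ι (K₀ p k) N) :
    X.tN = vp p k (semilinearMatrix b X.φ).det := by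
  have e : Fin (finrank (K₀ p k) N) ≃ ι :=
    Fintype.equivOfCardEq (by rw [Fintype.card_fin, finrank_eq_card_basis b])
  have h : semilinearMatrix (b.reindex e.symm) X.φ = (semilinearMatrix b X.φ).submatrix e e := by
    ext i j
    simp [semilinearMatrix]
  have h2 := X.vp_det_eq (finBasis (K₀ p k) N) (b.reindex e.symm)
  rw [h, Matrix.det_submatrix_equiv_self] at h2
  exact h2

/-! ### Short exact sequences -/

/-- A short exact sequence `0 → Y → X → Z → 0` of the underlying isocrystals; nothing is asked of
the filtrations. -/
structure IsShortExact (Y : FilteredIsocrystal p k K V) (X : FilteredIsocrystal p k K N)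
    (Z : FilteredIsocrystal p k K U) (f : V →ₗ[K₀ p k] N) (g : N →ₗ[K₀ p k] U) : Prop where
  injective : Function.Injective f
  surjective : Function.Surjective g
  range_eq_ker : LinearMap.range f = LinearMap.ker g
  left_φ : ∀ v, f (Y.φ v) = X.φ (f v)
  right_φ : ∀ v, g (X.φ v) = Z.φ (g v)

/-- A short exact sequence `0 → Y → X → Z → 0` of filtered isocrystals: the filtrations of `Y` and
`Z` are those induced by the one of `X`. -/
structure IsStrictExact (Y : FilteredIsocrystal p k K V) (X : FilteredIsocrystal p k K N)
    (Z : FilteredIsocrystal p k K U) (f : V →ₗ[K₀ p k] N) (g : N →ₗ[K₀ p k] U) : Prop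
    extends IsShortExact Y X Z f g where
  left_fil : ∀ i, Y.fil.Fil i = (X.fil.Fil i).comap (f.baseChange K)
  right_fil : ∀ i, Z.fil.Fil i = (X.fil.Fil i).map (g.baseChange K)

section

variable [FiniteDimensional (K₀ p k) N] [FiniteDimensional (K₀ p k) V]
  [FiniteDimensional (K₀ p k) U]
  {Y : FilteredIsocrystal p k K V} {X : FilteredIsocrystal p k K N}
  {Z : FilteredIsocrystal p k K U} {f : V →ₗ[K₀ p k] N} {g : N →ₗ[K₀ p k] U}

omit [FiniteDimensional (K₀ p k) V] [FiniteDimensional (K₀ p k) U] in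
theorem IsShortExact.finrank_eq (h : IsShortExact Y X Z f g) :
    finrank (K₀ p k) N = finrank (K₀ p k) V + finrank (K₀ p k) U := by
  rw [← g.finrank_range_add_finrank_ker, ← h.range_eq_ker, LinearMap.finrank_range_of_inj
    h.injective, LinearMap.range_eq_top.mpr h.surjective, finrank_top, add_comm]

theorem IsShortExact.tN_eq (h : IsShortExact Y X Z f g) : X.tN = Y.tN + Z.tN := by
  let bV := finBasis (K₀ p k) V
  let bU := finBasis (K₀ p k) U
  let bR := bV.map (LinearEquiv.ofInjective f h.injective)
  let q : (N ⧸ LinearMap.range f) ≃ₗ[K₀ p k] U :=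
    (Submodule.quotEquivOfEq _ _ h.range_eq_ker).trans (g.quotKerEquivOfSurjective h.surjective)
  have hq : ∀ v, q (Submodule.Quotient.mk v) = g v := fun v => rfl
  let bQ := bU.map q.symm
  let b := Basis.sumQuot bR bQ
  have hgf : ∀ v, g (f v) = 0 := fun v => by
    have : f v ∈ LinearMap.ker g := h.range_eq_ker ▸ LinearMap.mem_range_self f v
    exact this
  have hR : ∀ v i, bR.repr ⟨f v, LinearMap.mem_range_self f v⟩ i = bV.repr v i := by
    intro v i
    have : (⟨f v, LinearMap.mem_range_self f v⟩ : LinearMap.range f) =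
      LinearEquiv.ofInjective f h.injective v := rfl
    rw [this]
    simp [bR]
  have hl : ∀ j, b (Sum.inl j) = f (bV j) := fun j => by
    rw [Basis.sumQuot_inl]; simp [bR]
  have hr : ∀ j, g (b (Sum.inr j)) = bU j := fun j => by
    rw [← hq, Basis.sumQuot_inr]; simp [bQ]
  have hri : ∀ v i, b.repr v (Sum.inr i) = bU.repr (g v) i := fun v i => by
    rw [Basis.sumQuot_repr_inr, ← hq]; simp [bQ]
  have hM : semilinearMatrix b X.φ = fromBlocks (semilinearMatrix bV Y.φ)
      (Matrix.of fun i j => semilinearMatrix b X.φ (Sum.inl i) (Sum.inr j)) 0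
      (semilinearMatrix bU Z.φ) := by
    ext i j
    rcases i with i | i <;> rcases j with j | j
    · simp only [fromBlocks_apply₁₁, semilinearMatrix, Matrix.of_apply]
      rw [hl, ← h.left_φ, Basis.sumQuot_repr_inl_of_mem _ _ _ (LinearMap.mem_range_self f _), hR]
    · rfl
    · simp only [fromBlocks_apply₂₁, semilinearMatrix, Matrix.of_apply]
      rw [hl, ← h.left_φ, hri, hgf]
      simp
    · simp only [fromBlocks_apply₂₂, semilinearMatrix, Matrix.of_apply]
      rw [hri, h.right_φ, hr]
  rw [X.tN_eq b, Y.tN_eq bV, Z.tN_eq bU, hM, det_fromBlocks_zero₂₁,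
    vp_mul (Y.det_ne_zero bV) (Z.det_ne_zero bU)]

theorem IsStrictExact.tH_eq (h : IsStrictExact Y X Z f g) : X.tH = Y.tH + Z.tH :=
  VecFiltration.degree_add <| VecFiltration.finrank_fil_of_exact
    (Module.Flat.lTensor_preserves_injective_linearMap f h.injective)
    (range_baseChange_eq_ker K h.surjective h.range_eq_ker) h.left_fil h.right_fil

end

theorem isStrictExact_quot (X : FilteredIsocrystal p k K N) (A : Submodule (K₀ p k) N)
    (hA : X.IsStable A) : IsStrictExact (X.sub A hA) X (X.quot A hA) A.subtype A.mkQ where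
  injective := A.injective_subtype
  surjective := A.mkQ_surjective
  range_eq_ker := by rw [Submodule.range_subtype, Submodule.ker_mkQ]
  left_φ _ := rfl
  right_φ _ := rfl
  left_fil _ := rfl
  right_fil _ := rfl

end FilteredIsocrystal

end HodgeNewton

namespace HodgeNewton

/-! ### Lattices and bounds for the slopes -/

section Lattice

open Module

variable {p : ℕ} [Fact p.Prime] {k : Type*} [Field k] [CharP k p]
  {N V : Type*} [AddCommGroup N] [Module (K₀ p k) N] [AddCommGroup V] [Module (K₀ p k) V]

/-- The `W(k)`-module underlying a `K₀`-vector space. -/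
abbrev wittModule (p : ℕ) [Fact p.Prime] (k : Type*) [Field k] [CharP k p] (N : Type*)
    [AddCommGroup N] [Module (K₀ p k) N] : Module (WittVector p k) N :=
  Module.compHom N (algebraMap (WittVector p k) (K₀ p k))

attribute [local instance] wittModule

theorem witt_smul_def (w : WittVector p k) (v : N) :
    w • v = algebraMap (WittVector p k) (K₀ p k) w • v := rfl

instance wittModule_isScalarTower : IsScalarTower (WittVector p k) (K₀ p k) N :=
  ⟨fun a b v => by rw [witt_smul_def, smul_smul, Algebra.smul_def]⟩

theorem exists_smul_mem_of_mem_span {M : Submodule (WittVector p k) N} {v : N}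
    (hv : v ∈ Submodule.span (K₀ p k) (M : Set N)) :
    ∃ w : WittVector p k, w ≠ 0 ∧ w • v ∈ M := by
  induction hv using Submodule.span_induction with
  | mem x hx => exact ⟨1, one_ne_zero, by rw [one_smul]; exact hx⟩
  | zero => exact ⟨1, one_ne_zero, by rw [smul_zero]; exact M.zero_mem⟩
  | add x y _ _ hx hy =>
    obtain ⟨a, ha, hax⟩ := hx
    obtain ⟨b, hb, hby⟩ := hy
    refine ⟨a * b, mul_ne_zero ha hb, ?_⟩
    rw [smul_add]
    refine M.add_mem ?_ ?_
    · rw [mul_comm, mul_smul]; exact M.smul_mem b hax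
    · rw [mul_smul]; exact M.smul_mem a hby
  | smul c x _ hx =>
    obtain ⟨a, ha, hax⟩ := hx
    obtain ⟨u, v, hv, rfl⟩ := IsFractionRing.div_surjective (A := WittVector p k) c
    have hv0 : algebraMap (WittVector p k) (K₀ p k) v ≠ 0 := by
      simpa using nonZeroDivisors.ne_zero hv
    refine ⟨v * a, mul_ne_zero (nonZeroDivisors.ne_zero hv) ha, ?_⟩
    have : (v * a) • ((algebraMap (WittVector p k) (K₀ p k) u /
        algebraMap (WittVector p k) (K₀ p k) v) • x) = u • a • x := by
      rw [witt_smul_def, witt_smul_def, witt_smul_def, smul_smul, smul_smul, map_mul]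
      congr 1
      field_simp
    rw [this]
    exact M.smul_mem u hax

theorem exists_basis_of_fg [PerfectRing k p] {M : Submodule (WittVector p k) N} (hM : M.FG) :
    ∃ (n : ℕ) (e : Fin n → N), LinearIndependent (K₀ p k) e ∧
      Submodule.span (WittVector p k) (Set.range e) = M := by
  have : Module.Finite (WittVector p k) M := Module.Finite.iff_fg.mpr hM
  have : IsTorsionFree (WittVector p k) N :=
    IsTorsionFree.trans_faithfulSMul (WittVector p k) (K₀ p k) N
  let b := Module.finBasis (WittVector p k) M
  refine ⟨_, fun i => (b i : N), ?_, ?_⟩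
  · rw [← LinearIndependent.iff_fractionRing (WittVector p k) (K₀ p k)]
    exact b.linearIndependent.map' M.subtype M.ker_subtype
  · have : (Set.range fun i => (b i : N)) = M.subtype '' Set.range b := by
      rw [← Set.range_comp]; rfl
    rw [this, Submodule.span_image, b.span_eq, Submodule.map_top, Submodule.range_subtype]

end Lattice

namespace FilteredIsocrystal

open Module Matrix

variable {p : ℕ} [Fact p.Prime] {k : Type*} [Field k] [CharP k p] [PerfectRing k p]
  {K : Type*} [Field K] [Algebra (K₀ p k) K]
  {N V U : Type*} [AddCommGroup N] [Module (K₀ p k) N] [AddCommGroup V] [Module (K₀ p k) V]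
  [AddCommGroup U] [Module (K₀ p k) U]

attribute [local instance] wittModule

/-- All slopes of `A` are at least `q`: there are a lattice `M` in `A` and integers `r`, `s > 0`
with `φ^s M ⊆ p^r M` and `q ≤ r / s`. -/
def SlopesGE (X : FilteredIsocrystal p k K N) (A : Submodule (K₀ p k) N) (q : ℚ) : Prop :=
  ∃ (s : ℕ) (r : ℤ), 0 < s ∧ q * s ≤ r ∧ ∃ M : Submodule (WittVector p k) N, M.FG ∧
    Submodule.span (K₀ p k) (M : Set N) = A ∧
    ∀ v ∈ M, ∃ w ∈ M, X.φ^[s] v = (p : K₀ p k) ^ r • w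

/-- All slopes of `A` are at most `q`: there are a lattice `M` in `A` and integers `r`, `s > 0`
with `p^r M ⊆ φ^s M` and `r / s ≤ q`. -/
def SlopesLE (X : FilteredIsocrystal p k K N) (A : Submodule (K₀ p k) N) (q : ℚ) : Prop :=
  ∃ (s : ℕ) (r : ℤ), 0 < s ∧ (r : ℚ) ≤ q * s ∧ ∃ M : Submodule (WittVector p k) N, M.FG ∧
    Submodule.span (K₀ p k) (M : Set N) = A ∧
    ∀ v ∈ M, ∃ w ∈ M, (p : K₀ p k) ^ r • v = X.φ^[s] w

/-- The matrix of `φ^s` is a product of `s` Frobenius conjugates of the matrix of `φ`, and the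
Frobenius preserves the valuation. -/
theorem vp_det_iter (X : FilteredIsocrystal p k K N) {ι : Type*} [Fintype ι] [DecidableEq ι]
    (b : Basis ι (K₀ p k) N) (s : ℕ) : (semilinearMatrixIter b X.φ s).det ≠ 0 ∧
      vp p k (semilinearMatrixIter b X.φ s).det = s * vp p k (semilinearMatrix b X.φ).det := by
  induction s with
  | zero => simp [semilinearMatrixIter, vp_one]
  | succ s ih =>
    have h1 : ((semilinearMatrixIter b X.φ s).map
        (WittVector.FractionRing.frobeniusRingHom p k)).det =
      WittVector.FractionRing.frobeniusRingHom p k (semilinearMatrixIter b X.φ s).det :=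
      (RingHom.map_det _ _).symm
    have h2 := (map_ne_zero_iff (WittVector.FractionRing.frobeniusRingHom p k)
      (RingHom.injective _)).mpr ih.1
    rw [semilinearMatrixIter, det_mul, h1]
    refine ⟨mul_ne_zero (X.det_ne_zero b) h2, ?_⟩
    rw [vp_mul (X.det_ne_zero b) h2, vp_frobenius, ih.2]
    push_cast
    ring

theorem sub_φ_iterate (X : FilteredIsocrystal p k K N) {A : Submodule (K₀ p k) N}
    (hA : X.IsStable A) (s : ℕ) (v : A) : (((X.sub A hA).φ^[s] v : A) : N) = X.φ^[s] v := by
  induction s with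
  | zero => rfl
  | succ s ih =>
    rw [Function.iterate_succ_apply', Function.iterate_succ_apply', ← ih]
    rfl

theorem vp_zpow_pow_mul {r : ℤ} {n : ℕ} {x : K₀ p k} (hx : x ≠ 0) :
    vp p k (((p : K₀ p k) ^ r) ^ n * x) = n * r + vp p k x := by
  have hp := natCast_p_ne_zero (p := p) (k := k)
  rw [vp_mul (pow_ne_zero _ (zpow_ne_zero _ hp)) hx, vp_pow (zpow_ne_zero _ hp), vp_zpow hp, vp_p,
    mul_one]

section FiniteDim

variable [FiniteDimensional (K₀ p k) N]

/-- On a basis of the lattice, the matrix of `φ^s` is `p^r` times an integral matrix, whose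
determinant has nonnegative valuation. -/
theorem SlopesGE.le_tN {X : FilteredIsocrystal p k K N} {A : Submodule (K₀ p k) N} {q : ℚ}
    (h : X.SlopesGE A q) (hA : X.IsStable A) :
    q * finrank (K₀ p k) A ≤ (X.sub A hA).tN := by
  obtain ⟨s, r, hs, hqs, M, hM, rfl, hMφ⟩ := h
  obtain ⟨n, e, he, rfl⟩ := exists_basis_of_fg hM
  have hspan : Submodule.span (K₀ p k) (Set.range e) = Submodule.span (K₀ p k)
      (Submodule.span (WittVector p k) (Set.range e) : Set N) := by
    rw [Submodule.span_span_of_tower]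
  let b : Basis (Fin n) (K₀ p k) _ := (Basis.span he).map (LinearEquiv.ofEq _ _ hspan)
  have hb : ∀ i, (b i : N) = e i := fun i => by simp [b, Basis.span_apply]
  have hc : ∀ j, ∃ c : Fin n → WittVector p k,
      X.φ^[s] (e j) = (p : K₀ p k) ^ r • ∑ i, c i • e i := by
    intro j
    obtain ⟨w, hw, hw'⟩ := hMφ (e j) (Submodule.subset_span ⟨j, rfl⟩)
    obtain ⟨c, rfl⟩ := (Submodule.mem_span_range_iff_exists_fun _).mp hw
    exact ⟨c, hw'⟩
  choose c hc using hc
  have hmat : semilinearMatrixIter b (X.sub _ hA).φ s = (p : K₀ p k) ^ r •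
      (Matrix.of fun i j => c j i).map (algebraMap (WittVector p k) (K₀ p k)) := by
    ext i j
    have h1 := congrFun (repr_semilinear_iterate b (X.sub _ hA).φ s (b j)) i
    have h2 : (fun i => (WittVector.FractionRing.frobeniusRingHom p k)^[s] (b.repr (b j) i)) =
        Pi.single j 1 := by
      ext i
      rw [← RingHom.coe_pow, b.repr_self, Finsupp.single_apply, Pi.single_apply]
      by_cases h : j = i
      · rw [if_pos h, if_pos h.symm, map_one]
      · rw [if_neg h, if_neg (Ne.symm h), map_zero]
    rw [h2, mulVec_single_one] at h1
    refine h1.symm.trans ?_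
    have h3 : (X.sub _ hA).φ^[s] (b j) = ∑ i, ((p : K₀ p k) ^ r *
        algebraMap (WittVector p k) (K₀ p k) (c j i)) • b i := by
      apply Subtype.ext
      rw [sub_φ_iterate, hb, hc, AddSubmonoidClass.coe_finsetSum, Finset.smul_sum]
      refine Finset.sum_congr rfl fun i _ => ?_
      rw [Submodule.coe_smul, hb, witt_smul_def, smul_smul]
    rw [h3, b.repr_sum_self]
    simp
  obtain ⟨h0, h1⟩ := (X.sub _ hA).vp_det_iter b s
  have h4 : ((Matrix.of fun i j => c j i).map (algebraMap (WittVector p k) (K₀ p k))).det =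
      algebraMap (WittVector p k) (K₀ p k) (Matrix.of fun i j => c j i).det :=
    (RingHom.map_det _ _).symm
  rw [hmat, det_smul, Fintype.card_fin, h4] at h0 h1
  rw [vp_zpow_pow_mul (right_ne_zero_of_mul h0), ← (X.sub _ hA).tN_eq b] at h1
  have h5 := vp_algebraMap_nonneg (Matrix.of fun i j => c j i).det
  have h6 : ((n : ℤ) * r : ℤ) ≤ s * (X.sub _ hA).tN := by linarith
  have h7 : ((n : ℚ) * r : ℚ) ≤ s * (X.sub _ hA).tN := by exact_mod_cast h6
  rw [finrank_eq_card_basis b, Fintype.card_fin]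
  have hs' : (0 : ℚ) < s := by exact_mod_cast hs
  refine le_of_mul_le_mul_left ?_ hs'
  calc (s : ℚ) * (q * n) = n * (q * s) := by ring
    _ ≤ n * r := by gcongr
    _ ≤ _ := h7

/-- On a basis of the lattice, `p^r` times the unit matrix is the product of the matrix of `φ^s` and
an integral matrix, whose determinant has nonnegative valuation. -/
theorem SlopesLE.tN_le {X : FilteredIsocrystal p k K N} {A : Submodule (K₀ p k) N} {q : ℚ}
    (h : X.SlopesLE A q) (hA : X.IsStable A) :
    (X.sub A hA).tN ≤ q * finrank (K₀ p k) A := by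
  obtain ⟨s, r, hs, hqs, M, hM, rfl, hMφ⟩ := h
  obtain ⟨n, e, he, rfl⟩ := exists_basis_of_fg hM
  have hspan : Submodule.span (K₀ p k) (Set.range e) = Submodule.span (K₀ p k)
      (Submodule.span (WittVector p k) (Set.range e) : Set N) := by
    rw [Submodule.span_span_of_tower]
  let b : Basis (Fin n) (K₀ p k) _ := (Basis.span he).map (LinearEquiv.ofEq _ _ hspan)
  have hb : ∀ i, (b i : N) = e i := fun i => by simp [b, Basis.span_apply]
  have hc : ∀ j, ∃ c : Fin n → WittVector p k,
      (p : K₀ p k) ^ r • e j = X.φ^[s] (∑ i, c i • e i) := by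
    intro j
    obtain ⟨w, hw, hw'⟩ := hMφ (e j) (Submodule.subset_span ⟨j, rfl⟩)
    obtain ⟨c, rfl⟩ := (Submodule.mem_span_range_iff_exists_fun _).mp hw
    exact ⟨c, hw'⟩
  choose c hc using hc
  have hmat : (p : K₀ p k) ^ r • (1 : Matrix (Fin n) (Fin n) (K₀ p k)) =
      semilinearMatrixIter b (X.sub _ hA).φ s *
        ((Matrix.of fun i j => c j i).map (algebraMap (WittVector p k) (K₀ p k))).map
          (WittVector.FractionRing.frobeniusRingHom p k ^ s : K₀ p k →+* K₀ p k) := by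
    ext i j
    have h1 := congrFun (repr_semilinear_iterate b (X.sub _ hA).φ s
      (∑ i, algebraMap (WittVector p k) (K₀ p k) (c j i) • b i)) i
    have h2 : (X.sub _ hA).φ^[s] (∑ i, algebraMap (WittVector p k) (K₀ p k) (c j i) • b i) =
        (p : K₀ p k) ^ r • b j := by
      apply Subtype.ext
      rw [sub_φ_iterate, Submodule.coe_smul, hb, hc, AddSubmonoidClass.coe_finsetSum]
      congr 1
      refine Finset.sum_congr rfl fun i _ => ?_
      rw [Submodule.coe_smul, hb, witt_smul_def]
    rw [h2, b.repr_sum_self, map_smul, b.repr_self] at h1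
    refine Eq.trans ?_ (h1.trans ?_)
    · simp [Matrix.one_apply, Finsupp.single_apply, eq_comm]
    · rw [Matrix.mul_apply]
      rfl
  obtain ⟨h0, h1⟩ := (X.sub _ hA).vp_det_iter b s
  have h4 : (((Matrix.of fun i j => c j i).map (algebraMap (WittVector p k) (K₀ p k))).map
        (WittVector.FractionRing.frobeniusRingHom p k ^ s : K₀ p k →+* K₀ p k)).det =
      (WittVector.FractionRing.frobeniusRingHom p k ^ s : K₀ p k →+* K₀ p k)
        (algebraMap (WittVector p k) (K₀ p k) (Matrix.of fun i j => c j i).det) := by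
    rw [RingHom.map_det, RingHom.map_det]
    rfl
  have hd := congrArg Matrix.det hmat
  rw [det_smul, Fintype.card_fin, det_one, det_mul, h4] at hd
  have hne : ((p : K₀ p k) ^ r) ^ n * 1 ≠ 0 := by
    rw [mul_one]
    exact pow_ne_zero _ (zpow_ne_zero _ natCast_p_ne_zero)
  have h2 := hne
  rw [hd] at h2
  have h3 := congrArg (vp p k) hd
  rw [vp_zpow_pow_mul one_ne_zero, vp_one, vp_mul h0 (right_ne_zero_of_mul h2), h1,
    RingHom.coe_pow, vp_frobenius_iterate, ← (X.sub _ hA).tN_eq b] at h3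
  have h5 := vp_algebraMap_nonneg (Matrix.of fun i j => c j i).det
  have h6 : (s * (X.sub _ hA).tN : ℤ) ≤ (n : ℤ) * r := by linarith
  have h7 : (s * (X.sub _ hA).tN : ℚ) ≤ (n : ℚ) * r := by exact_mod_cast h6
  rw [finrank_eq_card_basis b, Fintype.card_fin]
  have hs' : (0 : ℚ) < s := by exact_mod_cast hs
  refine le_of_mul_le_mul_left ?_ hs'
  calc _ ≤ (n : ℚ) * r := h7
    _ ≤ n * (q * s) := by gcongr
    _ = (s : ℚ) * (q * n) := by ring

end FiniteDim

end FilteredIsocrystal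

end HodgeNewton

namespace HodgeNewton

namespace FilteredIsocrystal

open Module Matrix

variable {p : ℕ} [Fact p.Prime] {k : Type*} [Field k] [CharP k p] [PerfectRing k p]
  {K : Type*} [Field K] [Algebra (K₀ p k) K]
  {N V U : Type*} [AddCommGroup N] [Module (K₀ p k) N] [AddCommGroup V] [Module (K₀ p k) V]
  [AddCommGroup U] [Module (K₀ p k) U]

attribute [local instance] wittModule

/-! ### Permanence properties of slope bounds -/

theorem φ_zpow_smul (X : FilteredIsocrystal p k K N) (r : ℤ) (v : N) :
    X.φ ((p : K₀ p k) ^ r • v) = (p : K₀ p k) ^ r • X.φ v := by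
  rw [map_smulₛₗ, map_zpow₀, map_natCast]

theorem iterate_zpow_smul (X : FilteredIsocrystal p k K N) (s : ℕ) (r : ℤ) (v : N) :
    X.φ^[s] ((p : K₀ p k) ^ r • v) = (p : K₀ p k) ^ r • X.φ^[s] v := by
  induction s with
  | zero => rfl
  | succ s ih => rw [Function.iterate_succ_apply', ih, φ_zpow_smul, Function.iterate_succ_apply']

theorem iterate_add (X : FilteredIsocrystal p k K N) (s : ℕ) (v w : N) :
    X.φ^[s] (v + w) = X.φ^[s] v + X.φ^[s] w := by
  induction s with
  | zero => rfl
  | succ s ih => simp only [Function.iterate_succ_apply', ih, map_add]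

theorem IsStable.iterate_mem_iff {X : FilteredIsocrystal p k K N} {A : Submodule (K₀ p k) N}
    (hA : X.IsStable A) (s : ℕ) (v : N) : X.φ^[s] v ∈ A ↔ v ∈ A := by
  induction s with
  | zero => rfl
  | succ s ih => rw [Function.iterate_succ_apply', hA, ih]

omit [PerfectRing k p] in
theorem natCast_p_zpow_ne_zero (r : ℤ) : (p : K₀ p k) ^ r ≠ 0 :=
  zpow_ne_zero _ natCast_p_ne_zero

omit [PerfectRing k p] in
theorem zpow_smul_mem_of_nonneg (M : Submodule (WittVector p k) N) {v : N} (hv : v ∈ M) {r : ℤ}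
    (hr : 0 ≤ r) : (p : K₀ p k) ^ r • v ∈ M := by
  obtain ⟨n, rfl⟩ := Int.eq_ofNat_of_zero_le hr
  have := M.smul_mem ((p : WittVector p k) ^ n) hv
  rwa [witt_smul_def, map_pow, map_natCast] at this

/-- A lattice in a subspace `A` induces one in every smaller subspace. -/
theorem exists_lattice_of_le {M : Submodule (WittVector p k) N} (hM : M.FG)
    {B : Submodule (K₀ p k) N} (hB : B ≤ Submodule.span (K₀ p k) (M : Set N)) :
    (M ⊓ B.restrictScalars (WittVector p k)).FG ∧
      Submodule.span (K₀ p k) ((M ⊓ B.restrictScalars (WittVector p k) : Submodule _ N) : Set N) =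
        B := by
  refine ⟨Submodule.FG.of_le hM inf_le_left, le_antisymm ?_ fun v hv => ?_⟩
  · exact Submodule.span_le.mpr fun v hv => hv.2
  · obtain ⟨w, hw, hwv⟩ := exists_smul_mem_of_mem_span (hB hv)
    have h0 : algebraMap (WittVector p k) (K₀ p k) w ≠ 0 := by simpa using hw
    have h1 : w • v ∈ Submodule.span (K₀ p k)
        ((M ⊓ B.restrictScalars (WittVector p k) : Submodule _ N) : Set N) :=
      Submodule.subset_span ⟨hwv, B.smul_mem _ hv⟩
    rwa [witt_smul_def, Submodule.smul_mem_iff _ h0] at h1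

theorem SlopesGE.of_le {X : FilteredIsocrystal p k K N} {A B : Submodule (K₀ p k) N} {q : ℚ}
    (h : X.SlopesGE A q) (hB : X.IsStable B) (hBA : B ≤ A) : X.SlopesGE B q := by
  obtain ⟨s, r, hs, hqs, M, hM, rfl, hMφ⟩ := h
  obtain ⟨h1, h2⟩ := exists_lattice_of_le hM hBA
  refine ⟨s, r, hs, hqs, _, h1, h2, fun v hv => ?_⟩
  obtain ⟨w, hw, hvw⟩ := hMφ v hv.1
  refine ⟨w, ⟨hw, ?_⟩, hvw⟩
  have h3 := (hB.iterate_mem_iff s v).mpr hv.2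
  rw [hvw, Submodule.smul_mem_iff _ (natCast_p_zpow_ne_zero r)] at h3
  exact h3

theorem SlopesLE.of_le {X : FilteredIsocrystal p k K N} {A B : Submodule (K₀ p k) N} {q : ℚ}
    (h : X.SlopesLE A q) (hB : X.IsStable B) (hBA : B ≤ A) : X.SlopesLE B q := by
  obtain ⟨s, r, hs, hqs, M, hM, rfl, hMφ⟩ := h
  obtain ⟨h1, h2⟩ := exists_lattice_of_le hM hBA
  refine ⟨s, r, hs, hqs, _, h1, h2, fun v hv => ?_⟩
  obtain ⟨w, hw, hvw⟩ := hMφ v hv.1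
  refine ⟨w, ⟨hw, ?_⟩, hvw⟩
  refine (hB.iterate_mem_iff s w).mp ?_
  rw [← hvw]
  exact B.smul_mem _ hv.2

theorem SlopesGE.mono {X : FilteredIsocrystal p k K N} {A : Submodule (K₀ p k) N} {q q' : ℚ}
    (h : X.SlopesGE A q) (hq : q' ≤ q) : X.SlopesGE A q' := by
  obtain ⟨s, r, hs, hqs, h⟩ := h
  exact ⟨s, r, hs, le_trans (by gcongr) hqs, h⟩

theorem SlopesLE.mono {X : FilteredIsocrystal p k K N} {A : Submodule (K₀ p k) N} {q q' : ℚ}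
    (h : X.SlopesLE A q) (hq : q ≤ q') : X.SlopesLE A q' := by
  obtain ⟨s, r, hs, hqs, h⟩ := h
  exact ⟨s, r, hs, le_trans hqs (by gcongr), h⟩

theorem slopesGE_bot (X : FilteredIsocrystal p k K N) (q : ℚ) : X.SlopesGE ⊥ q :=
  ⟨1, ⌊q⌋ + 1, one_pos, by simpa using (Int.lt_floor_add_one q).le, ⊥, Submodule.fg_bot,
    by simp, fun v hv => ⟨0, Submodule.zero_mem _, by
      rw [(Submodule.mem_bot _).mp hv]; simp⟩⟩

theorem slopesLE_bot (X : FilteredIsocrystal p k K N) (q : ℚ) : X.SlopesLE ⊥ q :=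
  ⟨1, ⌊q⌋, one_pos, by simpa using Int.floor_le q, ⊥, Submodule.fg_bot,
    by simp, fun v hv => ⟨0, Submodule.zero_mem _, by
      rw [(Submodule.mem_bot _).mp hv]; simp⟩⟩

section Map

variable {X : FilteredIsocrystal p k K N} {Z : FilteredIsocrystal p k K V}
  {f : N →ₗ[K₀ p k] V}

theorem map_iterate (hf : ∀ v, f (X.φ v) = Z.φ (f v)) (s : ℕ) (v : N) :
    f (X.φ^[s] v) = Z.φ^[s] (f v) := by
  induction s with
  | zero => rfl
  | succ s ih => rw [Function.iterate_succ_apply', hf, ih, Function.iterate_succ_apply']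

omit [PerfectRing k p] in
theorem span_map_restrictScalars (M : Submodule (WittVector p k) N) :
    Submodule.span (K₀ p k) ((M.map (f.restrictScalars (WittVector p k)) : Submodule _ V) : Set V) =
      (Submodule.span (K₀ p k) (M : Set N)).map f := by
  rw [Submodule.map_span]
  rfl

theorem SlopesGE.map (hf : ∀ v, f (X.φ v) = Z.φ (f v)) {A : Submodule (K₀ p k) N} {q : ℚ}
    (h : X.SlopesGE A q) : Z.SlopesGE (A.map f) q := by
  obtain ⟨s, r, hs, hqs, M, hM, rfl, hMφ⟩ := h
  refine ⟨s, r, hs, hqs, M.map (f.restrictScalars (WittVector p k)), hM.map _,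
    span_map_restrictScalars M, ?_⟩
  rintro _ ⟨v, hv, rfl⟩
  obtain ⟨w, hw, hvw⟩ := hMφ v hv
  refine ⟨f w, ⟨w, hw, rfl⟩, ?_⟩
  rw [← map_smul, ← hvw, map_iterate hf]
  rfl

theorem SlopesLE.map (hf : ∀ v, f (X.φ v) = Z.φ (f v)) {A : Submodule (K₀ p k) N} {q : ℚ}
    (h : X.SlopesLE A q) : Z.SlopesLE (A.map f) q := by
  obtain ⟨s, r, hs, hqs, M, hM, rfl, hMφ⟩ := h
  refine ⟨s, r, hs, hqs, M.map (f.restrictScalars (WittVector p k)), hM.map _,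
    span_map_restrictScalars M, ?_⟩
  rintro _ ⟨v, hv, rfl⟩
  obtain ⟨w, hw, hvw⟩ := hMφ v hv
  refine ⟨f w, ⟨w, hw, rfl⟩, ?_⟩
  rw [← map_iterate hf, ← hvw, map_smul]
  rfl

theorem IsStable.map (hf : ∀ v, f (X.φ v) = Z.φ (f v)) {A : Submodule (K₀ p k) N}
    (hA : X.IsStable A) : Z.IsStable (A.map f) := by
  intro w
  constructor
  · rintro ⟨c, hc, hcw⟩
    obtain ⟨c, rfl⟩ := X.bijective.2 c
    rw [hf] at hcw
    exact ⟨c, (hA c).mp hc, Z.bijective.1 hcw⟩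
  · rintro ⟨c, hc, rfl⟩
    exact ⟨X.φ c, (hA c).mpr hc, hf c⟩

theorem IsStable.comap (hf : ∀ v, f (X.φ v) = Z.φ (f v)) {B : Submodule (K₀ p k) V}
    (hB : Z.IsStable B) : X.IsStable (B.comap f) := fun v => by
  rw [Submodule.mem_comap, Submodule.mem_comap, hf, hB]

theorem IsIsotypical.map (hf : ∀ v, f (X.φ v) = Z.φ (f v)) {A : Submodule (K₀ p k) N} {l : ℚ}
    (h : X.IsIsotypical A l) : Z.IsIsotypical (A.map f) l := by
  obtain ⟨hA, r, s, hs, rfl, M, hM, rfl, hMφ⟩ := h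
  refine ⟨hA.map hf, r, s, hs, rfl, M.map (f.restrictScalars (WittVector p k)), hM.map _,
    span_map_restrictScalars M, ?_⟩
  have h1 : ((M.map (f.restrictScalars (WittVector p k)) : Submodule _ V) : Set V) = f '' M := rfl
  rw [h1, Set.image_image, Set.image_image]
  have h2 := congrArg (fun S => f '' S) hMφ
  simp only [Set.image_image, map_iterate hf, map_smul] at h2
  exact h2

end Map

theorem IsIsotypical.slopesGE {X : FilteredIsocrystal p k K N} {A : Submodule (K₀ p k) N} {l : ℚ}
    (h : X.IsIsotypical A l) : X.SlopesGE A l := by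
  obtain ⟨hA, r, s, hs, rfl, M, hM, rfl, hMφ⟩ := h
  obtain ⟨s, rfl⟩ := Int.eq_ofNat_of_zero_le hs.le
  have hs' : (0 : ℚ) < s := by exact_mod_cast hs
  refine ⟨s, r, by exact_mod_cast hs, ?_, M, hM, rfl, fun v hv => ?_⟩
  · rw [Int.cast_natCast, div_mul_cancel₀ _ hs'.ne']
  · obtain ⟨w, hw, hvw⟩ : X.φ^[s] v ∈ (fun v => ((p : K₀ p k) ^ r) • v) '' (M : Set N) :=
      hMφ ▸ ⟨v, hv, rfl⟩
    exact ⟨w, hw, hvw.symm⟩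

theorem IsIsotypical.slopesLE {X : FilteredIsocrystal p k K N} {A : Submodule (K₀ p k) N} {l : ℚ}
    (h : X.IsIsotypical A l) : X.SlopesLE A l := by
  obtain ⟨hA, r, s, hs, rfl, M, hM, rfl, hMφ⟩ := h
  obtain ⟨s, rfl⟩ := Int.eq_ofNat_of_zero_le hs.le
  have hs' : (0 : ℚ) < s := by exact_mod_cast hs
  refine ⟨s, r, by exact_mod_cast hs, ?_, M, hM, rfl, fun v hv => ?_⟩
  · rw [Int.cast_natCast, div_mul_cancel₀ _ hs'.ne']
  · obtain ⟨w, hw, hvw⟩ : (p : K₀ p k) ^ r • v ∈ X.φ^[s] '' (M : Set N) := by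
      have : (p : K₀ p k) ^ r • v ∈ (fun v => ((p : K₀ p k) ^ r) • v) '' (M : Set N) :=
        ⟨v, hv, rfl⟩
      rw [← hMφ] at this
      exact this
    exact ⟨w, hw, hvw.symm⟩

theorem iterate_mul_of_slopesGE {X : FilteredIsocrystal p k K N} {s : ℕ} {r : ℤ}
    {M : Submodule (WittVector p k) N} (h : ∀ v ∈ M, ∃ w ∈ M, X.φ^[s] v = (p : K₀ p k) ^ r • w)
    (t : ℕ) : ∀ v ∈ M, ∃ w ∈ M, X.φ^[s * t] v = (p : K₀ p k) ^ (r * t) • w := by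
  induction t with
  | zero => exact fun v hv => ⟨v, hv, by simp⟩
  | succ t ih =>
    intro v hv
    obtain ⟨w, hw, hvw⟩ := ih v hv
    obtain ⟨u, hu, hwu⟩ := h w hw
    refine ⟨u, hu, ?_⟩
    rw [Nat.mul_succ, add_comm, Function.iterate_add_apply, hvw, iterate_zpow_smul, hwu, smul_smul,
      ← zpow_add₀ natCast_p_ne_zero]
    push_cast
    ring_nf

theorem iterate_mul_of_slopesLE {X : FilteredIsocrystal p k K N} {s : ℕ} {r : ℤ}
    {M : Submodule (WittVector p k) N} (h : ∀ v ∈ M, ∃ w ∈ M, (p : K₀ p k) ^ r • v = X.φ^[s] w)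
    (t : ℕ) : ∀ v ∈ M, ∃ w ∈ M, (p : K₀ p k) ^ (r * t) • v = X.φ^[s * t] w := by
  induction t with
  | zero => exact fun v hv => ⟨v, hv, by simp⟩
  | succ t ih =>
    intro v hv
    obtain ⟨w, hw, hvw⟩ := ih v hv
    obtain ⟨u, hu, hwu⟩ := h w hw
    refine ⟨u, hu, ?_⟩
    rw [Nat.mul_succ, Function.iterate_add_apply, ← hwu, iterate_zpow_smul, ← hvw, smul_smul,
      ← zpow_add₀ natCast_p_ne_zero]
    push_cast
    ring_nf

/-- After passing to a common power of `φ`, the sum of two lattices serves for the sum of their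
spans. -/
theorem SlopesGE.sup {X : FilteredIsocrystal p k K N} {A B : Submodule (K₀ p k) N} {q : ℚ}
    (hA : X.SlopesGE A q) (hB : X.SlopesGE B q) : X.SlopesGE (A ⊔ B) q := by
  obtain ⟨s, r, hs, hqs, M, hM, rfl, hMφ⟩ := hA
  obtain ⟨s', r', hs', hqs', M', hM', rfl, hMφ'⟩ := hB
  refine ⟨s * s', min (r * s') (r' * s), Nat.mul_pos hs hs', ?_, M ⊔ M', hM.sup hM', ?_, ?_⟩
  · push_cast
    refine le_min ?_ ?_
    · rw [← mul_assoc]; gcongr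
    · rw [mul_comm (s : ℚ), ← mul_assoc]; gcongr
  · refine le_antisymm (Submodule.span_le.mpr fun v hv => ?_)
      (sup_le (Submodule.span_mono (le_sup_left : M ≤ M ⊔ M'))
        (Submodule.span_mono (le_sup_right : M' ≤ M ⊔ M')))
    obtain ⟨a, ha, b, hb, rfl⟩ := Submodule.mem_sup.mp hv
    exact Submodule.add_mem_sup (Submodule.subset_span ha) (Submodule.subset_span hb)
  · intro v hv
    obtain ⟨a, ha, b, hb, rfl⟩ := Submodule.mem_sup.mp hv
    obtain ⟨a', ha', haa⟩ := iterate_mul_of_slopesGE hMφ s' a ha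
    obtain ⟨b', hb', hbb⟩ := iterate_mul_of_slopesGE hMφ' s b hb
    set m := min (r * s') (r' * s)
    refine ⟨(p : K₀ p k) ^ (r * s' - m) • a' + (p : K₀ p k) ^ (r' * s - m) • b',
      Submodule.add_mem_sup
        (zpow_smul_mem_of_nonneg M ha' (sub_nonneg.mpr (min_le_left _ _)))
        (zpow_smul_mem_of_nonneg M' hb' (sub_nonneg.mpr (min_le_right _ _))), ?_⟩
    rw [iterate_add, haa, mul_comm s s', hbb, smul_add, smul_smul, smul_smul,
      ← zpow_add₀ natCast_p_ne_zero, ← zpow_add₀ natCast_p_ne_zero, add_sub_cancel,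
      add_sub_cancel]

/-- After passing to a common power of `φ`, the sum of two lattices serves for the sum of their
spans. -/
theorem SlopesLE.sup {X : FilteredIsocrystal p k K N} {A B : Submodule (K₀ p k) N} {q : ℚ}
    (hA : X.SlopesLE A q) (hB : X.SlopesLE B q) : X.SlopesLE (A ⊔ B) q := by
  obtain ⟨s, r, hs, hqs, M, hM, rfl, hMφ⟩ := hA
  obtain ⟨s', r', hs', hqs', M', hM', rfl, hMφ'⟩ := hB
  refine ⟨s * s', max (r * s') (r' * s), Nat.mul_pos hs hs', ?_, M ⊔ M', hM.sup hM', ?_, ?_⟩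
  · push_cast
    refine max_le ?_ ?_
    · rw [← mul_assoc]; gcongr
    · rw [mul_comm (s : ℚ), ← mul_assoc]; gcongr
  · refine le_antisymm (Submodule.span_le.mpr fun v hv => ?_)
      (sup_le (Submodule.span_mono (le_sup_left : M ≤ M ⊔ M'))
        (Submodule.span_mono (le_sup_right : M' ≤ M ⊔ M')))
    obtain ⟨a, ha, b, hb, rfl⟩ := Submodule.mem_sup.mp hv
    exact Submodule.add_mem_sup (Submodule.subset_span ha) (Submodule.subset_span hb)
  · intro v hv
    obtain ⟨a, ha, b, hb, rfl⟩ := Submodule.mem_sup.mp hv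
    obtain ⟨a', ha', haa⟩ := iterate_mul_of_slopesLE hMφ s' a ha
    obtain ⟨b', hb', hbb⟩ := iterate_mul_of_slopesLE hMφ' s b hb
    set m := max (r * s') (r' * s)
    refine ⟨(p : K₀ p k) ^ (m - r * s') • a' + (p : K₀ p k) ^ (m - r' * s) • b',
      Submodule.add_mem_sup
        (zpow_smul_mem_of_nonneg M ha' (sub_nonneg.mpr (le_max_left _ _)))
        (zpow_smul_mem_of_nonneg M' hb' (sub_nonneg.mpr (le_max_right _ _))), ?_⟩
    rw [iterate_add, iterate_zpow_smul, iterate_zpow_smul, ← haa, mul_comm s s', ← hbb, smul_add,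
      smul_smul, smul_smul, ← zpow_add₀ natCast_p_ne_zero, ← zpow_add₀ natCast_p_ne_zero,
      sub_add_cancel, sub_add_cancel]

theorem SlopesGE.finset_sup {X : FilteredIsocrystal p k K N} {ι : Type*} {s : Finset ι}
    {A : ι → Submodule (K₀ p k) N} {q : ℚ} (h : ∀ i ∈ s, X.SlopesGE (A i) q) :
    X.SlopesGE (s.sup A) q :=
  Finset.sup_induction (p := fun A => X.SlopesGE A q) (X.slopesGE_bot q)
    (fun _ h1 _ h2 => h1.sup h2) h

theorem SlopesLE.finset_sup {X : FilteredIsocrystal p k K N} {ι : Type*} {s : Finset ι}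
    {A : ι → Submodule (K₀ p k) N} {q : ℚ} (h : ∀ i ∈ s, X.SlopesLE (A i) q) :
    X.SlopesLE (s.sup A) q :=
  Finset.sup_induction (p := fun A => X.SlopesLE A q) (X.slopesLE_bot q)
    (fun _ h1 _ h2 => h1.sup h2) h

/-! ### The lattice of stable subspaces -/

theorem isStable_bot (X : FilteredIsocrystal p k K N) : X.IsStable ⊥ := fun v => by
  rw [Submodule.mem_bot, Submodule.mem_bot, map_eq_zero_iff _ X.bijective.1]

theorem isStable_top (X : FilteredIsocrystal p k K N) : X.IsStable ⊤ := fun v => by simp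

theorem IsStable.inf {X : FilteredIsocrystal p k K N} {A B : Submodule (K₀ p k) N}
    (hA : X.IsStable A) (hB : X.IsStable B) : X.IsStable (A ⊓ B) := fun v =>
  and_congr (hA v) (hB v)

theorem IsStable.sup {X : FilteredIsocrystal p k K N} {A B : Submodule (K₀ p k) N}
    (hA : X.IsStable A) (hB : X.IsStable B) : X.IsStable (A ⊔ B) := by
  intro v
  constructor
  · intro h
    obtain ⟨a, ha, b, hb, hab⟩ := Submodule.mem_sup.mp h
    obtain ⟨a, rfl⟩ := X.bijective.2 a
    obtain ⟨b, rfl⟩ := X.bijective.2 b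
    rw [← map_add] at hab
    rw [← X.bijective.1 hab]
    exact Submodule.add_mem_sup ((hA a).mp ha) ((hB b).mp hb)
  · intro h
    obtain ⟨a, ha, b, hb, rfl⟩ := Submodule.mem_sup.mp h
    rw [map_add]
    exact Submodule.add_mem_sup ((hA a).mpr ha) ((hB b).mpr hb)

theorem IsStable.finset_sup {X : FilteredIsocrystal p k K N} {ι : Type*} {s : Finset ι}
    {A : ι → Submodule (K₀ p k) N} (h : ∀ i ∈ s, X.IsStable (A i)) : X.IsStable (s.sup A) :=
  Finset.sup_induction X.isStable_bot (fun _ h1 _ h2 => h1.sup h2) h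

/-- An isotypical subspace contained in an isotypical subspace of a different slope vanishes: its
Newton number would be the product of its dimension with either slope. -/
theorem IsIsotypical.eq_bot_of_le [FiniteDimensional (K₀ p k) N] {X : FilteredIsocrystal p k K N}
    {A B : Submodule (K₀ p k) N} {l l' : ℚ} (hA : X.IsIsotypical A l) (hB : X.IsIsotypical B l')
    (hAB : A ≤ B) (hl : l ≠ l') : A = ⊥ := by
  have h1 := hA.slopesGE.le_tN hA.1
  have h2 := hA.slopesLE.tN_le hA.1
  have h3 := (hB.slopesGE.of_le hA.1 hAB).le_tN hA.1
  have h4 := (hB.slopesLE.of_le hA.1 hAB).tN_le hA.1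
  have h5 : (l - l') * (finrank (K₀ p k) A : ℚ) = 0 := by linarith
  rcases mul_eq_zero.mp h5 with h | h
  · exact absurd (sub_eq_zero.mp h) hl
  · exact Submodule.finrank_eq_zero.mp (by exact_mod_cast h)

end FilteredIsocrystal

end HodgeNewton

namespace HodgeNewton

namespace FilteredIsocrystal

open Module Matrix

variable {p : ℕ} [Fact p.Prime] {k : Type*} [Field k] [CharP k p] [PerfectRing k p]
  {K : Type*} [Field K] [Algebra (K₀ p k) K]
  {N V U : Type*} [AddCommGroup N] [Module (K₀ p k) N] [AddCommGroup V] [Module (K₀ p k) V]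
  [AddCommGroup U] [Module (K₀ p k) U]

/-! ### Newton and Hodge numbers of subquotients -/

theorem tN_congr [FiniteDimensional (K₀ p k) N] [FiniteDimensional (K₀ p k) V]
    {X : FilteredIsocrystal p k K N} {Y : FilteredIsocrystal p k K V} (e : N ≃ₗ[K₀ p k] V)
    (h : ∀ v, e (X.φ v) = Y.φ (e v)) : X.tN = Y.tN := by
  let b := finBasis (K₀ p k) N
  rw [X.tN_eq b, Y.tN_eq (b.map e)]
  congr 2
  ext i j
  simp [semilinearMatrix, ← h]

theorem tH_sub [FiniteDimensional (K₀ p k) N] (X : FilteredIsocrystal p k K N)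
    (A : Submodule (K₀ p k) N) (hA : X.IsStable A) :
    (X.sub A hA).tH = X.fil.degreeOn (A.baseChange K) :=
  X.fil.degree_comap (baseChange_subtype_injective K A)

theorem tN_sub_congr [FiniteDimensional (K₀ p k) N] {X : FilteredIsocrystal p k K N}
    {A B : Submodule (K₀ p k) N} (h : A = B) (hA : X.IsStable A) (hB : X.IsStable B) :
    (X.sub A hA).tN = (X.sub B hB).tN := by
  subst h
  rfl

theorem tH_sub_congr [FiniteDimensional (K₀ p k) N] {X : FilteredIsocrystal p k K N}
    {A B : Submodule (K₀ p k) N} (h : A = B) (hA : X.IsStable A) (hB : X.IsStable B) :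
    (X.sub A hA).tH = (X.sub B hB).tH := by
  subst h
  rfl

theorem tN_sub_top [FiniteDimensional (K₀ p k) N] (X : FilteredIsocrystal p k K N) :
    (X.sub ⊤ X.isStable_top).tN = X.tN :=
  tN_congr Submodule.topEquiv fun _ => rfl

theorem tN_sub_bot [FiniteDimensional (K₀ p k) N] (X : FilteredIsocrystal p k K N) :
    (X.sub ⊥ X.isStable_bot).tN = 0 := by
  rw [(X.sub ⊥ X.isStable_bot).tN_eq (Basis.empty (ι := Fin 0) _), Matrix.det_isEmpty, vp_one]

theorem tH_sub_top [FiniteDimensional (K₀ p k) N] (X : FilteredIsocrystal p k K N) :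
    (X.sub ⊤ X.isStable_top).tH = X.tH := by
  obtain ⟨a, n, ha, hb⟩ := X.fil.exists_bounds
  rw [tH_sub, Submodule.baseChange_top, VecFiltration.degreeOn_eq _ ha hb, tH,
    VecFiltration.degree_eq ha hb, finrank_top]
  congr 1
  exact Finset.sum_congr rfl fun _ _ => by rw [top_inf_eq]

theorem tH_sub_bot [FiniteDimensional (K₀ p k) N] (X : FilteredIsocrystal p k K N) :
    (X.sub ⊥ X.isStable_bot).tH = 0 := by
  obtain ⟨a, n, ha, hb⟩ := X.fil.exists_bounds
  rw [tH_sub, Submodule.baseChange_bot, VecFiltration.degreeOn_eq _ ha hb, finrank_bot,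
    Finset.sum_eq_zero fun _ _ => by rw [bot_inf_eq, finrank_bot, Nat.cast_zero]]
  simp

section SubSub

variable {X : FilteredIsocrystal p k K N} {A : Submodule (K₀ p k) N} (hA : X.IsStable A)
  {D : Submodule (K₀ p k) A} (hD : (X.sub A hA).IsStable D)

include hD in
theorem isStable_map_subtype : X.IsStable (D.map A.subtype) :=
  hD.map (X := X.sub A hA) (f := A.subtype) fun _ => rfl

variable [FiniteDimensional (K₀ p k) N]

theorem tN_sub_sub : ((X.sub A hA).sub D hD).tN =
    (X.sub (D.map A.subtype) (isStable_map_subtype hA hD)).tN :=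
  tN_congr (Submodule.equivMapOfInjective A.subtype A.injective_subtype D) fun _ => rfl

theorem tH_sub_sub : ((X.sub A hA).sub D hD).tH =
    (X.sub (D.map A.subtype) (isStable_map_subtype hA hD)).tH := by
  have h1 := X.fil.degree_comap (f := A.subtype.baseChange K ∘ₗ D.subtype.baseChange K)
    ((baseChange_subtype_injective K A).comp (baseChange_subtype_injective K D))
  have h2 : LinearMap.range (A.subtype.baseChange K ∘ₗ D.subtype.baseChange K) =
      (D.map A.subtype).baseChange K := by
    let e := Submodule.equivMapOfInjective A.subtype A.injective_subtype D
    have : A.subtype ∘ₗ D.subtype = (D.map A.subtype).subtype ∘ₗ e.toLinearMap := rfl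
    rw [← LinearMap.baseChange_comp, this, LinearMap.baseChange_comp]
    refine LinearMap.range_comp_of_range_eq_top _ ?_
    exact LinearMap.range_eq_top.mpr (e.baseChange (A := K)).surjective
  rw [tH_sub X, ← h2, ← h1]
  rfl

end SubSub

section QuotSub

variable {X : FilteredIsocrystal p k K N} {A B : Submodule (K₀ p k) N}

theorem isStable_map_mkQ (hA : X.IsStable A) (hB : X.IsStable B) :
    (X.quot B hB).IsStable (A.map B.mkQ) :=
  hA.map (Z := X.quot B hB) (f := B.mkQ) fun _ => rfl

theorem isShortExact_quot_sub (hA : X.IsStable A) (hB : X.IsStable B) :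
    IsShortExact (X.sub (A ⊓ B) (hA.inf hB)) (X.sub A hA)
      ((X.quot B hB).sub (A.map B.mkQ) (isStable_map_mkQ hA hB))
      (Submodule.inclusion inf_le_left)
      (B.mkQ.restrict fun _ hv => Submodule.mem_map_of_mem hv) where
  injective := Submodule.inclusion_injective _
  surjective := by
    rintro ⟨_, v, hv, rfl⟩
    exact ⟨⟨v, hv⟩, rfl⟩
  range_eq_ker := by
    ext v
    rw [Submodule.range_inclusion, LinearMap.mem_ker, Submodule.mem_comap, ← Subtype.coe_inj]
    change _ ↔ B.mkQ v = 0
    rw [Submodule.mkQ_apply, Submodule.Quotient.mk_eq_zero]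
    exact ⟨fun h => h.2, fun h => ⟨v.2, h⟩⟩
  left_φ _ := rfl
  right_φ _ := rfl

theorem isStrictExact_quot_sub (hA : X.IsStable A) (hB : X.IsStable B) (hBA : B ≤ A) :
    IsStrictExact (X.sub B hB) (X.sub A hA)
      ((X.quot B hB).sub (A.map B.mkQ) (isStable_map_mkQ hA hB))
      (Submodule.inclusion hBA)
      (B.mkQ.restrict fun _ hv => Submodule.mem_map_of_mem hv) where
  injective := Submodule.inclusion_injective _
  surjective := (isShortExact_quot_sub hA hB).surjective
  range_eq_ker := by
    rw [← (isShortExact_quot_sub hA hB).range_eq_ker, Submodule.range_inclusion,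
      Submodule.range_inclusion, inf_eq_right.mpr hBA]
  left_φ _ := rfl
  right_φ _ := rfl
  left_fil i := by
    change (X.fil.Fil i).comap _ = ((X.fil.Fil i).comap _).comap _
    rw [← Submodule.comap_comp, ← LinearMap.baseChange_comp]
    rfl
  right_fil i := by
    refine map_comap_eq_comap_map (baseChange_subtype_injective K _)
      (LinearMap.lTensor_surjective K (isShortExact_quot_sub hA hB).surjective) ?_ ?_ _
    · rw [← LinearMap.baseChange_comp, ← LinearMap.baseChange_comp]
      rfl
    · rw [← range_baseChange_eq_ker (f := B.subtype) K B.mkQ_surjective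
        (by rw [Submodule.range_subtype, Submodule.ker_mkQ])]
      have : B.subtype = A.subtype ∘ₗ Submodule.inclusion hBA := rfl
      rw [this, LinearMap.baseChange_comp]
      exact LinearMap.range_comp_le_range _ _

variable [FiniteDimensional (K₀ p k) N]

/-- The Newton number is modular, by `(A ⊔ B) / B ≅ A / (A ⊓ B)`. -/
theorem tN_sup_add_tN_inf (hA : X.IsStable A) (hB : X.IsStable B) :
    (X.sub (A ⊔ B) (hA.sup hB)).tN + (X.sub (A ⊓ B) (hA.inf hB)).tN =
      (X.sub A hA).tN + (X.sub B hB).tN := by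
  have h1 := (isShortExact_quot_sub hA hB).tN_eq
  have h2 := (isStrictExact_quot_sub (hA.sup hB) hB le_sup_right).tN_eq
  have h3 : (A ⊔ B).map B.mkQ = A.map B.mkQ := by
    rw [Submodule.map_sup, Submodule.mkQ_map_self, sup_bot_eq]
  have h4 : ((X.quot B hB).sub ((A ⊔ B).map B.mkQ) (isStable_map_mkQ (hA.sup hB) hB)).tN =
      ((X.quot B hB).sub (A.map B.mkQ) (isStable_map_mkQ hA hB)).tN :=
    tN_sub_congr h3 _ _
  linarith

/-- Hodge numbers of stable subspaces are supermodular. -/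
theorem tH_add_tH_le (hA : X.IsStable A) (hB : X.IsStable B) :
    (X.sub A hA).tH + (X.sub B hB).tH ≤
      (X.sub (A ⊓ B) (hA.inf hB)).tH + (X.sub (A ⊔ B) (hA.sup hB)).tH := by
  simp only [tH_sub]
  have h := X.fil.degreeOn_add_le (A.baseChange K) (B.baseChange K)
  have h1 : (A ⊔ B).baseChange K = A.baseChange K ⊔ B.baseChange K := baseChange_sup ..
  have h2 : (A ⊓ B).baseChange K = A.baseChange K ⊓ B.baseChange K := baseChange_inf ..
  rwa [h1, h2]

end QuotSub

end FilteredIsocrystal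

end HodgeNewton

namespace HodgeNewton

namespace FilteredIsocrystal

open Module Matrix

variable {p : ℕ} [Fact p.Prime] {k : Type*} [Field k] [CharP k p] [PerfectRing k p]
  {K : Type*} [Field K] [Algebra (K₀ p k) K]
  {N V : Type*} [AddCommGroup N] [Module (K₀ p k) N] [AddCommGroup V] [Module (K₀ p k) V]

/-! ### Slope decompositions -/

namespace SlopeDecomposition

variable {X : FilteredIsocrystal p k K N} (D : X.SlopeDecomposition)

/-- The sum of the isotypical components with index in `J`. -/
def part (J : Finset (Fin D.m)) : Submodule (K₀ p k) N := J.sup D.comp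

theorem supIndep : (Finset.univ : Finset (Fin D.m)).SupIndep D.comp :=
  iSupIndep.supIndep (D.isInternal.submodule_iSupIndep.comp Subtype.val_injective)

theorem part_univ : D.part Finset.univ = ⊤ := by
  rw [part, Finset.sup_univ_eq_iSup, D.isInternal.submodule_iSup_eq_top]

theorem disjoint_part {J J' : Finset (Fin D.m)} (h : Disjoint J J') :
    Disjoint (D.part J) (D.part J') :=
  D.supIndep.disjoint_sup_sup (Finset.subset_univ _) (Finset.subset_univ _) h

theorem part_union (J J' : Finset (Fin D.m)) : D.part (J ∪ J') = D.part J ⊔ D.part J' :=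
  Finset.sup_union

theorem part_mono {J J' : Finset (Fin D.m)} (h : J ⊆ J') : D.part J ≤ D.part J' :=
  Finset.sup_mono h

theorem part_singleton (i : Fin D.m) : D.part {i} = D.comp i := Finset.sup_singleton

theorem isCompl_part (J : Finset (Fin D.m)) : IsCompl (D.part J) (D.part Jᶜ) :=
  ⟨D.disjoint_part disjoint_compl_right, codisjoint_iff.mpr (by
    rw [← part_union, Finset.union_compl, part_univ])⟩

theorem comp_le_part {J : Finset (Fin D.m)} {i : Fin D.m} (h : i ∈ J) : D.comp i ≤ D.part J :=
  Finset.le_sup h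

theorem isStable_part (J : Finset (Fin D.m)) : X.IsStable (D.part J) :=
  IsStable.finset_sup fun i _ => (D.isotypical i).1

theorem le_part_compl {C : Submodule (K₀ p k) N} {T : Finset (Fin D.m)}
    (h : ∀ i ∈ T, C ≤ D.part {i}ᶜ) : C ≤ D.part Tᶜ := by
  induction T using Finset.induction_on with
  | empty => rw [Finset.compl_empty, part_univ]; exact le_top
  | insert i T hi ih =>
    have h1 := ih fun j hj => h j (Finset.mem_insert_of_mem hj)
    have h2 := h i (Finset.mem_insert_self i T)
    have h3 : (Tᶜ : Finset (Fin D.m)) = (insert i T)ᶜ ∪ {i} := by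
      ext j
      simp only [Finset.mem_compl, Finset.mem_union, Finset.mem_insert, Finset.mem_singleton]
      by_cases hj : j = i
      · simp [hj, hi]
      · simp [hj]
    have h4 : D.part (insert i T)ᶜ ≤ D.part {i}ᶜ := D.part_mono (Finset.compl_subset_compl.mpr
      (by simp))
    rw [h3, part_union] at h1
    refine (le_inf h1 h2).trans ?_
    rw [sup_inf_assoc_of_le _ h4, (D.isCompl_part {i}).inf_eq_bot, sup_bot_eq]

variable [FiniteDimensional (K₀ p k) N]

/-- An isotypical subspace has no component along the `D.comp i` of different slope. -/
theorem le_part_compl_singleton {C : Submodule (K₀ p k) N} {l : ℚ} (hC : X.IsIsotypical C l)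
    {i : Fin D.m} (hi : D.slope i ≠ l) : C ≤ D.part {i}ᶜ := by
  have hB := D.isStable_part {i}ᶜ
  have h1 : (X.quot _ hB).IsIsotypical (C.map (D.part {i}ᶜ).mkQ) l := hC.map fun _ => rfl
  have h2 : (X.quot _ hB).IsIsotypical ((D.comp i).map (D.part {i}ᶜ).mkQ) (D.slope i) :=
    (D.isotypical i).map fun _ => rfl
  have h3 : (D.comp i).map (D.part {i}ᶜ).mkQ = ⊤ := by
    have h := congrArg (Submodule.map (D.part {i}ᶜ).mkQ) (D.isCompl_part {i}).sup_eq_top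
    rwa [Submodule.map_sup, Submodule.mkQ_map_self, sup_bot_eq, part_singleton,
      Submodule.map_top, Submodule.range_mkQ] at h
  have h4 := h1.eq_bot_of_le h2 (h3 ▸ le_top) (Ne.symm hi)
  intro v hv
  have h5 : (D.part {i}ᶜ).mkQ v ∈ C.map (D.part {i}ᶜ).mkQ := Submodule.mem_map_of_mem hv
  rwa [h4, Submodule.mem_bot, Submodule.mkQ_apply, Submodule.Quotient.mk_eq_zero] at h5

/-- A nonzero isotypical subspace lies in the isotypical component of the same slope. -/
theorem exists_comp_of_isIsotypical {C : Submodule (K₀ p k) N} {l : ℚ} (hC : X.IsIsotypical C l)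
    (h0 : C ≠ ⊥) : ∃ i, D.slope i = l ∧ C ≤ D.comp i := by
  have h1 : C ≤ D.part (Finset.univ.filter fun i => D.slope i ≠ l)ᶜ :=
    D.le_part_compl fun i hi => D.le_part_compl_singleton hC (Finset.mem_filter.mp hi).2
  by_cases h : ∃ i, D.slope i = l
  · obtain ⟨i, rfl⟩ := h
    refine ⟨i, rfl, h1.trans ?_⟩
    rw [← D.part_singleton i]
    refine D.part_mono fun j hj => ?_
    simp only [Finset.compl_filter, not_not, Finset.mem_filter, Finset.mem_univ, true_and] at hj
    exact Finset.mem_singleton.mpr (D.strictMono.injective hj)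
  · push Not at h
    exfalso
    refine h0 (le_bot_iff.mp (h1.trans ?_))
    rw [Finset.filter_true_of_mem fun i _ => h i, Finset.compl_univ]
    exact Finset.sup_empty.le

theorem exists_comp_eq (D' : X.SlopeDecomposition) (i : Fin D.m) :
    ∃ j, D'.slope j = D.slope i ∧ D'.comp j = D.comp i := by
  obtain ⟨j, hj, hij⟩ := D'.exists_comp_of_isIsotypical (D.isotypical i) (D.ne_bot i)
  obtain ⟨i', hi', hji⟩ := D.exists_comp_of_isIsotypical (D'.isotypical j) (D'.ne_bot j)
  obtain rfl : i' = i := D.strictMono.injective (hi'.trans hj)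
  exact ⟨j, hj, le_antisymm hji hij⟩

/-- The slope decomposition is unique: sums over it do not depend on the choice. -/
theorem sum_eq {M : Type*} [AddCommMonoid M] (D' : X.SlopeDecomposition)
    (F : ℚ → Submodule (K₀ p k) N → M) :
    ∑ i, F (D.slope i) (D.comp i) = ∑ i, F (D'.slope i) (D'.comp i) := by
  choose e he hec using D.exists_comp_eq D'
  refine Fintype.sum_bijective e ⟨fun i i' h => ?_, fun j => ?_⟩ _ _ fun i => by rw [he, hec]
  · exact D.strictMono.injective (by rw [← he, ← he, h])
  · obtain ⟨i, hi, -⟩ := D'.exists_comp_eq D j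
    exact ⟨i, D'.strictMono.injective ((he i).trans hi)⟩

theorem finrank_part (J : Finset (Fin D.m)) :
    finrank (K₀ p k) (D.part J) = ∑ i ∈ J, finrank (K₀ p k) (D.comp i) := by
  induction J using Finset.induction_on with
  | empty => exact (congrArg (fun S : Submodule (K₀ p k) N => finrank (K₀ p k) S)
      Finset.sup_empty).trans (by simp)
  | insert i J hi ih =>
    have h1 := Submodule.finrank_sup_add_finrank_inf_eq (D.comp i) (D.part J)
    have h2 : D.comp i ⊓ D.part J = ⊥ := by
      rw [← D.part_singleton, (D.disjoint_part (Finset.disjoint_singleton_left.mpr hi)).eq_bot]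
    rw [h2, finrank_bot, add_zero, ih] at h1
    rw [Finset.sum_insert hi, ← h1, Finset.insert_eq, part_union, part_singleton]

theorem tN_comp (i : Fin D.m) (h : X.IsStable (D.comp i)) :
    ((X.sub (D.comp i) h).tN : ℚ) = D.slope i * finrank (K₀ p k) (D.comp i) :=
  le_antisymm ((D.isotypical i).slopesLE.tN_le h) ((D.isotypical i).slopesGE.le_tN h)

theorem tN_part (J : Finset (Fin D.m)) :
    ((X.sub (D.part J) (D.isStable_part J)).tN : ℚ) =
      ∑ i ∈ J, D.slope i * finrank (K₀ p k) (D.comp i) := by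
  induction J using Finset.induction_on with
  | empty =>
    rw [Finset.sum_empty, tN_sub_congr (show D.part ∅ = ⊥ from Finset.sup_empty) _ X.isStable_bot,
      tN_sub_bot, Int.cast_zero]
  | insert i J hi ih =>
    have h1 := tN_sup_add_tN_inf (D.isotypical i).1 (D.isStable_part J)
    have h2 : D.comp i ⊓ D.part J = ⊥ := by
      rw [← D.part_singleton, (D.disjoint_part (Finset.disjoint_singleton_left.mpr hi)).eq_bot]
    rw [tN_sub_congr h2 _ X.isStable_bot, tN_sub_bot, add_zero] at h1
    have h3 : D.part (insert i J) = D.comp i ⊔ D.part J := by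
      rw [Finset.insert_eq, part_union, part_singleton]
    rw [Finset.sum_insert hi, ← ih, ← D.tN_comp i (D.isotypical i).1,
      tN_sub_congr h3 _ ((D.isotypical i).1.sup (D.isStable_part J)), h1]
    push_cast
    rfl

omit [FiniteDimensional (K₀ p k) N] in
/-- A quotient of `X` by a sum of isotypical components inherits a slope decomposition, whose
components are the images of the remaining ones. -/
theorem exists_of_surjective {Z : FilteredIsocrystal p k K V} {f : N →ₗ[K₀ p k] V}
    (hφ : ∀ v, f (X.φ v) = Z.φ (f v)) (hf : Function.Surjective f) (J : Finset (Fin D.m))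
    (hker : LinearMap.ker f = D.part Jᶜ) :
    ∃ D' : Z.SlopeDecomposition, ∀ {M : Type} [AddCommMonoid M] (F : ℚ → ℕ → M),
      ∑ i, F (D'.slope i) (finrank (K₀ p k) (D'.comp i)) =
        ∑ i ∈ J, F (D.slope i) (finrank (K₀ p k) (D.comp i)) := by
  let e := J.orderEmbOfFin (k := J.card) rfl
  have heJ : ∀ i, e i ∈ J := fun i => J.orderEmbOfFin_mem rfl i
  have heq : ∀ i ∈ J, ∃ i', e i' = i := fun i hi => by
    have : i ∈ Set.range e := by rw [Finset.range_orderEmbOfFin]; exact hi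
    exact this
  have hdisj : ∀ i ∈ J, Disjoint (D.comp i) (D.part (J.erase i) ⊔ LinearMap.ker f) := by
    intro i hi
    rw [hker, ← part_union, ← part_singleton]
    exact D.disjoint_part (Finset.disjoint_singleton_left.mpr (by simp [hi]))
  have hinj : ∀ i ∈ J, Function.Injective (f.domRestrict (D.comp i)) := by
    intro i hi
    rw [injective_iff_map_eq_zero]
    intro v hv
    exact Subtype.ext (Submodule.disjoint_def.mp (hdisj i hi) v v.2
      (Submodule.mem_sup_right (LinearMap.mem_ker.mpr hv)))
  have hrank : ∀ i ∈ J, finrank (K₀ p k) ((D.comp i).map f) = finrank (K₀ p k) (D.comp i) := by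
    intro i hi
    rw [← LinearMap.range_domRestrict, LinearMap.finrank_range_of_inj (hinj i hi)]
  let D' : Z.SlopeDecomposition :=
    { m := J.card
      slope := fun i => D.slope (e i)
      strictMono := D.strictMono.comp e.strictMono
      comp := fun i => (D.comp (e i)).map f
      ne_bot := fun i h => D.ne_bot (e i) <| (Submodule.eq_bot_iff _).mpr fun v hv => by
        have h1 : f v ∈ (D.comp (e i)).map f := Submodule.mem_map_of_mem hv
        rw [h, Submodule.mem_bot] at h1
        exact congrArg Subtype.val
          (hinj (e i) (heJ i) (a₁ := ⟨v, hv⟩) (a₂ := 0) (by simpa using h1))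
      isotypical := fun i => (D.isotypical (e i)).map hφ
      isInternal := by
        rw [DirectSum.isInternal_submodule_iff_iSupIndep_and_iSup_eq_top]
        constructor
        · rw [iSupIndep_def]
          intro i
          refine Disjoint.mono_right (c := (D.part (J.erase (e i))).map f) ?_ ?_
          · refine iSup₂_le fun j hj => Submodule.map_mono (D.comp_le_part ?_)
            exact Finset.mem_erase.mpr ⟨fun h => hj (e.injective h), heJ j⟩
          · rw [Submodule.disjoint_def]
            rintro _ ⟨c, hc, rfl⟩ ⟨t, ht, htc⟩
            have h1 : c ∈ D.part (J.erase (e i)) ⊔ LinearMap.ker f := by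
              have h2 : c = t + (c - t) := by abel
              rw [h2]
              exact Submodule.add_mem_sup ht (by rw [LinearMap.mem_ker, map_sub, htc, sub_self])
            rw [Submodule.disjoint_def.mp (hdisj _ (heJ i)) c hc h1, map_zero]
        · have h := congrArg (Submodule.map f) (D.isCompl_part J).sup_eq_top
          rw [Submodule.map_sup, ← hker, Submodule.map_top, LinearMap.range_eq_top.mpr hf,
            (LinearMap.le_ker_iff_map (f := f)).mp le_rfl, sup_bot_eq] at h
          rw [eq_top_iff, ← h, Submodule.map_le_iff_le_comap]
          refine Finset.sup_le fun i hi => ?_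
          obtain ⟨i', rfl⟩ := heq i hi
          rw [← Submodule.map_le_iff_le_comap]
          exact le_iSup (fun i => (D.comp (e i)).map f) i' }
  refine ⟨D', fun F => ?_⟩
  conv_rhs => rw [← Finset.map_orderEmbOfFin_univ J rfl, Finset.sum_map]
  refine Finset.sum_congr rfl fun i _ => ?_
  exact congrArg (F (D.slope (e i))) (hrank (e i) (heJ i))

end SlopeDecomposition

end FilteredIsocrystal

end HodgeNewton

namespace HodgeNewton

open Module Polynomial

/-! ### Elements of `K₀` fixed by the Frobenius -/

section Fixed

variable {p : ℕ} [Fact p.Prime] {k : Type*} [Field k] [CharP k p]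

/-- The coefficients of a Witt vector fixed by the Frobenius are fixed by the `p`-th power map, so
they lie in the prime field. -/
theorem exists_map_eq_of_frobenius_eq {w : WittVector p k} (hw : WittVector.frobenius w = w) :
    ∃ w₀ : WittVector p (ZMod p), WittVector.map (ZMod.castHom (dvd_refl p) k) w₀ = w := by
  have h : ∀ n, ∃ c : ZMod p, ZMod.castHom (dvd_refl p) k c = w.coeff n := by
    intro n
    have h1 : w.coeff n ^ p = w.coeff n := by
      rw [← WittVector.coeff_frobenius_charP, hw]
    have h2 := (Subfield.mem_bot_iff_pow_eq_self k p).mpr h1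
    rw [← ZMod.fieldRange_castHom_eq_bot p] at h2
    exact h2
  choose c hc using h
  exact ⟨WittVector.mk p c, WittVector.ext fun n => by
    rw [WittVector.map_coeff, WittVector.coeff_mk, hc]⟩

theorem padicToK₀_algebraMap (x : ℤ_[p]) :
    padicToK₀ p k (algebraMap ℤ_[p] ℚ_[p] x) = padicIntToK₀ p k x :=
  IsFractionRing.lift_algebraMap (padicIntToK₀_injective p k) x

variable [PerfectRing k p]

/-- The elements of `K₀` fixed by the Frobenius are those of `ℚ_p`. -/
theorem exists_padicToK₀_eq {x : K₀ p k}
    (hx : WittVector.FractionRing.frobeniusRingHom p k x = x) : ∃ y, padicToK₀ p k y = x := by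
  obtain ⟨a, b, hb, rfl⟩ := IsFractionRing.div_surjective (A := WittVector p k) x
  obtain ⟨n, u, rfl⟩ := WittVector.exists_eq_pow_p_mul' b (nonZeroDivisors.ne_zero hb)
  have hu : algebraMap (WittVector p k) (K₀ p k) u ≠ 0 := by simp
  have hp : (p : K₀ p k) ^ n ≠ 0 := pow_ne_zero _ natCast_p_ne_zero
  have h1 : algebraMap (WittVector p k) (K₀ p k) (a * ((u⁻¹ : (WittVector p k)ˣ) : WittVector p k)) =
      (p : K₀ p k) ^ n * (algebraMap (WittVector p k) (K₀ p k) a /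
        algebraMap (WittVector p k) (K₀ p k) ((p : WittVector p k) ^ n * u)) := by
    have h2 : algebraMap (WittVector p k) (K₀ p k) ((u⁻¹ : (WittVector p k)ˣ) : WittVector p k) *
        algebraMap (WittVector p k) (K₀ p k) u = 1 := by
      rw [← map_mul, Units.inv_mul, map_one]
    rw [map_mul, map_mul, map_pow, map_natCast, eq_inv_of_mul_eq_one_left h2]
    field_simp
  set x := algebraMap (WittVector p k) (K₀ p k) a /
    algebraMap (WittVector p k) (K₀ p k) ((p : WittVector p k) ^ n * u)
  have h2 : WittVector.frobenius (a * ((u⁻¹ : (WittVector p k)ˣ) : WittVector p k)) =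
      a * ((u⁻¹ : (WittVector p k)ˣ) : WittVector p k) := by
    apply IsFractionRing.injective (WittVector p k) (K₀ p k)
    rw [← frobenius_algebraMap, h1, map_mul, map_pow, map_natCast, hx]
  obtain ⟨w, hw⟩ := exists_map_eq_of_frobenius_eq h2
  refine ⟨algebraMap ℤ_[p] ℚ_[p] (WittVector.equiv p w) / (p : ℚ_[p]) ^ n, ?_⟩
  rw [map_div₀, padicToK₀_algebraMap, map_pow, map_natCast, div_eq_iff hp, mul_comm x, ← h1, ← hw]
  simp [padicIntToK₀]

end Fixed

/-! ### Multiplicities of roots -/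

/-- If all roots of `g` are roots of the irreducible polynomial `f`, then `g` is a power of `f` up
to a constant, so that all roots of `f` have the same multiplicity in `g`. -/
theorem rootMultiplicity_mul_natDegree {k Ω : Type*} [Field k] [Field Ω] [IsAlgClosed Ω]
    (j : k →+* Ω) {f g : k[X]} (hf : Irreducible f) (hsep : f.Separable) (hg : g ≠ 0)
    (h : ∀ μ : Ω, (g.map j).IsRoot μ → (f.map j).IsRoot μ) {μ : Ω} (hμ : (f.map j).IsRoot μ) :
    (g.map j).rootMultiplicity μ * f.natDegree = g.natDegree := by
  classical
  obtain ⟨m, q, hq, rfl⟩ : ∃ (m : ℕ) (q : k[X]), ¬ f ∣ q ∧ g = f ^ m * q := by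
    have hfin : FiniteMultiplicity f g :=
      FiniteMultiplicity.of_prime_left hf.prime hg
    obtain ⟨c, hc, hc'⟩ := hfin.exists_eq_pow_mul_and_not_dvd
    exact ⟨_, c, hc', hc⟩
  have hf0 : f.map j ≠ 0 := (Polynomial.map_ne_zero_iff j.injective).mpr hf.ne_zero
  obtain ⟨a, b, hab⟩ := (Irreducible.coprime_iff_not_dvd hf).mpr hq
  have hdeg : q.degree = 0 := by
    by_contra hd
    have hd' : (q.map j).degree ≠ 0 := by rwa [Polynomial.degree_map]
    obtain ⟨ν, hν⟩ := IsAlgClosed.exists_root _ hd'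
    have h1 := h ν (by rw [Polynomial.map_mul, IsRoot, eval_mul, hν, mul_zero])
    have h2 := congrArg (fun r => (r.map j).eval ν) hab
    simp only [Polynomial.map_add, Polynomial.map_mul, eval_add, eval_mul, Polynomial.map_one,
      eval_one] at h2
    rw [hν, h1] at h2
    simp at h2
  obtain ⟨c, rfl⟩ : ∃ c, q = C c := ⟨_, Polynomial.eq_C_of_degree_eq_zero hdeg⟩
  have hc : c ≠ 0 := by
    rintro rfl
    simp at hg
  have hr1 : (f.map j).rootMultiplicity μ = 1 :=
    le_antisymm (Polynomial.rootMultiplicity_le_one_of_separable hsep.map μ)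
      ((Polynomial.rootMultiplicity_pos hf0).mpr hμ)
  rw [Polynomial.map_mul, Polynomial.map_pow, Polynomial.map_C, mul_comm _ (C _),
    ← Polynomial.count_roots, Polynomial.roots_C_mul _ ((map_ne_zero j).mpr hc),
    Polynomial.roots_pow, Multiset.count_nsmul, Polynomial.count_roots, hr1, mul_one,
    mul_comm _ (C c), Polynomial.natDegree_C_mul hc, Polynomial.natDegree_pow]

/-! ### The characteristic polynomial of the action of a coefficient -/

namespace FilteredIsocrystalWithCoeff

variable {p : ℕ} [Fact p.Prime] {k : Type*} [Field k] [CharP k p] [PerfectRing k p]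
  {K : Type*} [Field K] [Algebra (K₀ p k) K] {F : Type*} [Field F] [Algebra ℚ_[p] F]
  {N : Type*} [AddCommGroup N] [Module (K₀ p k) N]

theorem aeval_ι (X : FilteredIsocrystalWithCoeff p k K F N) (a : F) (h : ℚ_[p][X]) :
    aeval (X.ι a) (h.map (padicToK₀ p k)) = X.ι (aeval a h) := by
  induction h using Polynomial.induction_on' with
  | add f g hf hg => rw [Polynomial.map_add, map_add, hf, hg, map_add, map_add]
  | monomial n c =>
    rw [Polynomial.map_monomial, aeval_monomial, aeval_monomial, map_mul, map_pow]
    congr 1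
    ext v
    rw [X.ι_padic, Module.algebraMap_end_apply]

variable [FiniteDimensional (K₀ p k) N]

/-- The characteristic polynomial of `ι(a)` is fixed by the Frobenius: if `M` and `P` are the
matrices of `ι(a)` and `φ`, then `P * σ(M) = M * P`, because `ι(a)` commutes with `φ`. -/
theorem charpoly_map_frobenius (X : FilteredIsocrystalWithCoeff p k K F N) (a : F) :
    (LinearMap.charpoly (X.ι a)).map (WittVector.FractionRing.frobeniusRingHom p k) =
      LinearMap.charpoly (X.ι a) := by
  let b := finBasis (K₀ p k) N
  set M := LinearMap.toMatrix b b (X.ι a) with hM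
  set P := semilinearMatrix b X.φ with hP
  have h1 : P * M.map (WittVector.FractionRing.frobeniusRingHom p k) = M * P := by
    ext i j
    have h2 := congrFun (repr_semilinear b X.φ (X.ι a (b j))) i
    have h3 := congrFun (LinearMap.toMatrix_mulVec_repr b b (X.ι a) (X.φ (b j))) i
    rw [X.ι_φ] at h3
    refine Eq.trans ?_ (h2.symm.trans (h3.symm.trans ?_))
    · simp only [Matrix.mul_apply, Matrix.mulVec, dotProduct, Matrix.map_apply, hM,
        LinearMap.toMatrix_apply]
      rfl
    · rfl
  have hu : IsUnit P := (Matrix.isUnit_iff_isUnit_det P).mpr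
    (X.det_ne_zero b).isUnit
  obtain ⟨u, hu⟩ := hu
  have h2 := Matrix.charpoly_units_conj u
    (M.map (WittVector.FractionRing.frobeniusRingHom p k))
  rw [hu, h1, ← hu, mul_assoc, ← Matrix.coe_units_inv, Units.mul_inv, mul_one, Matrix.charpoly_map,
    LinearMap.charpoly_toMatrix] at h2
  exact h2.symm

/-- The characteristic polynomial of `ι(a)` has coefficients in `ℚ_p`. -/
theorem exists_charpoly_eq_map (X : FilteredIsocrystalWithCoeff p k K F N) (a : F) :
    ∃ g : ℚ_[p][X], g.map (padicToK₀ p k) = LinearMap.charpoly (X.ι a) := by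
  rw [← Polynomial.mem_lifts, Polynomial.lifts_iff_coeff_lifts]
  intro n
  apply exists_padicToK₀_eq
  rw [← Polynomial.coeff_map, X.charpoly_map_frobenius]

end FilteredIsocrystalWithCoeff

end HodgeNewton

namespace HodgeNewton

open Module Polynomial

/-! ### Dimensions of independent families and of eigenspaces -/

section LinearAlgebra

variable {L V : Type*} [Field L] [AddCommGroup V] [Module L V] [FiniteDimensional L V]

theorem finrank_finset_sup {ι : Type*} {s : Finset ι} {A : ι → Submodule L V}
    (h : s.SupIndep A) : finrank L (s.sup A : Submodule L V) = ∑ i ∈ s, finrank L (A i) := by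
  classical
  induction s using Finset.induction_on with
  | empty => rw [Finset.sup_empty, finrank_bot, Finset.sum_empty]
  | insert i s hi ih =>
    have h1 := Submodule.finrank_sup_add_finrank_inf_eq (A i) (s.sup A)
    have h2 : A i ⊓ s.sup A = ⊥ :=
      (h (Finset.subset_insert i s) (Finset.mem_insert_self i s) hi).eq_bot
    rw [h2, finrank_bot, add_zero, ih (h.subset (Finset.subset_insert i s))] at h1
    rw [Finset.sup_insert, Finset.sum_insert hi, h1]

/-- The dimension of an invariant subspace of a diagonalizable endomorphism is the sum of the
dimensions of its intersections with the eigenspaces. -/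
theorem finrank_eq_sum_inf_eigenspace {T : Type*} [Fintype T] {θ : Module.End L V} {c : T → L}
    (hc : Function.Injective c) (hθ : ⨆ μ, θ.eigenspace μ = ⊤)
    (h : ∀ μ, θ.eigenspace μ ≠ ⊥ → ∃ t, c t = μ) {U : Submodule L V} (hU : ∀ v ∈ U, θ v ∈ U) :
    finrank L U = ∑ t, finrank L (θ.eigenspace (c t) ⊓ U : Submodule L V) := by
  have h1 : U = ⨆ μ, U ⊓ θ.eigenspace μ := Submodule.eq_iSup_inf_genEigenspace 1 hU hθ
  have h2 : ⨆ μ, U ⊓ θ.eigenspace μ = Finset.univ.sup fun t => θ.eigenspace (c t) ⊓ U := by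
    rw [Finset.sup_univ_eq_iSup]
    refine le_antisymm (iSup_le fun μ => ?_) (iSup_le fun t => ?_)
    · by_cases hμ : θ.eigenspace μ = ⊥
      · rw [hμ, inf_bot_eq]; exact bot_le
      · obtain ⟨t, rfl⟩ := h μ hμ
        rw [inf_comm]
        exact le_iSup (fun t => θ.eigenspace (c t) ⊓ U) t
    · rw [inf_comm]
      exact le_iSup (fun μ => U ⊓ θ.eigenspace μ) (c t)
  have h3 : (Finset.univ : Finset T).SupIndep fun t => θ.eigenspace (c t) ⊓ U :=
    iSupIndep.supIndep (((θ.eigenspaces_iSupIndep.comp hc).comp Subtype.val_injective).mono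
      fun _ => inf_le_left)
  conv_lhs => rw [h1, h2]
  exact finrank_finset_sup h3

end LinearAlgebra

/-! ### Embeddings of the coefficient field -/

variable (p : ℕ) [Fact p.Prime] (k : Type*) [Field k] [CharP k p]
  (K : Type*) [Field K] [Algebra (K₀ p k) K] (F : Type*) [Field F] [Algebra ℚ_[p] F]

/-- The canonical embedding of `ℚ_p` into the algebraic closure of `K`. -/
def padicToClosure : ℚ_[p] →+* AlgebraicClosure K :=
  (algebraMap K (AlgebraicClosure K)).comp ((algebraMap (K₀ p k) K).comp (padicToK₀ p k))

variable [FiniteDimensional ℚ_[p] F]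

/-- A primitive element of the extension `F` of `ℚ_p`. -/
def primitiveElement : F := (Field.powerBasisOfFiniteOfSeparable ℚ_[p] F).gen

variable {p k K F}

variable (p) in
omit [Field k] [CharP k p] in
theorem exists_eq_aeval_primitiveElement (a : F) :
    ∃ h : ℚ_[p][X], a = aeval (primitiveElement p F) h :=
  (Field.powerBasisOfFiniteOfSeparable ℚ_[p] F).exists_eq_aeval' a

variable (p F) in
/-- The minimal polynomial of the primitive element. -/
def primitivePoly : ℚ_[p][X] := minpoly ℚ_[p] (primitiveElement p F)

theorem irreducible_primitivePoly : Irreducible (primitivePoly p F) :=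
  minpoly.irreducible (Algebra.IsIntegral.isIntegral _)

theorem separable_primitivePoly : (primitivePoly p F).Separable :=
  irreducible_primitivePoly.separable

theorem natDegree_primitivePoly : (primitivePoly p F).natDegree = finrank ℚ_[p] F := by
  rw [(Field.powerBasisOfFiniteOfSeparable ℚ_[p] F).finrank, ← PowerBasis.natDegree_minpoly]
  rfl

theorem aeval_primitivePoly : aeval (primitiveElement p F) (primitivePoly p F) = 0 :=
  minpoly.aeval _ _

namespace FilteredIsocrystalWithCoeff

variable [PerfectRing k p]

omit [FiniteDimensional ℚ_[p] F] [PerfectRing k p] in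
theorem Embedding.map_aeval (τ : Embedding p k K F) (a : F) (h : ℚ_[p][X]) :
    τ.1 (aeval a h) = (h.map (padicToClosure p k K)).eval (τ.1 a) := by
  rw [Polynomial.eval_map, aeval_def, Polynomial.hom_eval₂]
  congr 1
  ext c
  exact τ.2 c

omit [PerfectRing k p] in
theorem Embedding.isRoot (τ : Embedding p k K F) :
    ((primitivePoly p F).map (padicToClosure p k K)).IsRoot (τ.1 (primitiveElement p F)) := by
  rw [IsRoot, ← τ.map_aeval, aeval_primitivePoly, map_zero]

omit [PerfectRing k p] in
theorem Embedding.injective_primitiveElement :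
    Function.Injective fun τ : Embedding p k K F => τ.1 (primitiveElement p F) := by
  intro τ τ' h
  apply Subtype.ext
  ext a
  obtain ⟨q, rfl⟩ := exists_eq_aeval_primitiveElement p a
  rw [τ.map_aeval, τ'.map_aeval]
  exact congrArg (fun μ => eval μ (q.map (padicToClosure p k K))) h

omit [PerfectRing k p] in
theorem Embedding.exists_of_isRoot {μ : AlgebraicClosure K}
    (hμ : ((primitivePoly p F).map (padicToClosure p k K)).IsRoot μ) :
    ∃ τ : Embedding p k K F, τ.1 (primitiveElement p F) = μ := by
  let : Algebra ℚ_[p] (AlgebraicClosure K) := (padicToClosure p k K).toAlgebra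
  have h : aeval μ (minpoly ℚ_[p] (Field.powerBasisOfFiniteOfSeparable ℚ_[p] F).gen) = 0 := by
    rw [aeval_def, ← Polynomial.eval_map]
    exact hμ
  let f := (Field.powerBasisOfFiniteOfSeparable ℚ_[p] F).lift μ h
  exact ⟨⟨f.toRingHom, fun a => f.commutes a⟩, PowerBasis.lift_gen _ μ h⟩

instance Embedding.finite : Finite (Embedding p k K F) := by
  have h0 : (primitivePoly p F).map (padicToClosure p k K) ≠ 0 :=
    (Polynomial.map_ne_zero_iff (RingHom.injective _)).mpr irreducible_primitivePoly.ne_zero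
  have : Finite {μ // ((primitivePoly p F).map (padicToClosure p k K)).IsRoot μ} :=
    (Polynomial.finite_setOfPred_isRoot h0).to_subtype
  exact Finite.of_injective (fun τ : Embedding p k K F =>
    (⟨_, τ.isRoot⟩ : {μ // ((primitivePoly p F).map (padicToClosure p k K)).IsRoot μ}))
    fun τ τ' h => Embedding.injective_primitiveElement (congrArg Subtype.val h)

instance Embedding.nonempty : Nonempty (Embedding p k K F) := by
  have h0 : ((primitivePoly p F).map (padicToClosure p k K)).degree ≠ 0 := by
    rw [Polynomial.degree_map]
    exact irreducible_primitivePoly.degree_pos.ne'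
  obtain ⟨μ, hμ⟩ := IsAlgClosed.exists_root _ h0
  exact ⟨(Embedding.exists_of_isRoot hμ).choose⟩

noncomputable instance Embedding.fintype : Fintype (Embedding p k K F) := Fintype.ofFinite _

/-! ### Eigenspaces of the coefficient field -/

variable {N : Type*} [AddCommGroup N] [Module (K₀ p k) N]

/-- The action of `a : F` on the scalar extension of `N` to the algebraic closure of `K`. -/
def ιBar (X : FilteredIsocrystalWithCoeff p k K F N) (a : F) :
    Module.End (AlgebraicClosure K) (AlgebraicClosure K ⊗[K] (K ⊗[K₀ p k] N)) :=
  ((X.ι a).baseChange K).baseChange (AlgebraicClosure K)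

theorem aeval_baseChange {L : Type*} [Field L] {M : Type*} [AddCommGroup M] [Module L M]
    (L' : Type*) [Field L'] [Algebra L L'] (f : Module.End L M) (h : L[X]) :
    aeval (f.baseChange L' : Module.End L' (L' ⊗[L] M)) (h.map (algebraMap L L')) =
      (aeval f h).baseChange L' := by
  rw [aeval_map_algebraMap]
  exact (aeval_algHom_apply (Module.End.baseChangeHom L L' M) f h)

omit [FiniteDimensional ℚ_[p] F] in
theorem aeval_ιBar (X : FilteredIsocrystalWithCoeff p k K F N) (a : F) (h : ℚ_[p][X]) :
    aeval (X.ιBar a) (h.map (padicToClosure p k K)) = X.ιBar (aeval a h) := by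
  rw [padicToClosure, ← Polynomial.map_map, ← Polynomial.map_map, ιBar, aeval_baseChange,
    aeval_baseChange, aeval_ι]
  rfl

omit [FiniteDimensional ℚ_[p] F] in
theorem mem_eigenspace_iff (X : FilteredIsocrystalWithCoeff p k K F N) (τ : Embedding p k K F)
    (v : AlgebraicClosure K ⊗[K] (K ⊗[K₀ p k] N)) :
    v ∈ X.eigenspace τ ↔ ∀ a, X.ιBar a v = τ.1 a • v := by
  rw [eigenspace, Submodule.mem_iInf]
  refine forall_congr' fun a => ?_
  rw [LinearMap.mem_ker, LinearMap.sub_apply, sub_eq_zero]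
  rfl

/-- `N_τ` is an eigenspace of the primitive element. -/
theorem eigenspace_eq (X : FilteredIsocrystalWithCoeff p k K F N) (τ : Embedding p k K F) :
    X.eigenspace τ = (X.ιBar (primitiveElement p F)).eigenspace (τ.1 (primitiveElement p F)) := by
  ext v
  rw [mem_eigenspace_iff, Module.End.mem_eigenspace_iff]
  refine ⟨fun h => h _, fun h a => ?_⟩
  obtain ⟨q, rfl⟩ := exists_eq_aeval_primitiveElement p a
  rw [← aeval_ιBar, Module.End.aeval_apply_of_mem_apply_eq_smul h, τ.map_aeval]

/-- The eigenvalues of the primitive element are its conjugates. -/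
theorem isRoot_of_eigenspace_ne_bot (X : FilteredIsocrystalWithCoeff p k K F N)
    {μ : AlgebraicClosure K} (h : (X.ιBar (primitiveElement p F)).eigenspace μ ≠ ⊥) :
    ((primitivePoly p F).map (padicToClosure p k K)).IsRoot μ := by
  obtain ⟨v, hv, hv0⟩ := Submodule.exists_mem_ne_zero_of_ne_bot h
  have h1 := Module.End.aeval_apply_of_mem_apply_eq_smul
    (p := (primitivePoly p F).map (padicToClosure p k K)) (Module.End.mem_eigenspace_iff.mp hv)
  have h2 : X.ιBar (0 : F) = 0 := by
    rw [ιBar, map_zero]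
    simp
  rw [aeval_ιBar, aeval_primitivePoly, h2, LinearMap.zero_apply] at h1
  exact (smul_eq_zero.mp h1.symm).resolve_right hv0

variable [FiniteDimensional (K₀ p k) N]

omit [FiniteDimensional (K₀ p k) N] in
theorem isSemisimple_ιBar (X : FilteredIsocrystalWithCoeff p k K F N) :
    (X.ιBar (primitiveElement p F)).IsSemisimple := by
  refine Module.End.isSemisimple_of_squarefree_aeval_eq_zero
    (p := (primitivePoly p F).map (padicToClosure p k K))
    (separable_primitivePoly.map (f := padicToClosure p k K)).squarefree ?_
  rw [aeval_ιBar, aeval_primitivePoly, ιBar, map_zero]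
  simp

theorem iSup_eigenspace_eq_top (X : FilteredIsocrystalWithCoeff p k K F N) :
    ⨆ μ, (X.ιBar (primitiveElement p F)).eigenspace μ = ⊤ := by
  rw [← Module.End.iSup_maxGenEigenspace_eq_top (X.ιBar (primitiveElement p F))]
  exact iSup_congr fun μ =>
    (X.isSemisimple_ιBar.isFinitelySemisimple.maxGenEigenspace_eq_eigenspace μ).symm

/-- All the spaces `N_τ` have the same dimension, because the characteristic polynomial of a
primitive element of `F` has coefficients in `ℚ_p`. -/
theorem finrank_eigenspace_mul (X : FilteredIsocrystalWithCoeff p k K F N)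
    (τ : Embedding p k K F) :
    finrank (AlgebraicClosure K) (X.eigenspace τ) * finrank ℚ_[p] F = finrank (K₀ p k) N := by
  obtain ⟨g, hg⟩ := X.exists_charpoly_eq_map (primitiveElement p F)
  have hg' : LinearMap.charpoly (X.ιBar (primitiveElement p F)) =
      g.map (padicToClosure p k K) := by
    rw [ιBar, LinearMap.charpoly_baseChange, LinearMap.charpoly_baseChange, ← hg,
      Polynomial.map_map, Polynomial.map_map]
    rfl
  have hg0 : g ≠ 0 := by
    rintro rfl
    rw [Polynomial.map_zero] at hg
    exact (LinearMap.charpoly_monic (X.ι (primitiveElement p F))).ne_zero hg.symm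
  have hroot : ∀ μ, (g.map (padicToClosure p k K)).IsRoot μ →
      ((primitivePoly p F).map (padicToClosure p k K)).IsRoot μ := by
    intro μ hμ
    rw [← hg'] at hμ
    exact X.isRoot_of_eigenspace_ne_bot
      (Module.End.hasEigenvalue_iff.mp ((Module.End.hasEigenvalue_iff_isRoot_charpoly _ μ).mpr hμ))
  have h1 := rootMultiplicity_mul_natDegree (padicToClosure p k K) irreducible_primitivePoly
    separable_primitivePoly hg0 hroot τ.isRoot
  have h2 : g.natDegree = finrank (K₀ p k) N := by
    rw [← Polynomial.natDegree_map (padicToK₀ p k), hg, LinearMap.charpoly_natDegree]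
  rw [← h2, ← h1, natDegree_primitivePoly, ← hg', ← LinearMap.finrank_maxGenEigenspace_eq,
    X.isSemisimple_ιBar.isFinitelySemisimple.maxGenEigenspace_eq_eigenspace, eigenspace_eq]

theorem finrank_eigenspace (X : FilteredIsocrystalWithCoeff p k K F N) (τ : Embedding p k K F) :
    finrank (AlgebraicClosure K) (X.eigenspace τ) =
      finrank (K₀ p k) N / finrank ℚ_[p] F :=
  (Nat.div_eq_of_eq_mul_left Module.finrank_pos (X.finrank_eigenspace_mul τ).symm).symm

theorem finrank_dvd (X : FilteredIsocrystalWithCoeff p k K F N) :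
    finrank ℚ_[p] F ∣ finrank (K₀ p k) N :=
  Dvd.intro_left _ (X.finrank_eigenspace_mul (Classical.arbitrary (Embedding p k K F)))

omit [FiniteDimensional ℚ_[p] F] [FiniteDimensional (K₀ p k) N] in
theorem ιBar_mem_fil (X : FilteredIsocrystalWithCoeff p k K F N) (a : F) (i : ℤ)
    {v : AlgebraicClosure K ⊗[K] (K ⊗[K₀ p k] N)}
    (hv : v ∈ (X.fil.baseChange (AlgebraicClosure K)).Fil i) :
    X.ιBar a v ∈ (X.fil.baseChange (AlgebraicClosure K)).Fil i := by
  obtain ⟨w, rfl⟩ := hv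
  let f : X.fil.Fil i →ₗ[K] X.fil.Fil i :=
    ((X.ι a).baseChange K).restrict fun v hv => X.ι_fil a i v hv
  refine ⟨f.baseChange (AlgebraicClosure K) w, ?_⟩
  rw [ιBar, ← LinearMap.comp_apply, ← LinearMap.comp_apply, ← LinearMap.baseChange_comp,
    ← LinearMap.baseChange_comp]
  rfl

/-- The steps of the Hodge filtration are stable under `F`, so after scalar extension they are the
direct sums of their intersections with the `N_τ`. -/
theorem finrank_fil_eq_sum (X : FilteredIsocrystalWithCoeff p k K F N) (i : ℤ) :
    finrank K (X.fil.Fil i) = ∑ τ, finrank (AlgebraicClosure K) ((X.eigenFil τ).Fil i) := by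
  have h1 := finrank_eq_sum_inf_eigenspace (Embedding.injective_primitiveElement (p := p) (k := k)
    (K := K) (F := F)) X.iSup_eigenspace_eq_top (fun μ hμ => Embedding.exists_of_isRoot
      (X.isRoot_of_eigenspace_ne_bot hμ))
      (U := (X.fil.baseChange (AlgebraicClosure K)).Fil i) (fun v hv => X.ιBar_mem_fil _ i hv)
  have h2 : finrank (AlgebraicClosure K) ((X.fil.baseChange (AlgebraicClosure K)).Fil i) =
      finrank K (X.fil.Fil i) :=
    finrank_baseChange_submodule (AlgebraicClosure K) (X.fil.Fil i)
  rw [← h2, h1]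
  refine Finset.sum_congr rfl fun τ _ => ?_
  rw [eigenFil, VecFiltration.comap, VecFiltration.finrank_comap (Submodule.injective_subtype _),
    Submodule.range_subtype, eigenspace_eq]

/-- The Hodge number is the sum over all embeddings of the degrees of the filtrations of the
`N_τ`. -/
theorem tH_eq_sum (X : FilteredIsocrystalWithCoeff p k K F N) :
    X.tH = ∑ τ, (X.eigenFil τ).degree :=
  VecFiltration.degree_eq_sum X.finrank_fil_eq_sum

end FilteredIsocrystalWithCoeff

end HodgeNewton

namespace HodgeNewton

namespace FilteredIsocrystalWithCoeff

open Module FilteredIsocrystal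

variable {p : ℕ} [Fact p.Prime] {k : Type*} [Field k] [CharP k p] [PerfectRing k p]
  {K : Type*} [Field K] [Algebra (K₀ p k) K]
  {F : Type*} [Field F] [Algebra ℚ_[p] F] [FiniteDimensional ℚ_[p] F]
  {N : Type*} [AddCommGroup N] [Module (K₀ p k) N] [FiniteDimensional (K₀ p k) N]

/-! ### Exactness of the Hodge filtrations of the `N_τ` -/

variable (X : FilteredIsocrystalWithCoeff p k K F N) {A : Submodule (K₀ p k) N}
  (hA : X.IsStable A)

omit [FiniteDimensional ℚ_[p] F] [FiniteDimensional (K₀ p k) N] in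
theorem finrank_eigenFil (τ : Embedding p k K F) (i : ℤ) :
    finrank (AlgebraicClosure K) ((X.eigenFil τ).Fil i) = finrank (AlgebraicClosure K)
      (X.eigenspace τ ⊓ (X.fil.baseChange (AlgebraicClosure K)).Fil i :
        Submodule (AlgebraicClosure K) _) := by
  rw [eigenFil, VecFiltration.comap, VecFiltration.finrank_comap (Submodule.injective_subtype _),
    Submodule.range_subtype]

omit [FiniteDimensional ℚ_[p] F] in
/-- The inequality follows from `Fil^i N_τ → Fil^i (N / A)_τ`, whose kernel is `Fil^i A_τ`; the
surjectivity of this map is not needed here. -/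
theorem finrank_eigenFil_le (τ : Embedding p k K F) (i : ℤ) :
    finrank (AlgebraicClosure K) ((X.eigenFil τ).Fil i) ≤
      finrank (AlgebraicClosure K) (((X.sub A hA).eigenFil τ).Fil i) +
        finrank (AlgebraicClosure K) (((X.quot A hA).eigenFil τ).Fil i) := by
  let Ω := AlgebraicClosure K
  let f := (A.subtype.baseChange K).baseChange Ω
  let q := (A.mkQ.baseChange K).baseChange Ω
  have hfK : Function.Injective (A.subtype.baseChange K) := baseChange_subtype_injective K A
  have hf : Function.Injective f := Module.Flat.lTensor_preserves_injective_linearMap _ hfK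
  have hfq : LinearMap.range f = LinearMap.ker q :=
    range_baseChange_eq_ker Ω (baseChange_mkQ_surjective K A)
      (range_baseChange_eq_ker K A.mkQ_surjective (by rw [Submodule.range_subtype,
        Submodule.ker_mkQ]))
  have hfι : ∀ a w, f ((X.sub A hA).ιBar a w) = X.ιBar a (f w) := fun a =>
    baseChange_apply_comm Ω (baseChange_apply_comm K fun _ => rfl)
  have hqι : ∀ a w, q (X.ιBar a w) = (X.quot A hA).ιBar a (q w) := fun a =>
    baseChange_apply_comm Ω (baseChange_apply_comm K fun _ => rfl)
  set T := X.eigenspace τ ⊓ (X.fil.baseChange Ω).Fil i with hT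
  have h2 : T.map q ≤ (X.quot A hA).eigenspace τ ⊓ ((X.quot A hA).fil.baseChange Ω).Fil i := by
    rintro _ ⟨v, ⟨hv1, hv2⟩, rfl⟩
    refine ⟨?_, map_baseChange_le Ω _ _ ⟨v, hv2, rfl⟩⟩
    rw [SetLike.mem_coe, mem_eigenspace_iff] at hv1 ⊢
    intro a
    rw [← hqι, hv1, map_smul]
  have h3 : T ⊓ LinearMap.ker q ≤
      ((X.sub A hA).eigenspace τ ⊓ ((X.sub A hA).fil.baseChange Ω).Fil i).map f := by
    rintro v ⟨⟨hv1, hv2⟩, hv3⟩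
    have h4 : v ∈ (X.fil.Fil i ⊓ LinearMap.range (A.subtype.baseChange K)).baseChange Ω := by
      rw [baseChange_inf]
      refine ⟨hv2, ?_⟩
      rw [← hfq] at hv3
      obtain ⟨w, rfl⟩ := hv3
      rw [LinearMap.range_eq_map]
      refine map_baseChange_le Ω _ _ ⟨w, ?_, rfl⟩
      rw [Submodule.baseChange_top]
      trivial
    rw [inf_comm, ← Submodule.map_comap_eq] at h4
    obtain ⟨w, hw, rfl⟩ := baseChange_map_le Ω _ _ h4
    refine ⟨w, ⟨?_, hw⟩, rfl⟩
    rw [SetLike.mem_coe, mem_eigenspace_iff] at hv1 ⊢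
    intro a
    apply hf
    rw [hfι, map_smul]
    exact hv1 a
  rw [finrank_eigenFil, finrank_eigenFil, finrank_eigenFil, ← hT]
  exact finrank_le_of_map_le h2 h3

/-- The spaces `N_τ` with their filtrations depend exactly on `N`. By a sum over all `τ` it
suffices to bound the dimensions of the steps in one direction. -/
theorem finrank_eigenFil_eq (τ : Embedding p k K F) (i : ℤ) :
    finrank (AlgebraicClosure K) ((X.eigenFil τ).Fil i) =
      finrank (AlgebraicClosure K) (((X.sub A hA).eigenFil τ).Fil i) +
        finrank (AlgebraicClosure K) (((X.quot A hA).eigenFil τ).Fil i) := by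
  have hex := isStrictExact_quot X.toFilteredIsocrystal A hA.stable
  have h1 := VecFiltration.finrank_fil_of_exact (baseChange_subtype_injective K A)
    (range_baseChange_eq_ker K hex.surjective hex.range_eq_ker) hex.left_fil hex.right_fil i
  have h2 := X.finrank_fil_eq_sum i
  have h3 := (X.sub A hA).finrank_fil_eq_sum i
  have h4 := (X.quot A hA).finrank_fil_eq_sum i
  have h5 : ∑ τ, finrank (AlgebraicClosure K) ((X.eigenFil τ).Fil i) =
      ∑ τ, (finrank (AlgebraicClosure K) (((X.sub A hA).eigenFil τ).Fil i) +
        finrank (AlgebraicClosure K) (((X.quot A hA).eigenFil τ).Fil i)) := by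
    rw [Finset.sum_add_distrib, ← h2, ← h3, ← h4]
    exact h1
  exact (Finset.sum_eq_sum_iff_of_le fun τ _ => X.finrank_eigenFil_le hA τ i).mp h5 τ
    (Finset.mem_univ τ)

theorem typeMultiset_eigenFil (τ : Embedding p k K F) :
    (X.eigenFil τ).typeMultiset =
      ((X.sub A hA).eigenFil τ).typeMultiset + ((X.quot A hA).eigenFil τ).typeMultiset :=
  VecFiltration.typeMultiset_add (X.finrank_eigenFil_eq hA τ)

/-! ### The Hodge polygon of an extension -/

theorem length_type_eigenFil (τ : Embedding p k K F) :
    (X.eigenFil τ).type.length = finrank (K₀ p k) N / finrank ℚ_[p] F := by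
  rw [VecFiltration.length_type, finrank_eigenspace]

omit [FiniteDimensional ℚ_[p] F] [FiniteDimensional (K₀ p k) N] in
theorem length_hodge : X.hodge.length = finrank (K₀ p k) N / finrank ℚ_[p] F := by
  rw [hodge, List.length_ofFn]

omit [FiniteDimensional (K₀ p k) N] in
theorem hodge_getElem (i : ℕ) (hi : i < X.hodge.length) :
    finrank ℚ_[p] F * X.hodge[i] = ∑ τ, (X.eigenFil τ).type.getD i 0 := by
  have hd : (finrank ℚ_[p] F : ℚ) ≠ 0 := Nat.cast_ne_zero.mpr Module.finrank_pos.ne'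
  have h : X.hodge[i] = (1 / (finrank ℚ_[p] F : ℚ)) *
      ∑ᶠ τ : Embedding p k K F, (X.eigenFil τ).type.getD i 0 := List.getElem_ofFn hi
  rw [h, finsum_eq_sum_of_fintype, ← mul_assoc, mul_one_div_cancel hd, one_mul]

theorem sum_take_hodge (q : ℕ) (hq : q ≤ X.hodge.length) :
    finrank ℚ_[p] F * (X.hodge.take q).sum = ∑ τ, ((X.eigenFil τ).type.take q).sum := by
  induction q with
  | zero => simp
  | succ q ih =>
    rw [List.sum_take_succ _ _ hq, mul_add, ih (by omega), hodge_getElem, ← Finset.sum_add_distrib]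
    refine Finset.sum_congr rfl fun τ _ => ?_
    have h : q < (X.eigenFil τ).type.length := by
      rw [length_type_eigenFil, ← X.length_hodge]
      exact hq
    rw [List.sum_take_succ _ _ h, List.getD_eq_getElem _ _ h]

theorem tH_eq_neg_sum : (X.tH : ℚ) = -∑ τ, (X.eigenFil τ).type.sum := by
  rw [tH_eq_sum, ← Finset.sum_neg_distrib, Int.cast_sum]
  refine Finset.sum_congr rfl fun τ _ => ?_
  rw [VecFiltration.type_eq_sort, ← Multiset.sum_coe, Multiset.sort_eq,
    VecFiltration.sum_typeMultiset, neg_neg]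

/-- The slopes of `A_τ` are among the ones of `N_τ`, so that their sum is at most the sum of as many
largest slopes of `N_τ`. -/
theorem sum_type_eigenFil_sub_le (τ : Embedding p k K F) :
    ((X.sub A hA).eigenFil τ).type.sum ≤
      ((X.eigenFil τ).type.take (finrank (K₀ p k) A / finrank ℚ_[p] F)).sum := by
  have h := sum_sort_le_sum_take ((X.sub A hA).eigenFil τ).typeMultiset
    ((X.quot A hA).eigenFil τ).typeMultiset
  rw [← X.typeMultiset_eigenFil hA τ, VecFiltration.card_typeMultiset, finrank_eigenspace,
    ← VecFiltration.type_eq_sort] at h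
  rwa [VecFiltration.type_eq_sort, ← Multiset.sum_coe, Multiset.sort_eq]

/-- The Hodge polygon of a subobject lies below the one of the whole object: `-t_H(A)/d` is at most
the value of the Hodge polygon at `dim A / d`. -/
theorem neg_tH_sub_le : -((X.sub A hA).tH : ℚ) ≤
    finrank ℚ_[p] F * (X.hodge.take (finrank (K₀ p k) A / finrank ℚ_[p] F)).sum := by
  rw [sum_take_hodge, tH_eq_neg_sum, neg_neg]
  · exact Finset.sum_le_sum fun τ _ => X.sum_type_eigenFil_sub_le hA τ
  · rw [length_hodge]
    exact Nat.div_le_div_right (Submodule.finrank_le A)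

/-- If the Hodge polygon of `A` ends on the Hodge polygon of `N`, then the latter is the
concatenation of the Hodge polygons of `A` and `N / A`. -/
theorem hodge_eq_append (h : finrank ℚ_[p] F *
      (X.hodge.take (finrank (K₀ p k) A / finrank ℚ_[p] F)).sum ≤ -((X.sub A hA).tH : ℚ)) :
    X.hodge = (X.sub A hA).hodge ++ (X.quot A hA).hodge := by
  have hd : (finrank ℚ_[p] F : ℚ) ≠ 0 := Nat.cast_ne_zero.mpr Module.finrank_pos.ne'
  have hq : finrank (K₀ p k) A / finrank ℚ_[p] F ≤ X.hodge.length := by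
    rw [length_hodge]
    exact Nat.div_le_div_right (Submodule.finrank_le A)
  have hle := X.sum_type_eigenFil_sub_le hA
  rw [sum_take_hodge _ _ hq, tH_eq_neg_sum, neg_neg] at h
  have heq := (Finset.sum_eq_sum_iff_of_le fun τ _ => hle τ).mp
    (le_antisymm (Finset.sum_le_sum fun τ _ => hle τ) h)
  have htype : ∀ τ, (X.eigenFil τ).type =
      ((X.sub A hA).eigenFil τ).type ++ ((X.quot A hA).eigenFil τ).type := by
    intro τ
    rw [VecFiltration.type_eq_sort, VecFiltration.type_eq_sort, VecFiltration.type_eq_sort,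
      X.typeMultiset_eigenFil hA τ]
    apply sort_eq_append_of_sum_eq
    rw [← X.typeMultiset_eigenFil hA τ, VecFiltration.card_typeMultiset, finrank_eigenspace,
      ← VecFiltration.type_eq_sort, ← heq τ (Finset.mem_univ τ), VecFiltration.type_eq_sort,
      ← Multiset.sum_coe, Multiset.sort_eq]
  have hlen : X.hodge.length = (X.sub A hA).hodge.length + (X.quot A hA).hodge.length := by
    rw [length_hodge, length_hodge, length_hodge, ← A.finrank_quotient_add_finrank, add_comm,
      Nat.add_div_of_dvd_right (X.sub A hA).finrank_dvd]
  refine List.ext_getElem (by rw [List.length_append, hlen]) fun i h1 h2 => ?_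
  apply mul_left_cancel₀ hd
  rw [hodge_getElem, List.getElem_append]
  split_ifs with hi
  · rw [hodge_getElem]
    refine Finset.sum_congr rfl fun τ _ => ?_
    rw [htype τ, List.getD_append]
    rwa [length_type_eigenFil, ← (X.sub A hA).length_hodge]
  · rw [hodge_getElem]
    refine Finset.sum_congr rfl fun τ _ => ?_
    rw [htype τ, List.getD_append_right, length_type_eigenFil, length_hodge]
    · rw [length_type_eigenFil, ← (X.sub A hA).length_hodge]
      exact not_lt.mp hi

end FilteredIsocrystalWithCoeff

end HodgeNewton

namespace HodgeNewton

namespace FilteredIsocrystal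

open Module

variable {p : ℕ} [Fact p.Prime] {k : Type*} [Field k] [CharP k p] [PerfectRing k p]
  {K : Type*} [Field K] [Algebra (K₀ p k) K]
  {N : Type*} [AddCommGroup N] [Module (K₀ p k) N] [FiniteDimensional (K₀ p k) N]

/-! ### Weakly admissible subquotients -/

open Classical in
/-- The Newton number of the subobject with underlying space `A`, as a function of the subspace
alone (with value `0` if `A` is not stable). -/
def tNOn (X : FilteredIsocrystal p k K N) (A : Submodule (K₀ p k) N) : ℤ :=
  if hA : X.IsStable A then (X.sub A hA).tN else 0

theorem tNOn_eq {X : FilteredIsocrystal p k K N} {A : Submodule (K₀ p k) N} (hA : X.IsStable A) :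
    X.tNOn A = (X.sub A hA).tN :=
  dif_pos hA

/-- `A` underlies a subobject whose Hodge and Newton numbers agree. For weakly admissible `X`
these are exactly the weakly admissible subobjects. -/
structure IsAdmissible (X : FilteredIsocrystal p k K N) (A : Submodule (K₀ p k) N) : Prop where
  stable : X.IsStable A
  tH_eq : (X.sub A stable).tH = (X.sub A stable).tN

variable {X : FilteredIsocrystal p k K N} {A B C E : Submodule (K₀ p k) N}

theorem tNOn_sup_add_inf (hA : X.IsStable A) (hB : X.IsStable B) :
    X.tNOn (A ⊔ B) + X.tNOn (A ⊓ B) = X.tNOn A + X.tNOn B := by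
  rw [tNOn_eq (hA.sup hB), tNOn_eq (hA.inf hB), tNOn_eq hA, tNOn_eq hB, tN_sup_add_tN_inf]

theorem tNOn_bot : X.tNOn ⊥ = 0 := by rw [tNOn_eq X.isStable_bot, tN_sub_bot]

theorem tNOn_top : X.tNOn ⊤ = X.tN := by rw [tNOn_eq X.isStable_top, tN_sub_top]

theorem isAdmissible_bot : X.IsAdmissible ⊥ where
  stable := X.isStable_bot
  tH_eq := by rw [tN_sub_bot, tH_sub_bot]

namespace IsWeaklyAdmissible

variable (hX : X.IsWeaklyAdmissible)

include hX

theorem isAdmissible_top : X.IsAdmissible ⊤ where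
  stable := X.isStable_top
  tH_eq := by rw [tN_sub_top, tH_sub_top, hX.2]

theorem sub (hA : X.IsAdmissible A) : (X.sub A hA.stable).IsWeaklyAdmissible := by
  refine ⟨fun D hD => ?_, hA.tH_eq⟩
  rw [tH_sub_sub, tN_sub_sub]
  exact hX.1 _ _

/-- The intersection and the sum of weakly admissible subobjects are weakly admissible, since the
Newton numbers are modular and the Hodge numbers are supermodular. -/
theorem inf_sup (hA : X.IsAdmissible A) (hB : X.IsAdmissible B) :
    X.IsAdmissible (A ⊓ B) ∧ X.IsAdmissible (A ⊔ B) := by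
  have h1 := tN_sup_add_tN_inf hA.stable hB.stable
  have h2 := tH_add_tH_le hA.stable hB.stable
  have h3 := hX.1 _ (hA.stable.inf hB.stable)
  have h4 := hX.1 _ (hA.stable.sup hB.stable)
  have h5 := hA.tH_eq
  have h6 := hB.tH_eq
  exact ⟨⟨hA.stable.inf hB.stable, by linarith⟩, ⟨hA.stable.sup hB.stable, by linarith⟩⟩

theorem quot (hA : X.IsAdmissible A) : (X.quot A hA.stable).IsWeaklyAdmissible := by
  constructor
  · intro D hD
    have hE : X.IsStable (D.comap A.mkQ) :=
      hD.comap (X := X) (Z := X.quot A hA.stable) (f := A.mkQ) fun _ => rfl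
    have hAE : A ≤ D.comap A.mkQ := A.le_comap_mkQ D
    have hex := isStrictExact_quot_sub hE hA.stable hAE
    have hD' : (D.comap A.mkQ).map A.mkQ = D :=
      Submodule.map_comap_eq_of_surjective A.mkQ_surjective D
    have h1 := hex.tN_eq
    have h2 := hex.tH_eq
    rw [tN_sub_congr hD' _ hD] at h1
    rw [tH_sub_congr hD' _ hD] at h2
    have h3 := hX.1 _ hE
    have h4 := hA.tH_eq
    linarith
  · have hex := isStrictExact_quot X A hA.stable
    have h1 := hex.tN_eq
    have h2 := hex.tH_eq
    have h3 := hX.2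
    have h4 := hA.tH_eq
    linarith

end IsWeaklyAdmissible

theorem tNOn_sub_submoduleOf (hB : X.IsStable B) (hC : X.IsStable C) (hBC : B ≤ C) :
    (X.sub C hC).tNOn (B.submoduleOf C) = X.tNOn B := by
  rw [tNOn_eq (X.isStable_submoduleOf hB hC), tN_sub_sub, tNOn_eq hB]
  refine tN_sub_congr ?_ _ _
  rw [Submodule.submoduleOf, Submodule.map_comap_subtype, inf_eq_right.mpr hBC]

theorem isAdmissible_sub_iff {D : Submodule (K₀ p k) C} (hC : X.IsStable C) :
    (X.sub C hC).IsAdmissible D ↔ X.IsAdmissible (D.map C.subtype) := by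
  constructor
  · rintro ⟨h1, h2⟩
    rw [tN_sub_sub, tH_sub_sub] at h2
    exact ⟨_, h2⟩
  · rintro ⟨h1, h2⟩
    have h3 : (X.sub C hC).IsStable D := by
      rw [← Submodule.comap_map_eq_of_injective C.injective_subtype D]
      exact h1.comap (X := X.sub C hC) (Z := X) (f := C.subtype) fun _ => rfl
    refine ⟨h3, ?_⟩
    rw [tN_sub_sub, tH_sub_sub]
    exact h2

/-- The slope of the subquotient `C / B`. -/
def slope (X : FilteredIsocrystal p k K N) (B C : Submodule (K₀ p k) N) : ℚ :=
  -((X.tNOn C : ℚ) - X.tNOn B) / ((finrank (K₀ p k) C : ℚ) - finrank (K₀ p k) B)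

theorem mu_quot (hB : X.IsStable B) : (X.quot B hB).mu = X.slope B ⊤ := by
  have h1 := (isStrictExact_quot X B hB).tN_eq
  have h2 := (isStrictExact_quot X B hB).finrank_eq
  rw [mu, slope, tNOn_top, tNOn_eq hB, finrank_top, h1, h2]
  push_cast
  congr 1 <;> ring

omit [CharP k p] [PerfectRing k p] [FiniteDimensional (K₀ p k) N] in
theorem finrank_submoduleOf (hBC : B ≤ C) :
    finrank (K₀ p k) (B.submoduleOf C) = finrank (K₀ p k) B :=
  (Submodule.submoduleOfEquivOfLe hBC).finrank_eq

theorem mu_subquot (hB : X.IsStable B) (hC : X.IsStable C) (hBC : B ≤ C) :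
    (X.subquot B C hB hC).mu = X.slope B C := by
  rw [subquot, mu_quot, slope, slope, tNOn_sub_submoduleOf hB hC hBC, tNOn_top, tNOn_eq hC,
    finrank_top, finrank_submoduleOf hBC]

theorem slope_sub_submoduleOf (hB : X.IsStable B) (hC : X.IsStable C) (hE : X.IsStable E)
    (hBC : B ≤ C) (hEC : E ≤ C) :
    (X.sub C hC).slope (B.submoduleOf C) (E.submoduleOf C) = X.slope B E := by
  rw [slope, slope, tNOn_sub_submoduleOf hB hC hBC, tNOn_sub_submoduleOf hE hC hEC,
    finrank_submoduleOf hBC, finrank_submoduleOf hEC]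

theorem mu_quot_sub (hB : X.IsStable B) (hE : X.IsStable E) (hBE : B ≤ E)
    {D : Submodule (K₀ p k) (N ⧸ B)} (hD : (X.quot B hB).IsStable D) (h : E.map B.mkQ = D) :
    ((X.quot B hB).sub D hD).mu = X.slope B E := by
  subst h
  have hex := isStrictExact_quot_sub hE hB hBE
  have h1 := hex.tN_eq
  have h2 := hex.finrank_eq
  rw [mu, slope, tNOn_eq hB, tNOn_eq hE, h1, h2]
  push_cast
  congr 1 <;> ring

/-- Semi-stability of a quotient in terms of the subobjects of the whole object. -/
theorem isSemistable_quot_iff (hX : X.IsWeaklyAdmissible) (hB : X.IsAdmissible B) (hBN : B ≠ ⊤) :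
    (X.quot B hB.stable).IsSemistable ↔
      ∀ E, X.IsAdmissible E → B < E → X.slope B E ≤ X.slope B ⊤ := by
  constructor
  · rintro ⟨-, -, h⟩ E hE hBE
    have hex := isStrictExact_quot_sub hE.stable hB.stable hBE.le
    rw [← mu_quot hB.stable, ← mu_quot_sub hB.stable hE.stable hBE.le
      (isStable_map_mkQ hE.stable hB.stable) rfl]
    refine h _ _ ?_ ((hX.quot hB).sub ⟨isStable_map_mkQ hE.stable hB.stable, ?_⟩)
    · rw [ne_eq, ← le_bot_iff, Submodule.map_le_iff_le_comap, Submodule.comap_bot,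
        Submodule.ker_mkQ]
      exact hBE.not_ge
    · have h1 := hex.tN_eq
      have h2 := hex.tH_eq
      have h3 := hB.tH_eq
      have h4 := hE.tH_eq
      linarith
  · intro h
    refine ⟨Submodule.Quotient.nontrivial_iff.mpr hBN, hX.quot hB, fun D hD hD0 hDa => ?_⟩
    have hE : X.IsStable (D.comap B.mkQ) :=
      hD.comap (X := X) (Z := X.quot B hB.stable) (f := B.mkQ) fun _ => rfl
    have hBE : B ≤ D.comap B.mkQ := B.le_comap_mkQ D
    have hex := isStrictExact_quot_sub hE hB.stable hBE
    have hD' : (D.comap B.mkQ).map B.mkQ = D :=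
      Submodule.map_comap_eq_of_surjective B.mkQ_surjective D
    rw [mu_quot, mu_quot_sub hB.stable hE hBE hD hD']
    refine h _ ⟨hE, ?_⟩ (lt_of_le_of_ne hBE ?_)
    · have h1 := hex.tN_eq
      have h2 := hex.tH_eq
      rw [tN_sub_congr hD' _ hD] at h1
      rw [tH_sub_congr hD' _ hD] at h2
      have h3 := hB.tH_eq
      have h4 := hDa.2
      linarith
    · intro h0
      apply hD0
      rw [← hD', ← h0, Submodule.mkQ_map_self]

/-- Semi-stability of a subquotient in terms of the subobjects of the whole object. -/
theorem isSemistable_subquot_iff (hX : X.IsWeaklyAdmissible) (hB : X.IsAdmissible B)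
    (hC : X.IsAdmissible C) (hBC : B < C) :
    (X.subquot B C hB.stable hC.stable).IsSemistable ↔
      ∀ E, X.IsAdmissible E → B < E → E ≤ C → X.slope B E ≤ X.slope B C := by
  have hB' : (X.sub C hC.stable).IsAdmissible (B.submoduleOf C) := by
    rw [isAdmissible_sub_iff, Submodule.submoduleOf, Submodule.map_comap_subtype,
      inf_eq_right.mpr hBC.le]
    exact hB
  have hmapB : (B.submoduleOf C).map C.subtype = B := by
    rw [Submodule.submoduleOf, Submodule.map_comap_subtype, inf_eq_right.mpr hBC.le]
  have htop : (C.submoduleOf C) = ⊤ := Submodule.submoduleOf_self C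
  rw [subquot, isSemistable_quot_iff (hX.sub hC) hB' (by
    rw [ne_eq, Submodule.submoduleOf, Submodule.comap_subtype_eq_top]
    exact hBC.not_ge), ← htop,
    slope_sub_submoduleOf hB.stable hC.stable hC.stable hBC.le le_rfl]
  constructor
  · intro h E hE hBE hEC
    have hmapE : (E.submoduleOf C).map C.subtype = E := by
      rw [Submodule.submoduleOf, Submodule.map_comap_subtype, inf_eq_right.mpr hEC]
    rw [← slope_sub_submoduleOf hB.stable hC.stable hE.stable hBC.le hEC]
    refine h _ ((isAdmissible_sub_iff _).mpr (hmapE.symm ▸ hE)) ?_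
    rw [← Submodule.map_lt_map_iff_of_injective C.injective_subtype, hmapB, hmapE]
    exact hBE
  · intro h E hE hBE
    have hE' := (isAdmissible_sub_iff _).mp hE
    have hEC : E.map C.subtype ≤ C := Submodule.map_subtype_le C E
    have h1 : (E.map C.subtype).submoduleOf C = E :=
      Submodule.comap_map_eq_of_injective C.injective_subtype E
    rw [← h1, slope_sub_submoduleOf hB.stable hC.stable hE'.stable hBC.le hEC]
    refine h _ hE' ?_ hEC
    rwa [← hmapB, Submodule.map_lt_map_iff_of_injective C.injective_subtype]

end FilteredIsocrystal

end HodgeNewton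

namespace HodgeNewton

namespace FilteredIsocrystal

open Module

variable {p : ℕ} [Fact p.Prime] {k : Type*} [Field k] [CharP k p] [PerfectRing k p]
  {K : Type*} [Field K] [Algebra (K₀ p k) K]
  {N : Type*} [AddCommGroup N] [Module (K₀ p k) N] [FiniteDimensional (K₀ p k) N]
  {X : FilteredIsocrystal p k K N} {A B C E : Submodule (K₀ p k) N}

/-! ### Existence of the Harder-Narasimhan filtration -/

theorem slope_mul (h : B < C) : X.slope B C * ((finrank (K₀ p k) C : ℚ) - finrank (K₀ p k) B) =
    -((X.tNOn C : ℚ) - X.tNOn B) := by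
  have h1 : (finrank (K₀ p k) B : ℚ) < finrank (K₀ p k) C :=
    Nat.cast_lt.mpr (Submodule.finrank_lt_finrank_of_lt h)
  exact div_mul_cancel₀ _ (sub_ne_zero.mpr h1.ne')

/-- Among all `E ⊋ B`, there is one of maximal slope, and of maximal dimension among those. -/
theorem exists_max_slope {b : ℚ} (hb : ∀ E, X.IsAdmissible E → b ≤ X.tNOn E)
    (hX : X.IsWeaklyAdmissible) (hB : B ≠ ⊤) :
    ∃ C, X.IsAdmissible C ∧ B < C ∧ ∀ E, X.IsAdmissible E → B < E →
      X.slope B E < X.slope B C ∨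
        (X.slope B E = X.slope B C ∧ finrank (K₀ p k) E ≤ finrank (K₀ p k) C) := by
  set n := finrank (K₀ p k) N
  -- Slopes lie in `ℤ / n!`, so that a weighted sum of slope and dimension is integral.
  let e : Submodule (K₀ p k) N → ℕ := fun E => finrank (K₀ p k) E - finrank (K₀ p k) B
  let s : Submodule (K₀ p k) N → ℤ := fun E =>
    -(X.tNOn E - X.tNOn B) * ((n.factorial / e E : ℕ) : ℤ)
  let f : Submodule (K₀ p k) N → ℤ := fun E => (n + 1) * s E + finrank (K₀ p k) E
  have hle : ∀ E : Submodule (K₀ p k) N, finrank (K₀ p k) E ≤ n := fun E => E.finrank_le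
  have hs : ∀ E, B < E → (s E : ℚ) = n.factorial * X.slope B E := by
    intro E hE
    have h1 := Submodule.finrank_lt_finrank_of_lt hE
    have h2 : e E ∣ n.factorial :=
      Nat.dvd_factorial (Nat.sub_pos_of_lt h1) ((Nat.sub_le _ _).trans (hle E))
    have h3 : (e E : ℚ) ≠ 0 := Nat.cast_ne_zero.mpr (Nat.sub_pos_of_lt h1).ne'
    have h4 : (e E : ℚ) = (finrank (K₀ p k) E : ℚ) - finrank (K₀ p k) B := Nat.cast_sub h1.le
    have h5 : ((n.factorial / e E : ℕ) : ℚ) = n.factorial / e E := Nat.cast_div h2 h3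
    simp only [s, slope]
    rw [← h4, Int.cast_mul, Int.cast_natCast, h5]
    push_cast
    ring
  have hbdd : ∀ z, (∃ E, (X.IsAdmissible E ∧ B < E) ∧ f E = z) →
      z ≤ (n + 1) * (|⌈(X.tNOn B : ℚ) - b⌉| * n.factorial) + n := by
    rintro _ ⟨E, ⟨hE, -⟩, rfl⟩
    have h1 : -(X.tNOn E - X.tNOn B) ≤ |⌈(X.tNOn B : ℚ) - b⌉| := by
      refine le_trans ?_ (le_abs_self _)
      rw [Int.le_ceil_iff]
      have := hb E hE
      push_cast
      linarith
    have h2 : s E ≤ |⌈(X.tNOn B : ℚ) - b⌉| * n.factorial :=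
      mul_le_mul h1 (by exact_mod_cast Nat.div_le_self _ _) (by positivity) (abs_nonneg _)
    have h3 : (finrank (K₀ p k) E : ℤ) ≤ n := by exact_mod_cast hle E
    exact add_le_add (mul_le_mul_of_nonneg_left h2 (by positivity)) h3
  obtain ⟨_, ⟨C, ⟨hC, hBC⟩, rfl⟩, hmax⟩ := Int.exists_greatest_of_bdd ⟨_, hbdd⟩
    ⟨_, ⊤, ⟨hX.isAdmissible_top, lt_top_iff_ne_top.mpr hB⟩, rfl⟩
  refine ⟨C, hC, hBC, fun E hE hBE => ?_⟩
  have hfE : f E ≤ f C := hmax _ ⟨E, ⟨hE, hBE⟩, rfl⟩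
  have hfac : (0 : ℚ) < n.factorial := Nat.cast_pos.mpr n.factorial_pos
  simp only [f] at hfE
  rcases lt_trichotomy (s E) (s C) with h | h | h
  · left
    have : (s E : ℚ) < s C := by exact_mod_cast h
    rw [hs E hBE, hs C hBC] at this
    exact lt_of_mul_lt_mul_left this hfac.le
  · right
    refine ⟨?_, ?_⟩
    · have : (s E : ℚ) = s C := by exact_mod_cast h
      rw [hs E hBE, hs C hBC] at this
      exact mul_left_cancel₀ hfac.ne' this
    · rw [h] at hfE
      omega
  · exfalso
    have h1 := hle C
    have h2 : (n + 1 : ℤ) * (s C + 1) ≤ (n + 1) * s E :=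
      mul_le_mul_of_nonneg_left h (by positivity)
    have h3 : (finrank (K₀ p k) C : ℤ) ≤ n := by exact_mod_cast h1
    linarith [(Nat.cast_nonneg (finrank (K₀ p k) E) : (0 : ℤ) ≤ _)]

/-- A weakly admissible filtered isocrystal, the Newton numbers of whose subobjects are bounded
below, has a Harder-Narasimhan filtration: each step is the largest subobject of maximal slope
above the preceding one. -/
theorem nonempty_hnFiltration {b : ℚ} (hb : ∀ E, X.IsAdmissible E → b ≤ X.tNOn E)
    (hX : X.IsWeaklyAdmissible) : Nonempty X.HNFiltration := by
  classical
  have key : ∀ B : {B // X.IsAdmissible B}, ∃ C : {C // X.IsAdmissible C}, B.1 ≠ ⊤ →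
      B.1 < C.1 ∧ ∀ E, X.IsAdmissible E → B.1 < E →
      X.slope B E < X.slope B C ∨
        (X.slope B E = X.slope B C ∧ finrank (K₀ p k) E ≤ finrank (K₀ p k) C.1) := by
    intro B
    by_cases hB : B.1 = ⊤
    · exact ⟨B, fun h => absurd hB h⟩
    · obtain ⟨C, hC, h1, h2⟩ := exists_max_slope hb hX hB
      exact ⟨⟨C, hC⟩, fun _ => ⟨h1, h2⟩⟩
  choose g hg using key
  let c : ℕ → {B // X.IsAdmissible B} := fun i => g^[i] ⟨⊥, isAdmissible_bot⟩
  have hc : ∀ i, c (i + 1) = g (c i) := fun i => Function.iterate_succ_apply' g i _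
  have htop : ∃ i, (c i).1 = ⊤ := by
    by_contra! h
    have h1 : ∀ i, i ≤ finrank (K₀ p k) (c i).1 := by
      intro i
      induction i with
      | zero => exact Nat.zero_le _
      | succ i ih =>
        have := Submodule.finrank_lt_finrank_of_lt (hg (c i) (h i)).1
        rw [hc]
        omega
    have h2 := h1 (finrank (K₀ p k) N + 1)
    have h3 := (c (finrank (K₀ p k) N + 1)).1.finrank_le
    omega
  have hlt : ∀ i, i < Nat.find htop → (c i).1 < (c (i + 1)).1 := fun i hi => by
    rw [hc]
    exact (hg _ (Nat.find_min htop hi)).1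
  have hmax : ∀ i, i < Nat.find htop → ∀ E, X.IsAdmissible E → (c i).1 < E →
      X.slope (c i).1 E < X.slope (c i).1 (c (i + 1)).1 ∨
        (X.slope (c i).1 E = X.slope (c i).1 (c (i + 1)).1 ∧
          finrank (K₀ p k) E ≤ finrank (K₀ p k) (c (i + 1)).1) := fun i hi => by
    rw [hc]
    exact (hg _ (Nat.find_min htop hi)).2
  refine ⟨{
    m := Nat.find htop
    C := fun i => (c i).1
    bot := rfl
    top := Nat.find_spec htop
    strictMono := Fin.strictMono_iff_lt_succ.mpr fun i => hlt i i.2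
    stable := fun i => (c i).2.stable
    weaklyAdmissible := fun i => hX.sub (c i).2
    semistable := fun i => ?_
    slope_strictAnti := ?_ }⟩
  · refine (isSemistable_subquot_iff hX (c i).2 (c (i + 1)).2 (hlt i i.2)).mpr fun E hE hBE _ => ?_
    rcases hmax i i.2 E hE hBE with h | h
    · exact h.le
    · exact h.1.le
  · have hmu : ∀ i : Fin (Nat.find htop), (X.subquot (c i).1 (c (i + 1)).1 (c i).2.stable
        (c (i + 1)).2.stable).mu = X.slope (c i).1 (c (i + 1)).1 := fun i =>
      mu_subquot (c i).2.stable (c (i + 1)).2.stable (hlt i i.2).le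
    have hdrop : ∀ i, i + 1 < Nat.find htop → X.slope (c (i + 1)).1 (c (i + 2)).1 <
        X.slope (c i).1 (c (i + 1)).1 := by
      intro i hi
      have h1 := hlt i (by omega)
      have h2 : (c (i + 1)).1 < (c (i + 2)).1 := hlt (i + 1) hi
      have h3 := Submodule.finrank_lt_finrank_of_lt h1
      have h4 := Submodule.finrank_lt_finrank_of_lt h2
      have h5 : X.slope (c i).1 (c (i + 2)).1 < X.slope (c i).1 (c (i + 1)).1 := by
        rcases hmax i (by omega) _ (c (i + 2)).2 (h1.trans h2) with h | h
        · exact h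
        · omega
      have h6 := slope_mul (X := X) h1
      have h7 := slope_mul (X := X) h2
      have h8 := slope_mul (X := X) (h1.trans h2)
      have h3' : (finrank (K₀ p k) (c i).1 : ℚ) < finrank (K₀ p k) (c (i + 1)).1 :=
        Nat.cast_lt.mpr h3
      have h4' : (finrank (K₀ p k) (c (i + 1)).1 : ℚ) < finrank (K₀ p k) (c (i + 2)).1 :=
        Nat.cast_lt.mpr h4
      by_contra! h9
      nlinarith [mul_le_mul_of_nonneg_right h9 (sub_nonneg.mpr h4'.le),
        mul_lt_mul_of_pos_right h5 (sub_pos.mpr (h3'.trans h4'))]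
    have hanti : ∀ i j, i < j → j < Nat.find htop → X.slope (c j).1 (c (j + 1)).1 <
        X.slope (c i).1 (c (i + 1)).1 := by
      intro i j hij
      induction j, hij using Nat.le_induction with
      | base => exact fun h => hdrop i h
      | succ j _ ih => exact fun h => (hdrop j h).trans (ih (by omega))
    intro i j hij
    have h1 := hmu i
    have h2 := hmu j
    have h3 := hanti i j hij j.2
    rw [← h1, ← h2] at h3
    exact h3

/-! ### Maximality of the steps of the Harder-Narasimhan filtration -/

/-- The degree function `c · ht - t_N` on subspaces. -/
def deg (X : FilteredIsocrystal p k K N) (c : ℚ) (B : Submodule (K₀ p k) N) : ℚ :=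
  c * finrank (K₀ p k) B - X.tNOn B

theorem deg_sup_add_inf (c : ℚ) (hA : X.IsStable A) (hB : X.IsStable B) :
    X.deg c (A ⊔ B) + X.deg c (A ⊓ B) = X.deg c A + X.deg c B := by
  have h1 : (X.tNOn (A ⊔ B) + X.tNOn (A ⊓ B) : ℚ) = X.tNOn A + X.tNOn B := by
    exact_mod_cast tNOn_sup_add_inf hA hB
  have h2 : (finrank (K₀ p k) (A ⊔ B : Submodule _ _) + finrank (K₀ p k) (A ⊓ B : Submodule _ _) : ℚ)
      = finrank (K₀ p k) A + finrank (K₀ p k) B := by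
    exact_mod_cast Submodule.finrank_sup_add_finrank_inf_eq A B
  simp only [deg]
  linear_combination c * h2 - h1

theorem deg_bot (c : ℚ) : X.deg c ⊥ = 0 := by
  rw [deg, tNOn_bot, finrank_bot]
  simp

theorem deg_sub_deg (c : ℚ) (h : B < C) : X.deg c C - X.deg c B =
    ((finrank (K₀ p k) C : ℚ) - finrank (K₀ p k) B) * (c + X.slope B C) := by
  have := slope_mul (X := X) h
  simp only [deg]
  linear_combination -this

namespace HNFiltration

variable (H : X.HNFiltration)

theorem lt_succ (i : Fin H.m) : H.C i.castSucc < H.C i.succ := H.strictMono i.castSucc_lt_succ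

theorem isAdmissible (i : Fin (H.m + 1)) : X.IsAdmissible (H.C i) :=
  ⟨H.stable i, (H.weaklyAdmissible i).2⟩

/-- The slope of the `i`-th successive quotient. -/
def step (i : Fin H.m) : ℚ := X.slope (H.C i.castSucc) (H.C i.succ)

theorem mu_eq_step (i : Fin H.m) : (X.subquot (H.C i.castSucc) (H.C i.succ)
    (H.stable _) (H.stable _)).mu = H.step i :=
  mu_subquot _ _ (H.lt_succ i).le

theorem step_strictAnti : StrictAnti H.step := fun i j hij => by
  rw [← mu_eq_step, ← mu_eq_step]
  exact H.slope_strictAnti hij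

/-- Intersecting with `E`, the degree grows from step `i` to the next one at most as much as the
degree of the steps, or not at all: the growth is the degree of the subobject
`(E ⊓ C_{i+1} + C_i) / C_i` of a semi-stable object. -/
theorem deg_inf_succ_sub_le (hX : X.IsWeaklyAdmissible) (hE : X.IsAdmissible E) (c : ℚ)
    (i : Fin H.m) :
    X.deg c (E ⊓ H.C i.succ) - X.deg c (E ⊓ H.C i.castSucc) ≤
      max 0 (X.deg c (H.C i.succ) - X.deg c (H.C i.castSucc)) := by
  have hC := H.isAdmissible i.castSucc
  have hC' := H.isAdmissible i.succ
  have hlt := H.lt_succ i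
  have hEC := (hX.inf_sup hE hC').1
  have hD := (hX.inf_sup hEC hC).2
  have h1 := X.deg_sup_add_inf c hEC.stable hC.stable
  have h2 : E ⊓ H.C i.succ ⊓ H.C i.castSucc = E ⊓ H.C i.castSucc := by
    rw [inf_assoc, inf_eq_right.mpr hlt.le]
  rw [h2] at h1
  have hle : H.C i.castSucc ≤ E ⊓ H.C i.succ ⊔ H.C i.castSucc := le_sup_right
  rcases hle.eq_or_lt with h | h
  · rw [← h] at h1
    refine le_max_of_le_left ?_
    linarith
  · have hDC : E ⊓ H.C i.succ ⊔ H.C i.castSucc ≤ H.C i.succ := sup_le inf_le_right hlt.le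
    have h3 := (isSemistable_subquot_iff hX hC hC' hlt).mp (H.semistable i) _ hD h hDC
    have h4 := X.deg_sub_deg c h
    have h5 := X.deg_sub_deg c hlt
    have h6 : (finrank (K₀ p k) (E ⊓ H.C i.succ ⊔ H.C i.castSucc : Submodule _ _) : ℚ) ≤
      finrank (K₀ p k) (H.C i.succ) := Nat.cast_le.mpr (Submodule.finrank_mono hDC)
    have h7 : (finrank (K₀ p k) (H.C i.castSucc) : ℚ) ≤ finrank (K₀ p k)
      (E ⊓ H.C i.succ ⊔ H.C i.castSucc : Submodule _ _) :=
        Nat.cast_le.mpr (Submodule.finrank_mono hle)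
    rcases le_total 0 (c + X.slope (H.C i.castSucc) (H.C i.succ)) with h8 | h8
    · refine le_max_of_le_right ?_
      nlinarith [mul_le_mul_of_nonneg_left h3 (sub_nonneg.mpr h7),
        mul_le_mul_of_nonneg_right h6 h8]
    · refine le_max_of_le_left ?_
      nlinarith [mul_le_mul_of_nonneg_left h3 (sub_nonneg.mpr h7),
        mul_nonneg (sub_nonneg.mpr h7) (sub_nonneg.mpr h8)]

/-- If the slopes up to the step `j` are at least `-c` and the slopes after it are at most `-c`,
then `H.C j` maximises the degree. -/
theorem deg_le (hX : X.IsWeaklyAdmissible) {c : ℚ} {j : Fin (H.m + 1)}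
    (h1 : ∀ i : Fin H.m, i.castSucc < j → -c ≤ H.step i)
    (h2 : ∀ i : Fin H.m, j ≤ i.castSucc → H.step i ≤ -c)
    (hE : X.IsAdmissible E) : X.deg c E ≤ X.deg c (H.C j) := by
  have hpos : ∀ i : Fin H.m, (0 : ℚ) ≤ (finrank (K₀ p k) (H.C i.succ) : ℚ) -
      finrank (K₀ p k) (H.C i.castSucc) := fun i =>
    sub_nonneg.mpr (Nat.cast_le.mpr (Submodule.finrank_mono (H.lt_succ i).le))
  have key : ∀ i : Fin (H.m + 1), X.deg c (E ⊓ H.C i) ≤ X.deg c (H.C (min i j)) := by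
    intro i
    induction i using Fin.induction with
    | zero =>
      rw [min_eq_left (Fin.zero_le j), H.bot, inf_bot_eq]
    | succ i ih =>
      have h3 := H.deg_inf_succ_sub_le hX hE c i
      have h4 := X.deg_sub_deg c (H.lt_succ i)
      rcases lt_or_ge i.castSucc j with hij | hij
      · rw [min_eq_left (Fin.castSucc_lt_iff_succ_le.mp hij)]
        rw [min_eq_left hij.le] at ih
        rw [max_eq_right] at h3
        · linarith
        · rw [h4]
          exact mul_nonneg (hpos i) (by have := h1 i hij; unfold step at this; linarith)
      · rw [min_eq_right (hij.trans i.castSucc_lt_succ.le)]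
        rw [min_eq_right hij] at ih
        rw [max_eq_left] at h3
        · linarith
        · rw [h4]
          exact mul_nonpos_of_nonneg_of_nonpos (hpos i)
            (by have := h2 i hij; unfold step at this; linarith)
  have h3 := key (Fin.last _)
  rwa [H.top, inf_top_eq, min_eq_right (Fin.le_last j)] at h3

/-- For every `c` there is a step as in `HNFiltration.deg_le`. -/
theorem exists_step (c : ℚ) : ∃ j : Fin (H.m + 1),
    (∀ i : Fin H.m, i.castSucc < j → -c ≤ H.step i) ∧
      ∀ i : Fin H.m, j ≤ i.castSucc → H.step i ≤ -c := by
  classical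
  by_cases h : ∃ n, ∃ hn : n < H.m, H.step ⟨n, hn⟩ ≤ -c
  · obtain ⟨hn, hn'⟩ := Nat.find_spec h
    refine ⟨⟨Nat.find h, by omega⟩, fun i hi => ?_, fun i hi => ?_⟩
    · have := Nat.find_min h (m := i) hi
      push Not at this
      exact (this i.2).le
    · exact (H.step_strictAnti.antitone (show ⟨Nat.find h, hn⟩ ≤ i from hi)).trans hn'
  · push Not at h
    refine ⟨Fin.last _, fun i _ => (h i i.2).le, fun i hi => ?_⟩
    exact absurd hi (not_le.mpr i.castSucc_lt_last)

end HNFiltration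

/-- A common maximiser of two degree functions is determined by its dimension and Newton number. -/
theorem eq_of_deg_le (hX : X.IsWeaklyAdmissible) {c c' : ℚ} (hcc : c < c')
    (hA : X.IsAdmissible A) (h : ∀ E, X.IsAdmissible E → X.deg c E ≤ X.deg c A)
    (h' : ∀ E, X.IsAdmissible E → X.deg c' E ≤ X.deg c' A) (hB : X.IsAdmissible B)
    (hdim : finrank (K₀ p k) B = finrank (K₀ p k) A) (htN : X.tNOn B = X.tNOn A) : B = A := by
  obtain ⟨h1, h2⟩ := hX.inf_sup hA hB
  have h3 := X.deg_sup_add_inf c hA.stable hB.stable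
  have h4 := X.deg_sup_add_inf c' hA.stable hB.stable
  have h5 := h _ h1
  have h6 := h' _ h1
  have h7 := h _ h2
  have h8 := h' _ h2
  have h9 : finrank (K₀ p k) A = finrank (K₀ p k) (A ⊔ B : Submodule _ _) := by
    simp only [deg, hdim, htN] at h3 h4 h5 h6 h7 h8
    have : (c' - c) * ((finrank (K₀ p k) A : ℚ) - finrank (K₀ p k) (A ⊔ B : Submodule _ _)) =
        0 := by
      linarith
    rcases mul_eq_zero.mp this with h | h
    · linarith
    · exact_mod_cast sub_eq_zero.mp h
  have h10 : A = A ⊔ B := Submodule.eq_of_le_of_finrank_eq le_sup_left h9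
  refine Submodule.eq_of_le_of_finrank_eq ?_ hdim
  rw [h10]
  exact le_sup_right

/-- A common maximiser of two degree functions is the only maximiser of every degree function in
between. -/
theorem eq_of_deg_eq (hX : X.IsWeaklyAdmissible) {c₀ c c₁ : ℚ} (h₀ : c₀ < c) (h₁ : c < c₁)
    (hA : X.IsAdmissible A) (h : ∀ E, X.IsAdmissible E → X.deg c₀ E ≤ X.deg c₀ A)
    (h' : ∀ E, X.IsAdmissible E → X.deg c₁ E ≤ X.deg c₁ A) (hB : X.IsAdmissible B)
    (heq : X.deg c B = X.deg c A) : B = A := by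
  have h1 := h B hB
  have h2 := h' B hB
  simp only [deg] at h1 h2 heq
  have h3 : (finrank (K₀ p k) B : ℚ) = finrank (K₀ p k) A := by
    apply le_antisymm
    · by_contra! h4
      nlinarith [mul_pos (sub_pos.mpr h₁) (sub_pos.mpr h4)]
    · by_contra! h4
      nlinarith [mul_pos (sub_pos.mpr h₀) (sub_pos.mpr h4)]
  have h4 : (X.tNOn B : ℚ) = X.tNOn A := by
    rw [h3] at heq
    linarith
  exact eq_of_deg_le hX (h₀.trans h₁) hA h h' hB (by exact_mod_cast h3) (by exact_mod_cast h4)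

end FilteredIsocrystal

end HodgeNewton

namespace HodgeNewton

namespace FilteredIsocrystal

open Module

variable {p : ℕ} [Fact p.Prime] {k : Type*} [Field k] [CharP k p] [PerfectRing k p]
  {K : Type*} [Field K] [Algebra (K₀ p k) K]
  {N : Type*} [AddCommGroup N] [Module (K₀ p k) N] [FiniteDimensional (K₀ p k) N]
  {X : FilteredIsocrystal p k K N} {A B C E : Submodule (K₀ p k) N}

/-! ### Maximality of the parts of the slope decomposition -/

namespace SlopeDecomposition

/-- The part of the slope decomposition belonging to the slopes below `c` maximises the degree
`c · ht - t_N` among all stable subspaces. -/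
theorem deg_le_part (D : X.SlopeDecomposition) (J : Finset (Fin D.m)) {c : ℚ}
    (h1 : ∀ i ∈ J, D.slope i ≤ c) (h2 : ∀ i ∉ J, c ≤ D.slope i) (hE : X.IsStable E) :
    X.deg c E ≤ X.deg c (D.part J) := by
  have hA := D.isStable_part J
  -- All slopes of `N / A` are at least `c`, so the degree does not grow from `A` to `A + E`.
  have h3 : X.deg c (D.part J ⊔ E) ≤ X.deg c (D.part J) := by
    have hge : X.SlopesGE (D.part Jᶜ) c := SlopesGE.finset_sup fun i hi =>
      (D.isotypical i).slopesGE.mono (h2 i (Finset.mem_compl.mp hi))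
    have htop : (D.part Jᶜ).map (D.part J).mkQ = ⊤ :=
      (Submodule.map_mkQ_eq_top _ _).mpr (D.isCompl_part J).sup_eq_top
    have hge' : (X.quot _ hA).SlopesGE ⊤ c := htop ▸ hge.map (Z := X.quot _ hA) fun _ => rfl
    have hex := isStrictExact_quot_sub (hA.sup hE) hA le_sup_left
    have h4 := (hge'.of_le (isStable_map_mkQ (hA.sup hE) hA) le_top).le_tN
      (isStable_map_mkQ (hA.sup hE) hA)
    have h5 := congrArg (Int.cast (R := ℚ)) hex.tN_eq
    have h6 := congrArg (Nat.cast (R := ℚ)) hex.finrank_eq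
    rw [Int.cast_add] at h5
    rw [Nat.cast_add] at h6
    rw [deg, deg, tNOn_eq (hA.sup hE), tNOn_eq hA, h5, h6]
    linarith
  -- All slopes of `A` are at most `c`, so the degree does not drop from `A ∩ E` to `A`.
  have h4 : X.deg c (D.part J ⊓ E) ≤ X.deg c (D.part J) := by
    have hle : X.SlopesLE (D.part J) c := SlopesLE.finset_sup fun i hi =>
      (D.isotypical i).slopesLE.mono (h1 i hi)
    have hAE := hA.inf hE
    have hex := isStrictExact_quot_sub hA hAE inf_le_left
    have h4 := (hle.map (Z := X.quot _ hAE) (f := (D.part J ⊓ E).mkQ) fun _ => rfl).tN_le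
      (isStable_map_mkQ hA hAE)
    have h5 := congrArg (Int.cast (R := ℚ)) hex.tN_eq
    have h6 := congrArg (Nat.cast (R := ℚ)) hex.finrank_eq
    rw [Int.cast_add] at h5
    rw [Nat.cast_add] at h6
    rw [deg, deg, tNOn_eq hAE, tNOn_eq hA, h5, h6]
    linarith
  have h5 := X.deg_sup_add_inf c hA hE
  linarith

/-- The Newton numbers of stable subspaces are bounded below: for `c` below all slopes, the zero
subspace maximises `c * ht - t_N`. -/
theorem exists_le_tNOn (D : X.SlopeDecomposition) : ∃ b : ℚ, ∀ E, X.IsStable E → b ≤ X.tNOn E := by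
  let c : ℚ := -∑ i, |D.slope i|
  have hc : ∀ i, c ≤ D.slope i := fun i => by
    have := Finset.single_le_sum (f := fun i => |D.slope i|) (fun i _ => abs_nonneg _)
      (Finset.mem_univ i)
    linarith [neg_abs_le (D.slope i)]
  have hc0 : c ≤ 0 := neg_nonpos.mpr (Finset.sum_nonneg fun i _ => abs_nonneg _)
  refine ⟨c * finrank (K₀ p k) N, fun E hE => ?_⟩
  have h1 := D.deg_le_part ∅ (c := c) (by simp) (fun i _ => hc i) hE
  have h2 : D.part ∅ = ⊥ := Finset.sup_empty
  rw [h2, deg_bot, deg] at h1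
  have h3 : (finrank (K₀ p k) E : ℚ) ≤ finrank (K₀ p k) N := Nat.cast_le.mpr E.finrank_le
  linarith [mul_le_mul_of_nonpos_left h3 hc0]

omit [FiniteDimensional (K₀ p k) N] in
/-- A sum `A` of isotypical components inherits a slope decomposition, since it is also the quotient
of `N` by the other components. -/
theorem exists_sub (D : X.SlopeDecomposition) (J : Finset (Fin D.m)) :
    ∃ D' : (X.sub (D.part J) (D.isStable_part J)).SlopeDecomposition,
      ∀ {M : Type} [AddCommMonoid M] (F : ℚ → ℕ → M),
        ∑ i, F (D'.slope i) (finrank (K₀ p k) (D'.comp i)) =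
          ∑ i ∈ J, F (D.slope i) (finrank (K₀ p k) (D.comp i)) := by
  have hc := D.isCompl_part J
  refine D.exists_of_surjective (f := (D.part J).projectionOnto (D.part Jᶜ) hc) (fun v => ?_)
    (Submodule.projectionOnto_surjective hc) J (Submodule.ker_projectionOnto hc)
  obtain ⟨a, ha, b, hb, rfl⟩ := Submodule.mem_sup.mp
    (hc.sup_eq_top ▸ Submodule.mem_top : v ∈ D.part J ⊔ D.part Jᶜ)
  have h1 := (D.isStable_part J a).mpr ha
  have h2 := (D.isStable_part Jᶜ b).mpr hb
  rw [map_add, map_add, map_add, Submodule.projectionOnto_apply_of_mem_left hc h1,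
    (Submodule.projectionOnto_apply_eq_zero_iff hc).mpr h2,
    Submodule.projectionOnto_apply_of_mem_left hc ha,
    (Submodule.projectionOnto_apply_eq_zero_iff hc).mpr hb, add_zero, add_zero]
  rfl

omit [FiniteDimensional (K₀ p k) N] in
theorem exists_quot (D : X.SlopeDecomposition) (J : Finset (Fin D.m)) :
    ∃ D' : (X.quot (D.part J) (D.isStable_part J)).SlopeDecomposition,
      ∀ {M : Type} [AddCommMonoid M] (F : ℚ → ℕ → M),
        ∑ i, F (D'.slope i) (finrank (K₀ p k) (D'.comp i)) =
          ∑ i ∈ Jᶜ, F (D.slope i) (finrank (K₀ p k) (D.comp i)) :=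
  D.exists_of_surjective (f := (D.part J).mkQ) (fun _ => rfl) (D.part J).mkQ_surjective Jᶜ
    (by rw [compl_compl, Submodule.ker_mkQ])

end SlopeDecomposition

end FilteredIsocrystal

namespace FilteredIsocrystalWithCoeff

open Module FilteredIsocrystal

variable {p : ℕ} [Fact p.Prime] {k : Type*} [Field k] [CharP k p] [PerfectRing k p]
  {K : Type*} [Field K] [Algebra (K₀ p k) K]
  {F : Type*} [Field F] [Algebra ℚ_[p] F]
  {N : Type*} [AddCommGroup N] [Module (K₀ p k) N]
  {X : FilteredIsocrystalWithCoeff p k K F N} {A : Submodule (K₀ p k) N}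

/-! ### Subspaces stable under the coefficients -/

theorem ι_injective {a : F} (ha : a ≠ 0) : Function.Injective (X.ι a) := by
  refine Function.LeftInverse.injective (g := X.ι a⁻¹) fun v => ?_
  rw [← Module.End.mul_apply, ← map_mul, inv_mul_cancel₀ ha, map_one, Module.End.one_apply]

theorem ι_zero_apply (v : N) : X.ι 0 v = 0 := by
  rw [map_zero, LinearMap.zero_apply]

theorem isStable_of_map_le (hA : X.toFilteredIsocrystal.IsStable A)
    (h : ∀ a ≠ 0, A.map (X.ι a) ≤ A) : X.IsStable A := by
  refine ⟨hA, fun a v hv => ?_⟩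
  by_cases ha : a = 0
  · rw [ha, ι_zero_apply]
    exact A.zero_mem
  · exact h a ha ⟨v, hv, rfl⟩

variable [FiniteDimensional (K₀ p k) N]

omit [FiniteDimensional (K₀ p k) N] in
theorem finrank_map_ι {a : F} (ha : a ≠ 0) :
    finrank (K₀ p k) (A.map (X.ι a)) = finrank (K₀ p k) A :=
  (Submodule.equivMapOfInjective (X.ι a) (ι_injective ha) A).finrank_eq.symm

theorem tNOn_map_ι (hA : X.toFilteredIsocrystal.IsStable A) {a : F} (ha : a ≠ 0) :
    X.tNOn (A.map (X.ι a)) = X.tNOn A := by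
  have hA' : X.toFilteredIsocrystal.IsStable (A.map (X.ι a)) := hA.map (X.ι_φ a)
  rw [tNOn_eq hA, tNOn_eq hA']
  refine (tN_congr (X := X.toFilteredIsocrystal.sub A hA)
    (Y := X.toFilteredIsocrystal.sub _ hA')
    (Submodule.equivMapOfInjective (X.ι a) (ι_injective ha) A) fun v => ?_).symm
  exact Subtype.ext (X.ι_φ a v)

/-- The image of a weakly admissible subobject under the coefficients is weakly admissible: the
Newton number does not change and the Hodge number cannot drop. -/
theorem isAdmissible_map_ι (hX : X.IsWeaklyAdmissible)
    (hA : X.toFilteredIsocrystal.IsAdmissible A) {a : F} (ha : a ≠ 0) :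
    X.toFilteredIsocrystal.IsAdmissible (A.map (X.ι a)) := by
  have hA' : X.toFilteredIsocrystal.IsStable (A.map (X.ι a)) := hA.stable.map (X.ι_φ a)
  refine ⟨hA', le_antisymm (hX.1 _ hA') ?_⟩
  have h1 := tNOn_map_ι hA.stable ha
  rw [tNOn_eq hA.stable, tNOn_eq hA'] at h1
  have hinj : Function.Injective ((X.ι a).baseChange K) :=
    Module.Flat.lTensor_preserves_injective_linearMap _ (ι_injective ha)
  have h2 := VecFiltration.degreeOn_le_degreeOn_map (𝓕 := X.fil) ((X.ι a).baseChange K) hinj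
    (X.ι_fil a) (A.baseChange K)
  have h3 : (A.baseChange K).map ((X.ι a).baseChange K) = (A.map (X.ι a)).baseChange K :=
    le_antisymm (map_baseChange_le K _ _) (baseChange_map_le K _ _)
  rw [h3, ← tH_sub _ _ hA.stable, ← tH_sub _ _ hA', hA.tH_eq] at h2
  rwa [h1]

/-- A common maximiser of two degree functions is stable under `F`: its image under `a ≠ 0` is a
weakly admissible subobject of the same height and Newton number, so it is the same subspace. -/
theorem isStable_of_deg_le (hX : X.IsWeaklyAdmissible) {c c' : ℚ} (hcc : c < c')
    (hA : X.toFilteredIsocrystal.IsAdmissible A)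
    (h : ∀ E, X.toFilteredIsocrystal.IsAdmissible E → X.deg c E ≤ X.deg c A)
    (h' : ∀ E, X.toFilteredIsocrystal.IsAdmissible E → X.deg c' E ≤ X.deg c' A) : X.IsStable A :=
  isStable_of_map_le hA.stable fun _ ha => (eq_of_deg_le hX hcc hA h h'
    (isAdmissible_map_ι hX hA ha) (finrank_map_ι ha) (tNOn_map_ι hA.stable ha)).le

/-- `ι(a)` maps an isotypical component to an isotypical subspace of the same slope. -/
theorem isStable_comp (D : X.SlopeDecomposition) (i : Fin D.m) : X.IsStable (D.comp i) := by
  refine isStable_of_map_le (D.isotypical i).1 fun a ha => ?_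
  have h1 : X.toFilteredIsocrystal.IsIsotypical ((D.comp i).map (X.ι a)) (D.slope i) :=
    (D.isotypical i).map (X.ι_φ a)
  have h2 : (D.comp i).map (X.ι a) ≠ ⊥ := by
    rw [ne_eq, ← Submodule.finrank_eq_zero (R := K₀ p k), finrank_map_ι ha,
      Submodule.finrank_eq_zero]
    exact D.ne_bot i
  obtain ⟨j, hj, hle⟩ := D.exists_comp_of_isIsotypical h1 h2
  rwa [D.strictMono.injective hj] at hle

theorem isStable_part (D : X.SlopeDecomposition) (J : Finset (Fin D.m)) :
    X.IsStable (D.part J) := by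
  refine isStable_of_map_le (D.isStable_part J) fun a ha => ?_
  rw [Submodule.map_le_iff_le_comap]
  exact Finset.sup_le fun i hi v hv => D.comp_le_part hi ((isStable_comp D i).ι_stable a v hv)

variable [FiniteDimensional ℚ_[p] F]

theorem IsStable.finrank_dvd (hA : X.IsStable A) : finrank ℚ_[p] F ∣ finrank (K₀ p k) A :=
  (X.sub A hA).finrank_dvd

/-! ### The Newton polygon -/

omit [FiniteDimensional (K₀ p k) N] [FiniteDimensional ℚ_[p] F] in
theorem sortedGE_newton : X.newton.SortedGE := by
  unfold newton
  split_ifs with h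
  · exact sortedGE_flatten_replicate _ fun i j hij => neg_le_neg (h.some.strictMono.monotone hij)
  · exact List.Pairwise.nil.sortedGE

omit [FiniteDimensional ℚ_[p] F] in
/-- The slopes of the Newton polygon can be computed from any slope decomposition. -/
theorem coe_newton (D : X.SlopeDecomposition) : (X.newton : Multiset ℚ) =
    ∑ i, Multiset.replicate (finrank (K₀ p k) (D.comp i) / finrank ℚ_[p] F) (-(D.slope i)) := by
  have h : Nonempty X.toFilteredIsocrystal.SlopeDecomposition := ⟨D⟩
  rw [newton, dif_pos h, coe_flatten_replicate]
  exact h.some.sum_eq D fun s C =>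
    Multiset.replicate (finrank (K₀ p k) C / finrank ℚ_[p] F) (-s)

omit [FiniteDimensional (K₀ p k) N] [FiniteDimensional ℚ_[p] F] in
/-- The list `newton` is empty by convention if there is no slope decomposition. So the existence of
a break point includes the one of a slope decomposition. -/
theorem nonempty_slopeDecomposition (h : X.newton ≠ []) :
    Nonempty X.toFilteredIsocrystal.SlopeDecomposition := by
  by_contra h'
  exact h (dif_neg h')

end FilteredIsocrystalWithCoeff

end HodgeNewton

namespace HodgeNewton

namespace FilteredIsocrystalWithCoeff

open Module FilteredIsocrystal

variable {p : ℕ} [Fact p.Prime] {k : Type*} [Field k] [CharP k p] [PerfectRing k p]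
  {K : Type*} [Field K] [Algebra (K₀ p k) K]
  {F : Type*} [Field F] [Algebra ℚ_[p] F] [FiniteDimensional ℚ_[p] F]
  {N : Type*} [AddCommGroup N] [Module (K₀ p k) N] [FiniteDimensional (K₀ p k) N]
  {X : FilteredIsocrystalWithCoeff p k K F N} {A : Submodule (K₀ p k) N} {z : ℝ × ℝ}

/-! ### Splitting the polygons at a break point -/

/-- A break point of the Newton polygon splits off the part `A` of the slope decomposition with
the small slopes. It maximises `c · ht - t_N` for all `c` in an interval which is not a point. -/
theorem exists_newton_eq_append (hz : IsBreakPoint X.newton z) :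
    ∃ (A : Submodule (K₀ p k) N) (hA : X.IsStable A),
      (∃ c c' : ℚ, c < c' ∧
        (∀ E, X.toFilteredIsocrystal.IsStable E → X.deg c E ≤ X.deg c A) ∧
        ∀ E, X.toFilteredIsocrystal.IsStable E → X.deg c' E ≤ X.deg c' A) ∧
      X.newton = (X.sub A hA).newton ++ (X.quot A hA).newton ∧
      ((X.sub A hA).newton.length : ℝ) = z.1 ∧ (((X.sub A hA).newton.sum : ℚ) : ℝ) = z.2 ∧
      finrank ℚ_[p] F * (X.sub A hA).newton.length = finrank (K₀ p k) A ∧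
      finrank ℚ_[p] F * (X.sub A hA).newton.sum = -(X.tNOn A : ℚ) ∧ A ≠ ⊥ ∧ A ≠ ⊤ := by
  classical
  obtain ⟨t, hcard, hsum, -, a, ha, hat⟩ := hz.exists_threshold sortedGE_newton
  have hne : X.newton ≠ [] := by
    intro h
    have h1 := hz.1
    have h2 := hz.2.1
    rw [h, List.length_nil, Nat.cast_zero] at h2
    exact lt_asymm h1 h2
  obtain ⟨D⟩ := nonempty_slopeDecomposition hne
  set d := finrank ℚ_[p] F with hd
  have hd0 : (d : ℚ) ≠ 0 := Nat.cast_ne_zero.mpr Module.finrank_pos.ne'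
  -- The polygon has slopes `-λ`, so its slopes from the threshold `t` on are the `λ ≤ -t`.
  let J : Finset (Fin D.m) := Finset.univ.filter fun i => t ≤ -(D.slope i)
  have hJ : ∀ i, i ∈ J ↔ t ≤ -(D.slope i) := fun i => by simp [J]
  let n : Fin D.m → ℕ := fun i => finrank (K₀ p k) (D.comp i) / d
  let s : Fin D.m → ℚ := fun i => -(D.slope i)
  let l := (∑ i ∈ J, Multiset.replicate (n i) (s i)).sort (· ≥ ·)
  let l' := (∑ i ∈ Jᶜ, Multiset.replicate (n i) (s i)).sort (· ≥ ·)
  have hn : ∀ i, (d : ℚ) * n i = finrank (K₀ p k) (D.comp i) := fun i => by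
    exact_mod_cast Nat.mul_div_cancel' (isStable_comp D i).finrank_dvd
  have hA : X.IsStable (D.part J) := isStable_part D J
  have hsub : (X.sub _ hA).newton = l := by
    obtain ⟨D', hD'⟩ := D.exists_sub J
    have h1 : ((X.sub _ hA).newton : Multiset ℚ) = l := by
      rw [Multiset.sort_eq, coe_newton (X := X.sub _ hA) D']
      exact hD' fun q m => Multiset.replicate (m / d) (-q)
    exact (Multiset.coe_eq_coe.mp h1).eq_of_sortedGE sortedGE_newton (sortedGE_sort _)
  have hquot : (X.quot _ hA).newton = l' := by
    obtain ⟨D', hD'⟩ := D.exists_quot J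
    have h1 : ((X.quot _ hA).newton : Multiset ℚ) = l' := by
      rw [Multiset.sort_eq, coe_newton (X := X.quot _ hA) D']
      exact hD' fun q m => Multiset.replicate (m / d) (-q)
    exact (Multiset.coe_eq_coe.mp h1).eq_of_sortedGE sortedGE_newton (sortedGE_sort _)
  have happ : X.newton = l ++ l' := by
    refine eq_sort_append_sort (fun i hi i' hi' => ?_) sortedGE_newton (coe_newton D)
    rw [hJ] at hi hi'
    exact (not_le.mp hi').trans_le hi
  have hfilter : (X.newton : Multiset ℚ).filter (t ≤ ·) = l := by
    rw [happ, ← Multiset.coe_add, Multiset.filter_add, Multiset.filter_eq_self.mpr fun a ha => ?_,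
      Multiset.filter_eq_nil.mpr fun a ha => ?_, add_zero]
    · obtain ⟨i, hi, rfl⟩ := mem_sort_sum_replicate (Multiset.mem_coe.mp ha)
      exact fun h => Finset.mem_compl.mp hi ((hJ i).mpr h)
    · obtain ⟨i, hi, rfl⟩ := mem_sort_sum_replicate (Multiset.mem_coe.mp ha)
      exact (hJ i).mp hi
  have hlen : d * l.length = finrank (K₀ p k) (D.part J) := by
    rw [length_sort_sum_replicate, D.finrank_part, Finset.mul_sum]
    exact Finset.sum_congr rfl fun i _ => Nat.mul_div_cancel' (isStable_comp D i).finrank_dvd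
  have hlsum : d * l.sum = -(X.tNOn (D.part J) : ℚ) := by
    rw [sum_sort_sum_replicate, tNOn_eq (D.isStable_part J), D.tN_part, Finset.mul_sum,
      ← Finset.sum_neg_distrib]
    refine Finset.sum_congr rfl fun i _ => ?_
    rw [← hn]
    ring
  have hl1 : (l.length : ℝ) = z.1 := by rw [← hcard, hfilter, Multiset.coe_card]
  have hl2 : ((l.sum : ℚ) : ℝ) = z.2 := by rw [← hsum, hfilter, Multiset.sum_coe]
  refine ⟨D.part J, hA, ?_, hsub.symm ▸ hquot.symm ▸ happ, ?_⟩
  · -- The interval reaches from `-t` to the next slope outside `J`.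
    obtain ⟨c', hc, hc'⟩ : ∃ c', -t < c' ∧ ∀ i ∉ J, c' ≤ D.slope i := by
      rcases Jᶜ.eq_empty_or_nonempty with h | h
      · refine ⟨-t + 1, by linarith, fun i hi => ?_⟩
        rw [Finset.compl_eq_empty_iff] at h
        exact absurd (h ▸ Finset.mem_univ i) hi
      · obtain ⟨i, hi, hmin⟩ := Finset.exists_min_image Jᶜ D.slope h
        rw [Finset.mem_compl, hJ] at hi
        exact ⟨D.slope i, by linarith, fun i' hi' => hmin i' (Finset.mem_compl.mpr hi')⟩
    refine ⟨-t, c', hc, fun E hE => ?_, fun E hE => ?_⟩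
    · exact D.deg_le_part J (fun i hi => by linarith [(hJ i).mp hi])
        (fun i hi => hc.le.trans (hc' i hi)) hE
    · exact D.deg_le_part J (fun i hi => by linarith [(hJ i).mp hi]) hc' hE
  · rw [hsub]
    refine ⟨hl1, hl2, hlen, hlsum, fun h => ?_, fun h => ?_⟩
    · rw [h, finrank_bot] at hlen
      have h1 := hz.1
      rw [← hl1, (Nat.mul_eq_zero.mp hlen).resolve_left Module.finrank_pos.ne', Nat.cast_zero] at h1
      exact lt_irrefl _ h1
    · rw [happ, List.mem_append] at ha
      rcases ha with ha | ha
      · obtain ⟨i, hi, rfl⟩ := mem_sort_sum_replicate ha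
        exact hat.not_ge ((hJ i).mp hi)
      · obtain ⟨i, hi, rfl⟩ := mem_sort_sum_replicate ha
        have h1 := (D.isCompl_part J).disjoint
        rw [h, top_disjoint] at h1
        exact D.ne_bot i (le_bot_iff.mp (h1 ▸ D.comp_le_part hi))

/-- A subobject whose underlying space ends on the Hodge polygon has equal Hodge and Newton numbers
and splits the Hodge polygon. -/
theorem hodge_eq_append_of_liesOn (hX : X.IsWeaklyAdmissible) (hz : LiesOn X.hodge z)
    (hA : X.IsStable A) {q : ℕ} (hq : (q : ℝ) = z.1)
    (hdim : finrank ℚ_[p] F * q = finrank (K₀ p k) A)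
    (htN : -(X.tNOn A : ℝ) = finrank ℚ_[p] F * z.2) :
    X.toFilteredIsocrystal.IsAdmissible A ∧ X.hodge = (X.sub A hA).hodge ++ (X.quot A hA).hodge ∧
      (X.sub A hA).hodge.length = q ∧ (((X.sub A hA).hodge.sum : ℚ) : ℝ) = z.2 := by
  have hq' : finrank (K₀ p k) A / finrank ℚ_[p] F = q := by
    rw [← hdim, Nat.mul_div_cancel_left _ Module.finrank_pos]
  have hql : q ≤ X.hodge.length := by
    have := hz.2.1
    rw [← hq] at this
    exact_mod_cast this
  have h1 := hz.2.2
  rw [← hq, polygon_natCast_eq_sum_take _ hql] at h1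
  have h2 : (finrank ℚ_[p] F : ℚ) * (X.hodge.take q).sum = -(X.tNOn A : ℚ) := by
    rw [← h1] at htN
    exact_mod_cast htN.symm
  -- `z` lies on the Hodge polygon, which lies above the one of `A`: hence `t_N(A) ≤ t_H(A)`.
  have h3 := X.neg_tH_sub_le hA
  rw [hq', h2, tNOn_eq hA.stable, neg_le_neg_iff, Int.cast_le] at h3
  have h4 : (X.toFilteredIsocrystal.sub A hA.stable).tH =
      (X.toFilteredIsocrystal.sub A hA.stable).tN :=
    le_antisymm (hX.1 A hA.stable) h3
  have h5 := X.hodge_eq_append hA (by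
    rw [hq', h2, tNOn_eq hA.stable, ← h4]
    rfl)
  have h6 : (X.sub A hA).hodge.length = q := by rw [length_hodge, hq']
  refine ⟨⟨hA.stable, h4⟩, h5, h6, ?_⟩
  rw [← h1, h5, ← h6, List.take_left]

/-! ### The Harder-Narasimhan polygon -/

omit [FiniteDimensional ℚ_[p] F] in
/-- The list `hn` is defined by some Harder-Narasimhan filtration, if there is one. -/
theorem exists_hn_eq (h : Nonempty X.toFilteredIsocrystal.HNFiltration) :
    ∃ H : X.toFilteredIsocrystal.HNFiltration, X.hn = (List.ofFn fun i : Fin H.m =>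
      List.replicate ((finrank (K₀ p k) (H.C i.succ) - finrank (K₀ p k) (H.C i.castSucc)) /
        finrank ℚ_[p] F) (H.step i)).flatten := by
  refine ⟨h.some, ?_⟩
  rw [hn, dif_pos h]
  congr 2
  funext i
  rw [HNFiltration.mu_eq_step]
  congr 2
  have h1 := Submodule.finrank_quotient_add_finrank
    ((h.some.C i.castSucc).submoduleOf (h.some.C i.succ))
  rw [finrank_submoduleOf (h.some.lt_succ i).le] at h1
  omega

/-- A common maximiser of two degree functions is a step of every Harder-Narasimhan filtration. -/
theorem exists_hn_step {X : FilteredIsocrystal p k K N} (hX : X.IsWeaklyAdmissible)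
    (H : X.HNFiltration) {c c' : ℚ} (hcc : c < c') (hA : X.IsAdmissible A)
    (h : ∀ E, X.IsAdmissible E → X.deg c E ≤ X.deg c A)
    (h' : ∀ E, X.IsAdmissible E → X.deg c' E ≤ X.deg c' A) : ∃ j, H.C j = A := by
  obtain ⟨b, hb, hb'⟩ := exists_between hcc
  obtain ⟨j, h1, h2⟩ := H.exists_step b
  refine ⟨j, eq_of_deg_eq hX hb hb' hA h h' (H.isAdmissible j) (le_antisymm ?_ ?_)⟩
  · -- The degree is affine in the parameter.
    have h3 := h _ (H.isAdmissible j)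
    have h4 := h' _ (H.isAdmissible j)
    simp only [deg] at h3 h4 ⊢
    nlinarith [mul_le_mul_of_nonneg_left h3 (sub_nonneg.mpr hb'.le),
      mul_le_mul_of_nonneg_left h4 (sub_nonneg.mpr hb.le)]
  · exact H.deg_le hX h1 h2 hA

omit [FiniteDimensional ℚ_[p] F] in
/-- Every step of a Harder-Narasimhan filtration is stable under `F`, as a common maximiser of the
degree functions for the two adjacent slopes. -/
theorem isStable_hn_step (hX : X.IsWeaklyAdmissible) (H : X.toFilteredIsocrystal.HNFiltration)
    (j : Fin (H.m + 1)) : X.IsStable (H.C j) := by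
  by_cases hj0 : j = 0
  · rw [hj0, H.bot]
    refine ⟨X.isStable_bot, fun a v hv => ?_⟩
    rw [(Submodule.mem_bot _).mp hv, map_zero]
    exact Submodule.zero_mem _
  by_cases hjl : j = Fin.last _
  · rw [hjl, H.top]
    exact ⟨X.isStable_top, fun _ _ _ => Submodule.mem_top⟩
  obtain ⟨i, hi⟩ := Fin.exists_succ_eq.mpr hj0
  obtain ⟨i', hi'⟩ := Fin.exists_castSucc_eq.mpr hjl
  have hii : i < i' := by
    rw [Fin.lt_def]
    have h1 := congrArg Fin.val hi
    have h2 := congrArg Fin.val hi'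
    rw [Fin.val_succ] at h1
    rw [Fin.val_castSucc] at h2
    omega
  -- The step maximises the degree for all parameters between the adjacent slopes.
  have key : ∀ c, -H.step i ≤ c → c ≤ -H.step i' → ∀ E, X.toFilteredIsocrystal.IsAdmissible E →
      X.deg c E ≤ X.deg c (H.C j) := by
    intro c hc hc' E hE
    refine H.deg_le hX (fun l hl => ?_) (fun l hl => ?_) hE
    · have : l ≤ i := by
        rw [← hi] at hl
        exact Fin.castSucc_lt_succ_iff.mp hl
      linarith [H.step_strictAnti.antitone this]
    · have : i' ≤ l := by
        rw [← hi'] at hl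
        exact Fin.castSucc_le_castSucc_iff.mp hl
      linarith [H.step_strictAnti.antitone this]
  have hlt : -H.step i < -H.step i' := neg_lt_neg (H.step_strictAnti hii)
  exact isStable_of_deg_le hX hlt (H.isAdmissible j) (key _ le_rfl hlt.le) (key _ hlt.le le_rfl)

/-- The Harder-Narasimhan polygon breaks at every proper step. The integer divisions by `d` in its
multiplicities are exact since all steps are stable under `F`. -/
theorem isBreakPoint_hn (hX : X.IsWeaklyAdmissible) {H : X.toFilteredIsocrystal.HNFiltration}
    (hH : X.hn = (List.ofFn fun i : Fin H.m =>
      List.replicate ((finrank (K₀ p k) (H.C i.succ) - finrank (K₀ p k) (H.C i.castSucc)) /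
        finrank ℚ_[p] F) (H.step i)).flatten) {j : Fin (H.m + 1)} (h0 : H.C j ≠ ⊥)
    (h1 : H.C j ≠ ⊤) {q : ℕ} {y : ℚ} (hq : finrank ℚ_[p] F * q = finrank (K₀ p k) (H.C j))
    (hy : finrank ℚ_[p] F * y = -(X.tNOn (H.C j) : ℚ)) : IsBreakPoint X.hn ((q : ℕ), (y : ℝ)) := by
  classical
  set d := finrank ℚ_[p] F with hd
  have hd0 : (d : ℚ) ≠ 0 := Nat.cast_ne_zero.mpr Module.finrank_pos.ne'
  let n : Fin H.m → ℕ := fun i =>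
    (finrank (K₀ p k) (H.C i.succ) - finrank (K₀ p k) (H.C i.castSucc)) / d
  let J : Finset (Fin H.m) := Finset.univ.filter fun i => i.castSucc < j
  have hn : ∀ i, (d : ℚ) * n i =
      (finrank (K₀ p k) (H.C i.succ) : ℚ) - finrank (K₀ p k) (H.C i.castSucc) := fun i => by
    rw [← Nat.cast_sub (Submodule.finrank_mono (H.lt_succ i).le)]
    exact_mod_cast Nat.mul_div_cancel' (Nat.dvd_sub (isStable_hn_step hX H _).finrank_dvd
      (isStable_hn_step hX H _).finrank_dvd)
  have happ : X.hn = (∑ i ∈ J, Multiset.replicate (n i) (H.step i)).sort (· ≥ ·) ++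
      (∑ i ∈ Jᶜ, Multiset.replicate (n i) (H.step i)).sort (· ≥ ·) := by
    rw [hH]
    refine eq_sort_append_sort (fun i hi i' hi' => H.step_strictAnti ?_)
      (sortedGE_flatten_replicate _ H.step_strictAnti.antitone) (coe_flatten_replicate _ _)
    simp only [J, Finset.mem_filter, Finset.mem_univ, true_and] at hi hi'
    exact Fin.castSucc_lt_castSucc_iff.mp (hi.trans_le (not_lt.mp hi'))
  set l := (∑ i ∈ J, Multiset.replicate (n i) (H.step i)).sort (· ≥ ·) with hl
  set l' := (∑ i ∈ Jᶜ, Multiset.replicate (n i) (H.step i)).sort (· ≥ ·) with hl'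
  have hlen : l.length = q := by
    have h2 : (d : ℚ) * l.length = finrank (K₀ p k) (H.C j) := by
      rw [hl, length_sort_sum_replicate, Nat.cast_sum, Finset.mul_sum]
      simp only [hn]
      rw [sum_filter_castSucc_lt (fun i => (finrank (K₀ p k) (H.C i) : ℚ)), H.bot, finrank_bot,
        Nat.cast_zero, sub_zero]
    rw [← hq, Nat.cast_mul] at h2
    exact_mod_cast mul_left_cancel₀ hd0 h2
  have hsum : l.sum = y := by
    apply mul_left_cancel₀ hd0
    rw [hy, hl, sum_sort_sum_replicate, Finset.mul_sum]
    have h2 : ∀ i ∈ J, (d : ℚ) * (n i * H.step i) =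
        -(X.tNOn (H.C i.succ) : ℚ) - -(X.tNOn (H.C i.castSucc) : ℚ) := fun i _ => by
      rw [← mul_assoc, hn, mul_comm]
      exact (slope_mul (H.lt_succ i)).trans (by ring)
    rw [Finset.sum_congr rfl h2,
      sum_filter_castSucc_lt (fun i => -(X.tNOn (H.C i) : ℚ)), H.bot, tNOn_bot]
    simp
  rw [happ, ← hlen, ← hsum]
  have hpos : ∀ i, n i ≠ 0 := fun i h => by
    have h2 := hn i
    rw [h, Nat.cast_zero, mul_zero] at h2
    have h3 : (finrank (K₀ p k) (H.C i.castSucc) : ℚ) < finrank (K₀ p k) (H.C i.succ) :=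
      Nat.cast_lt.mpr (Submodule.finrank_lt_finrank_of_lt (H.lt_succ i))
    linarith
  refine isBreakPoint_append_of_lt ?_ ?_ fun a ha b hb => ?_
  · intro h2
    rw [h2, List.length_nil] at hlen
    rw [← hlen, mul_zero] at hq
    exact h0 (Submodule.finrank_eq_zero.mp hq.symm)
  · intro h2
    have hj : j ≠ Fin.last _ := by
      rintro rfl
      exact h1 H.top
    obtain ⟨i, hi⟩ := Fin.exists_castSucc_eq.mpr hj
    have h3 : ∑ i ∈ Jᶜ, n i = 0 := by
      rw [← length_sort_sum_replicate Jᶜ n H.step, ← hl', h2, List.length_nil]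
    refine hpos i (Finset.sum_eq_zero_iff.mp h3 i ?_)
    simp [J, hi]
  · obtain ⟨i, hi, rfl⟩ := mem_sort_sum_replicate ha
    obtain ⟨i', hi', rfl⟩ := mem_sort_sum_replicate hb
    simp only [J, Finset.mem_compl, Finset.mem_filter, Finset.mem_univ, true_and] at hi hi'
    exact H.step_strictAnti (Fin.castSucc_lt_castSucc_iff.mp (hi.trans_le (not_lt.mp hi')))

end FilteredIsocrystalWithCoeff

end HodgeNewton

end

open HodgeNewton FilteredIsocrystal FilteredIsocrystalWithCoeff in
theorem proposition3p7 {p : ℕ} [Fact p.Prime] {k : Type*} [Field k] [CharP k p] [PerfectRing k p]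
    {K : Type*} [Field K] [Algebra (HodgeNewton.K₀ p k) K]
    (hK : HodgeNewton.IsTotallyRamified p k K)
    {F : Type*} [Field F] [Algebra ℚ_[p] F] [FiniteDimensional ℚ_[p] F]
    {N : Type*} [AddCommGroup N] [Module (HodgeNewton.K₀ p k) N]
    [FiniteDimensional (HodgeNewton.K₀ p k) N]
    (X : HodgeNewton.FilteredIsocrystalWithCoeff p k K F N) (z : ℝ × ℝ)
    (hX : X.IsWeaklyAdmissible) (hz : X.IsHodgeNewtonReducibleAt z) :
    HodgeNewton.IsBreakPoint X.hn z ∧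
    (∃! A : Submodule (HodgeNewton.K₀ p k) N, X.IsHNSubobjectAt z A) ∧
    ∀ A : Submodule (HodgeNewton.K₀ p k) N, X.IsHNSubobjectAt z A →
      ∃ hA : X.IsStable A,
        (X.sub A hA).IsWeaklyAdmissible ∧
        (X.quot A hA).IsWeaklyAdmissible ∧
        HodgeNewton.IsRestriction (X.sub A hA).newton X.newton z.1 ∧
        HodgeNewton.IsRestriction (X.sub A hA).hodge X.hodge z.1 ∧
        HodgeNewton.IsRest (X.quot A hA).newton X.newton z ∧
        HodgeNewton.IsRest (X.quot A hA).hodge X.hodge z := by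
  obtain ⟨A, hA, ⟨c, c', hcc, hmax, hmax'⟩, hnewton, hlen, hsum, hdim, htN, hbot, htop⟩ :=
    exists_newton_eq_append hz.1
  obtain ⟨D⟩ : Nonempty X.toFilteredIsocrystal.SlopeDecomposition := by
    refine nonempty_slopeDecomposition fun h => ?_
    have h1 := hz.1.1.trans hz.1.2.1
    rw [h, List.length_nil, Nat.cast_zero] at h1
    exact lt_irrefl _ h1
  obtain ⟨b, hb⟩ := D.exists_le_tNOn
  have hd : (Module.finrank ℚ_[p] F : ℝ) ≠ 0 := Nat.cast_ne_zero.mpr Module.finrank_pos.ne'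
  have htN' : -(X.tNOn A : ℝ) = Module.finrank ℚ_[p] F * z.2 := by
    rw [← hsum]
    exact_mod_cast htN.symm
  have hdim' : (Module.finrank (K₀ p k) A : ℝ) = Module.finrank ℚ_[p] F * z.1 := by
    rw [← hlen]
    exact_mod_cast hdim.symm
  obtain ⟨hAa, hhodge, hhlen, hhsum⟩ := hodge_eq_append_of_liesOn hX hz.2 hA hlen hdim htN'
  have hstep : ∀ H : X.toFilteredIsocrystal.HNFiltration, ∃ j, H.C j = A := fun H =>
    exists_hn_step hX H hcc hAa (fun E hE => hmax E hE.stable) fun E hE => hmax' E hE.stable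
  have huniq : ∀ B, X.IsHNSubobjectAt z B → B = A := by
    rintro _ ⟨H, i, rfl, h1, h2⟩
    refine eq_of_deg_le hX hcc hAa (fun E hE => hmax E hE.stable)
      (fun E hE => hmax' E hE.stable) (H.isAdmissible i) ?_ ?_
    · rw [div_eq_iff hd, mul_comm, ← hdim'] at h1
      exact_mod_cast h1
    · rw [div_eq_iff hd, mul_comm, ← htN', ← tNOn_eq, neg_inj] at h2
      exact_mod_cast h2
  obtain ⟨H, hH⟩ := exists_hn_eq (nonempty_hnFiltration (fun E hE => hb E hE.stable) hX)
  obtain ⟨j, rfl⟩ := hstep H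
  refine ⟨?_, ⟨H.C j, ⟨H, j, rfl, ?_, ?_⟩, huniq⟩, fun B hB => ?_⟩
  · have hz' : z = (((X.sub _ hA).newton.length : ℝ), (((X.sub _ hA).newton.sum : ℚ) : ℝ)) :=
      Prod.ext hlen.symm hsum.symm
    rw [hz']
    exact isBreakPoint_hn hX hH hbot htop hdim htN
  · rw [hdim', mul_div_cancel_left₀ _ hd]
  · rw [← tNOn_eq, htN', mul_div_cancel_left₀ _ hd]
  · obtain rfl := huniq B hB
    refine ⟨hA, hX.sub hAa, hX.quot hAa, ?_, ?_, ?_, ?_⟩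
    · rw [hnewton]
      exact isRestriction_append _ _ hlen
    · rw [hhodge]
      exact isRestriction_append _ _ (by rw [hhlen, hlen])
    · rw [hnewton]
      exact isRest_append _ _ hlen hsum
    · rw [hhodge]
      exact isRest_append _ _ (by rw [hhlen, hlen]) hhsum
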